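/- Let $\mathcal G$ be a finite graph (loops and multiple edges allowed) with set $\mathcal D$ of directed edges; write $\hat d$ for the reversal of $d$, $\iota(d)$ and $\tau(d)$ for its initial and terminal vertex, and $L_d=L_{\hat d}>0$ for its length. Let $w$ be a real potential, continuous on each closed edge, with $w_d(x)=w_{\hat d}(L_d-x)$. Let $\Delta_w=-\frac{d^2}{dx^2}+w$ act on functions $(\psi_d)_{d\in\mathcal D}$ that are twice differentiable on the edges, satisfy $\psi_d(x)=\psi_{\hat d}(L_d-x)$, are continuous at the vertices and satisfy the Kirchhoff–Neumann conditions $\sum_{\iota(d)=v}\psi_d'(0)=0$ at every vertex $v$. Denote the positive eigenvalues of $\Delta_w$, repeated with multiplicity, by $k_n^2$ with $k_n>0$. Let $\psi_d^{\pm}$ be the solutions of $-\psi''+w_d\psi=k^2\psi$ on $[0,L_d]$ with $\psi_d^\pm(0)=1$, $(\psi_d^\pm)'(0)=\mp ik$. Let $T(k;w)$ be the $\mathcal D\times\mathcal D$ matrix with $$T_{dd}=\frac{2ik}{ik\,\psi_{\hat d}^+(L_d)-(\psi_{\hat d}^+)'(L_d)},\qquad T_{d\hat d}=-\frac{ik\,\psi_{\hat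 d}^-(L_d)-(\psi_{\hat d}^-)'(L_d)}{ik\,\psi_{\hat d}^+(L_d)-(\psi_{\hat d}^+)'(L_d)},$$ and all other entries zero, and let $\Sigma_{dd'}=-\delta_{\hat d,d'}+\frac{2}{\deg\iota(d)}$ if $\tau(d')=\iota(d)$ and $\Sigma_{dd'}=0$ otherwise. Let $\mathcal G^*$ be the bipartite graph obtained from $\mathcal G$ by inserting one extra vertex on each edge, and $PO^*$ the set of its periodic orbits (nonempty closed oriented walks, backtracking allowed, up to the choice of the starting point). For $p\in PO^*$ let $n_p$ be the number of edges it traverses and $n_{\tilde p}$ that of the primitive orbit $\tilde p$ of which $p$ is a repetition, and let $$\mathcal A_p(k)=\frac{n_{\tilde p}}{n_p}\,\frac{\partial}{\partial k}\prod\tau(k),$$ where the product has one factor for each vertex passage of $p$: the entry $\Sigma_{dd'}$ when $p$ passes through an original vertex from (the second half of) $d'$ to (the first half of) $d$, and the entry $T_{dd'}(k;w)$ when $p$ enters an inserted vertex along the first half of $d'$ and leaves it along the second half of $d$. Then there is a differentiable phase $\Theta_w:(0,\infty)\to\mathbb R$ with $\det T(k;w)=e^{i\Theta_w(k)}$ for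 all $k>0$, and there is a $K\ge 0$ such that, for every Schwartz function $\varphi:\mathbb R\to\mathbb C$ that extends holomorphically to a neighbourhood of the real line and every such phase $\Theta_w$, $$\sum_{k_n>K}\varphi(k_n)=\frac1{2\pi}\int_K^\infty\varphi(k)\,\frac{\partial\Theta_w(k)}{\partial k}\,dk+\frac1\pi\lim_{N\to\infty}\int_K^\infty\varphi(k)\;\mathrm{Im}\sum_{p\in PO^*,\;n_p\le N}\mathcal A_p(k)\,dk .$$ Here the sum on the left converges absolutely, the eigenvalues with $k_n>K$ have finite multiplicity, the orbit products are differentiable on $(K,\infty)$ and $\varphi\,\Theta_w'$ and all $\varphi\,\mathcal A_p$ are integrable there. (For real-valued $\varphi$ the imaginary part may be taken outside the integral.) -/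

import Mathlib

open scoped SchwartzMap

noncomputable section

namespace QuantumGraph

/-- A graph, loops and multiple edges allowed, in directed-edge notation: `D` is the set of
directed edges, `init d` is the initial vertex of `d`, and `rev d` is `d` traversed backwards. -/
structure DGraph (V D : Type*) where
  init : D → V
  rev : D → D
  rev_rev : ∀ d, rev (rev d) = d
  rev_ne : ∀ d, rev d ≠ d

namespace DGraph

variable {V D : Type*}

/-- Terminal vertex of a directed edge. -/
def term (G : DGraph V D) (d : D) : V := G.init (G.rev d)

/-- The degree of a vertex (a loop counts twice). -/
def degree [Fintype D] [DecidableEq V] (G : DGraph V D) (v : V) : ℕ :=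
  (Finset.univ.filter fun d => G.init d = v).card

/-- The undirected edges: directed edges up to reversal. -/
def Edge (G : DGraph V D) : Type _ := Quot fun d d' => d' = G.rev d

/-- The undirected edge underlying a directed edge. -/
def toEdge (G : DGraph V D) (d : D) : G.Edge := Quot.mk _ d

/-- The auxiliary bipartite graph with one extra vertex inserted on each edge.
The directed edge `Sum.inl d` is the first half of `d` (from `init d` to the inserted vertex),
`Sum.inr d` is the second half of `d` (from the inserted vertex to `term d`). -/
def subdivision (G : DGraph V D) : DGraph (V ⊕ G.Edge) (D ⊕ D) where
  init := Sum.elim (fun d => Sum.inl (G.init d)) (fun d => Sum.inr (G.toEdge d))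
  rev := Sum.elim (fun d => Sum.inr (G.rev d)) (fun d => Sum.inl (G.rev d))
  rev_rev := by rintro (d | d) <;> simp [G.rev_rev]
  rev_ne := by rintro (d | d) <;> simp

/-- Periodic orbits: nonempty closed oriented walks (backtracking allowed), up to the choice of
the starting point. -/
def PeriodicOrbit (G : DGraph V D) : Type _ :=
  {c : Cycle D // c ≠ Cycle.nil ∧ c.Chain fun a b => G.term a = G.init b}

namespace PeriodicOrbit

variable {G : DGraph V D}

/-- The topological length `n_p`. -/
def length (p : G.PeriodicOrbit) : ℕ := p.1.length

/-- The length of the primitive periodic orbit of which `p` is a repetition, that is, the smallest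
length of a walk of which `p` is a repetition. -/
def primLength (p : G.PeriodicOrbit) : ℕ :=
  sInf {m | ∃ (l : List D) (r : ℕ),
    l.length = m ∧ p.1 = (((List.replicate r l).flatten : List D) : Cycle D)}

theorem finite_length_le [Finite D] (N : ℕ) : {p : G.PeriodicOrbit | p.length ≤ N}.Finite := by
  have h : ((fun l : List D => (l : Cycle D)) '' {l | l.length ≤ N}).Finite :=
    (List.finite_length_le D N).image _
  refine Set.Finite.of_finite_image (f := Subtype.val) (h.subset ?_) Subtype.val_injective.injOn
  rintro _ ⟨⟨c, hc⟩, hp, rfl⟩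
  induction c using Quotient.inductionOn' with
  | h l => exact ⟨l, hp, rfl⟩

/-- The finite set of periodic orbits of length at most `N`. -/
def upTo (G : DGraph V D) [Finite D] (N : ℕ) : Finset G.PeriodicOrbit :=
  (finite_length_le (G := G) N).toFinset

end PeriodicOrbit

end DGraph

/-- The product of `τ b a` over all pairs `(a, b)` of consecutive entries of the closed list `l`
(`b` follows `a`; the first entry follows the last one). -/
def listProd {D : Type*} (τ : D → D → ℂ) (l : List D) : ℂ :=
  (List.zipWith (fun a b => τ b a) l (l.rotate 1)).prod

theorem listProd_isRotated {D : Type*} (τ : D → D → ℂ) {l l' : List D} (h : l.IsRotated l') :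
    listProd τ l = listProd τ l' := by
  obtain ⟨n, rfl⟩ := h
  have h1 : (l.rotate n).rotate 1 = (l.rotate 1).rotate n := by
    rw [List.rotate_rotate, List.rotate_rotate, add_comm]
  rw [listProd, listProd, h1, ← List.zipWith_rotate_distrib _ _ _ _ (by simp)]
  exact (List.IsRotated.perm ⟨n, rfl⟩).prod_eq

/-- The product of `τ b a` over all consecutive pairs `(a, b)` of a cycle, `b` following `a`. -/
def cycleProd {D : Type*} (τ : D → D → ℂ) (c : Cycle D) : ℂ :=
  Quotient.liftOn' c (listProd τ) fun _ _ h => listProd_isRotated τ h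

/-- A metric graph: a graph with a positive length for each edge. -/
structure MetricGraph (V D : Type*) extends DGraph V D where
  len : D → ℝ
  len_pos : ∀ d, 0 < len d
  len_rev : ∀ d, len (rev d) = len d

variable {V D : Type*}

/-- A real potential, continuous on every closed edge; `w d` is its expression in the coordinate
`x ∈ [0, len d]` of the directed edge `d`. -/
structure Potential (G : MetricGraph V D) where
  w : D → ℝ → ℝ
  cont : ∀ d, ContinuousOn (w d) (Set.Icc 0 (G.len d))
  w_rev : ∀ d, ∀ x ∈ Set.Icc 0 (G.len d), w d x = w (G.rev d) (G.len d - x)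

/-- Derivative of a function on the edge `[0, L]` (one-sided at the end points). -/
def edgeDeriv (L : ℝ) (f : ℝ → ℂ) : ℝ → ℂ := derivWithin f (Set.Icc 0 L)

/-- `f` is twice differentiable on `[0, L]`. -/
def TwiceDiff (L : ℝ) (f : ℝ → ℂ) : Prop :=
  DifferentiableOn ℝ f (Set.Icc 0 L) ∧ DifferentiableOn ℝ (edgeDeriv L f) (Set.Icc 0 L)

/-- The Schrödinger operator `-f'' + w f` on an edge of length `L`. -/
def edgeOp (L : ℝ) (w : ℝ → ℝ) (f : ℝ → ℂ) (x : ℝ) : ℂ :=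
  -edgeDeriv L (edgeDeriv L f) x + (w x : ℂ) * f x

theorem edgeDeriv_add {L : ℝ} {f g : ℝ → ℂ} (hf : DifferentiableOn ℝ f (Set.Icc 0 L))
    (hg : DifferentiableOn ℝ g (Set.Icc 0 L)) :
    ∀ x ∈ Set.Icc 0 L, edgeDeriv L (f + g) x = (edgeDeriv L f + edgeDeriv L g) x :=
  fun x hx => derivWithin_add (hf x hx) (hg x hx)

theorem edgeDeriv_smul {L : ℝ} (c : ℂ) {f : ℝ → ℂ} (hf : DifferentiableOn ℝ f (Set.Icc 0 L)) :
    ∀ x ∈ Set.Icc 0 L, edgeDeriv L (c • f) x = (c • edgeDeriv L f) x :=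
  fun x hx => derivWithin_const_smul c (hf x hx)

theorem edgeDeriv_congr {L : ℝ} {f g : ℝ → ℂ} (h : ∀ x ∈ Set.Icc 0 L, f x = g x) :
    ∀ x ∈ Set.Icc 0 L, edgeDeriv L f x = edgeDeriv L g x :=
  fun x hx => derivWithin_congr h (h x hx)

/-- The domain of the Schrödinger operator on the graph: twice differentiable functions on the
edges (extended by zero outside `[0, len d]`) that are invariant under a change of orientation,
continuous at the vertices, and satisfy the Kirchhoff-Neumann conditions. -/
def domain [Fintype D] [DecidableEq V] (G : MetricGraph V D) : Submodule ℂ (D → ℝ → ℂ) where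
  carrier := {f |
    (∀ d, ∀ x, x ∉ Set.Icc 0 (G.len d) → f d x = 0) ∧
    (∀ d, TwiceDiff (G.len d) (f d)) ∧
    (∀ d, ∀ x ∈ Set.Icc 0 (G.len d), f d x = f (G.rev d) (G.len d - x)) ∧
    (∀ d d', G.init d = G.init d' → f d 0 = f d' 0) ∧
    ∀ v, ∑ d with G.init d = v, edgeDeriv (G.len d) (f d) 0 = 0}
  zero_mem' := by
    have h : ∀ L : ℝ, edgeDeriv L 0 = 0 := fun L => by
      funext x; exact congrFun (derivWithin_const (Set.Icc 0 L) (0 : ℂ)) x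
    refine ⟨fun _ _ _ => rfl, fun d => ⟨?_, ?_⟩, fun _ _ _ => rfl, fun _ _ _ => rfl, fun v => ?_⟩
    · exact differentiableOn_const (0 : ℂ)
    · simp only [Pi.zero_apply, h]; exact differentiableOn_const (0 : ℂ)
    · simp [h]
  add_mem' := by
    rintro f g ⟨f1, f2, f3, f4, f5⟩ ⟨g1, g2, g3, g4, g5⟩
    refine ⟨fun d x hx => ?_, fun d => ⟨(f2 d).1.add (g2 d).1, ?_⟩, fun d x hx => ?_,
      fun d d' h => ?_, fun v => ?_⟩
    · simp [f1 d x hx, g1 d x hx]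
    · exact ((f2 d).2.add (g2 d).2).congr (edgeDeriv_add (f2 d).1 (g2 d).1)
    · simp [f3 d x hx, g3 d x hx]
    · simp [f4 d d' h, g4 d d' h]
    · have h := congrArg₂ (· + ·) (f5 v) (g5 v)
      simp only [← Finset.sum_add_distrib, add_zero] at h
      rw [← h]
      exact Finset.sum_congr rfl fun d _ =>
        edgeDeriv_add (f2 d).1 (g2 d).1 0 ⟨le_rfl, (G.len_pos d).le⟩
  smul_mem' := by
    rintro c f ⟨f1, f2, f3, f4, f5⟩
    refine ⟨fun d x hx => ?_, fun d => ⟨(f2 d).1.const_smul c, ?_⟩, fun d x hx => ?_,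
      fun d d' h => ?_, fun v => ?_⟩
    · simp [f1 d x hx]
    · exact ((f2 d).2.const_smul c).congr (edgeDeriv_smul c (f2 d).1)
    · simp [f3 d x hx]
    · simp [f4 d d' h]
    · have h := congrArg (c • ·) (f5 v)
      simp only [Finset.smul_sum, smul_zero] at h
      rw [← h]
      exact Finset.sum_congr rfl fun d _ =>
        edgeDeriv_smul c (f2 d).1 0 ⟨le_rfl, (G.len_pos d).le⟩

/-- The eigenspace of the Schrödinger operator of the graph for the spectral parameter `lam`. -/
def eigenspace [Fintype D] [DecidableEq V] (G : MetricGraph V D) (W : Potential G) (lam : ℂ) :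
    Submodule ℂ (D → ℝ → ℂ) where
  carrier := {f | f ∈ domain G ∧
    ∀ d, ∀ x ∈ Set.Icc 0 (G.len d), edgeOp (G.len d) (W.w d) (f d) x = lam * f d x}
  zero_mem' := by
    refine ⟨(domain G).zero_mem, fun d x hx => ?_⟩
    have h : ∀ L : ℝ, edgeDeriv L 0 = 0 := fun L => by
      funext x; exact congrFun (derivWithin_const (Set.Icc 0 L) (0 : ℂ)) x
    simp [edgeOp, h]
  add_mem' := by
    rintro f g ⟨hf, ef⟩ ⟨hg, eg⟩
    refine ⟨(domain G).add_mem hf hg, fun d x hx => ?_⟩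
    have h := edgeDeriv_congr (edgeDeriv_add (hf.2.1 d).1 (hg.2.1 d).1) x hx
    rw [edgeDeriv_add (hf.2.1 d).2 (hg.2.1 d).2 x hx] at h
    have h1 := ef d x hx
    have h2 := eg d x hx
    simp only [edgeOp, Pi.add_apply] at h h1 h2 ⊢
    rw [h]; linear_combination h1 + h2
  smul_mem' := by
    rintro c f ⟨hf, ef⟩
    refine ⟨(domain G).smul_mem c hf, fun d x hx => ?_⟩
    have h := edgeDeriv_congr (edgeDeriv_smul c (hf.2.1 d).1) x hx
    rw [edgeDeriv_smul c (hf.2.1 d).2 x hx] at h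
    have h1 := ef d x hx
    simp only [edgeOp, Pi.smul_apply, smul_eq_mul] at h h1 ⊢
    rw [h]; linear_combination c * h1

/-- The multiplicity of `k ^ 2` as an eigenvalue (zero if it is not an eigenvalue). -/
def multiplicity [Fintype D] [DecidableEq V] (G : MetricGraph V D) (W : Potential G) (k : ℝ) : ℕ :=
  Module.finrank ℂ (eigenspace G W ((k : ℂ) ^ 2))

/-- The solution on `[0, L]` of `-f'' + w f = k ^ 2 f` with `f 0 = 1` and `f' 0 = s`
(for continuous `w` it exists and is unique on `[0, L]`). -/
def edgeSolution (L : ℝ) (w : ℝ → ℝ) (k s : ℂ) : ℝ → ℂ :=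
  Classical.epsilon fun f : ℝ → ℂ =>
    TwiceDiff L f ∧ (∀ x ∈ Set.Icc 0 L, edgeOp L w f x = k ^ 2 * f x) ∧
      f 0 = 1 ∧ edgeDeriv L f 0 = s

/-- The incoming solution `ψ_d^+`, with `ψ 0 = 1`, `ψ' 0 = -i k`. -/
def psiPlus (G : MetricGraph V D) (W : Potential G) (k : ℂ) (d : D) : ℝ → ℂ :=
  edgeSolution (G.len d) (W.w d) k (-(Complex.I * k))

/-- The outgoing solution `ψ_d^-`, with `ψ 0 = 1`, `ψ' 0 = i k`. -/
def psiMinus (G : MetricGraph V D) (W : Potential G) (k : ℂ) (d : D) : ℝ → ℂ :=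
  edgeSolution (G.len d) (W.w d) k (Complex.I * k)

/-- The denominator of the entries `T_{dd}` and `T_{d, rev d}`: it equals
`i k ψ^+(L) - (ψ^+)'(L)` for the edge `rev d`. -/
def transDen (G : MetricGraph V D) (W : Potential G) (k : ℂ) (d : D) : ℂ :=
  Complex.I * k * psiPlus G W k (G.rev d) (G.len d) -
    edgeDeriv (G.len d) (psiPlus G W k (G.rev d)) (G.len d)

/-- The graph transition matrix `T(k; w)`. Its entry at `(d, d')` maps the amplitude of the wave
that leaves `init d'` along `d'` to that of the wave that arrives at `term d` along `d`;
the diagonal entries are transmission amplitudes, those at `(d, rev d)` reflection amplitudes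
of the edge potential. -/
def transitionMatrix [DecidableEq D] (G : MetricGraph V D) (W : Potential G) (k : ℂ) :
    Matrix D D ℂ :=
  Matrix.of fun d d' =>
    if d' = d then 2 * Complex.I * k / transDen G W k d
    else if d' = G.rev d then
      -(Complex.I * k * psiMinus G W k (G.rev d) (G.len d) -
        edgeDeriv (G.len d) (psiMinus G W k (G.rev d)) (G.len d)) / transDen G W k d
    else 0

/-- The relation that defines the transition matrix: if `a d ψ_d^+ + b d ψ_d^-` and
`a (rev d) ψ_{rev d}^+ + b (rev d) ψ_{rev d}^-` are the same function seen from the two ends of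
the edge, then the incoming amplitude `a (rev d)` at `term d` is obtained by applying the row `d`
of the transition matrix to the outgoing amplitudes `b`. -/
theorem transitionMatrix_spec [DecidableEq D] (G : MetricGraph V D) (W : Potential G) (k : ℂ)
    (d : D) (a b : D → ℂ) (hden : transDen G W k d ≠ 0)
    (h0 : a d + b d = a (G.rev d) * psiPlus G W k (G.rev d) (G.len d) +
      b (G.rev d) * psiMinus G W k (G.rev d) (G.len d))
    (h1 : a d * -(Complex.I * k) + b d * (Complex.I * k) =
      -(a (G.rev d) * edgeDeriv (G.len d) (psiPlus G W k (G.rev d)) (G.len d) +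
        b (G.rev d) * edgeDeriv (G.len d) (psiMinus G W k (G.rev d)) (G.len d))) :
    a (G.rev d) = transitionMatrix G W k d d * b d +
      transitionMatrix G W k d (G.rev d) * b (G.rev d) := by
  simp only [transitionMatrix, Matrix.of_apply, if_true, if_neg (G.rev_ne d)]
  field_simp
  unfold transDen
  linear_combination -(Complex.I * k) * h0 - h1

/-- The vertex scattering matrix `Σ` for Kirchhoff-Neumann conditions: scattering from `d'` to `d`
at the vertex `term d' = init d`. -/
def vertexMatrix [Fintype D] [DecidableEq V] [DecidableEq D] (G : MetricGraph V D) :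
    Matrix D D ℂ :=
  Matrix.of fun d d' =>
    if G.term d' = G.init d then
      -(if d' = G.rev d then 1 else 0) + 2 / (G.degree (G.init d) : ℂ)
    else 0

/-- The scattering amplitude from a directed edge `a` of the subdivided graph to the following one
`b`: an entry of the transition matrix at an inserted vertex, an entry of the vertex scattering
matrix at an original vertex. -/
def tau [Fintype D] [DecidableEq V] [DecidableEq D] (G : MetricGraph V D) (W : Potential G)
    (k : ℂ) : D ⊕ D → D ⊕ D → ℂ
  | Sum.inr d, Sum.inl d' => transitionMatrix G W k d d'
  | Sum.inl d, Sum.inr d' => vertexMatrix G d d'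
  | _, _ => 0

/-- The set `PO*` of periodic orbits of the auxiliary bipartite graph. -/
abbrev POStar (G : MetricGraph V D) : Type _ := G.toDGraph.subdivision.PeriodicOrbit

/-- The product of the scattering amplitudes along a periodic orbit. -/
def orbitProd [Fintype D] [DecidableEq V] [DecidableEq D] (G : MetricGraph V D) (W : Potential G)
    (p : POStar G) (k : ℝ) : ℂ :=
  cycleProd (tau G W (k : ℂ)) p.1

/-- The complex amplitude `A_p(k) = (n_{p̃} / n_p) ∂/∂k ∏ τ`. -/
def amplitude [Fintype D] [DecidableEq V] [DecidableEq D] (G : MetricGraph V D) (W : Potential G)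
    (p : POStar G) (k : ℝ) : ℂ :=
  (p.primLength : ℂ) / (p.length : ℂ) * deriv (orbitProd G W p) k

/-- `Θ` is a differentiable phase of `det T(k; w)` on the positive half line. -/
def IsPhase [Fintype D] [DecidableEq D] (G : MetricGraph V D) (W : Potential G) (Θ : ℝ → ℝ) :
    Prop :=
  ∀ k : ℝ, 0 < k → DifferentiableAt ℝ Θ k ∧
    (transitionMatrix G W (k : ℂ)).det = Complex.exp (Complex.I * (Θ k : ℂ))

/-- The function `φ` on the real line extends holomorphically to a neighbourhood of it. -/
def HasHolomorphicExtension (φ : ℝ → ℂ) : Prop :=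
  ∃ (U : Set ℂ) (F : ℂ → ℂ), IsOpen U ∧ (∀ x : ℝ, (x : ℂ) ∈ U) ∧ DifferentiableOn ℂ F U ∧
    ∀ x : ℝ, F (x : ℂ) = φ x

end QuantumGraph

end

/-!
# The trace formula for Schrödinger operators on a metric graph

For a real wave number `k > 0` let `U(k) = Σ T(k)` be the evolution matrix (`evol`). It is unitary,
since both factors are: for `T` this is Green's identity on the edges (`green_scattering`), for `Σ`
a direct computation. The solutions of the eigenvalue equation on the graph correspond to the
vectors fixed by `U(k)` (`multiplicity_eq`), so the spectrum is the set of `k` at which one of the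
eigenvalues `u_j(k)` of `U(k)` passes through `1`.

*Periodic orbits.* A periodic orbit is represented by as many closed words as its primitive length,
and two passages of vertices in the subdivided graph make up one application of `U`. Hence the sum
of the orbit products with `n_p ≤ N`, weighted by `n_p̃ / n_p`, is the sum of `tr U(k)ⁿ / n` over
`1 ≤ n ≤ N / 2` (`sum_orbitProd`). Its imaginary part is bounded uniformly in `N` and `k` and tends
to `Q(k) = ∑ j, s(u_j(k))`, where `s` is the sawtooth function of the circle (`abs_im_sum_le`,
`tendsto_im_sum`).

*Counting.* Since `s` is half of the phase of `-conj z`, the function `2 Q + Θ` is off the spectrum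
a phase of the constant `(-1) ^ |D| * conj (det Σ)`, hence locally constant there. At an eigenvalue
it jumps by `2 π` times the multiplicity, half of it on either side: Green's identity for two
different wave numbers shows that the quadratic form of `U'` on the fixed vectors of `U` has
positive imaginary part (`evol_deriv_pos`), so all eigenvalues that meet `1` cross it upwards
(`eventually_eig_side`). So `(Q + Θ / 2) / π` is, up to a constant, the counting function of the
spectrum (`eq_countBelow`).

*Trace formula.* Both terms on the right hand side are integrated by parts. The entries of `T` have
bounded derivatives on `[K, ∞)` for each `K > 0` (`isTame_transitionMatrix`), so there are no
problems at infinity, and dominated convergence gives `-∫ φ' · (Q + Θ / 2) / π` together with a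
boundary term at `K`. This is the integral of `-φ'` against the counting function of the spectrum
in `(K, ∞)`, that is, the sum of `φ` over the spectrum. Any `K > 0` outside the spectrum will do.
-/

noncomputable section

namespace QuantumGraph

/-! ### The Sturm-Liouville equation on an interval -/

/-- Global existence for `u'' = q u` on `[0, L]`. The Picard-Lindelöf theorem is applied to the
vector field truncated to a large ball; by Grönwall's inequality the solution never leaves the
ball on `[0, L]`. -/
theorem exists_secondOrder_solution {L : ℝ} (hL : 0 < L) {q : ℝ → ℝ} (hq : Continuous q)
    (p s : ℝ) :
    ∃ u v : ℝ → ℝ, u 0 = p ∧ v 0 = s ∧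
      ∀ x ∈ Set.Icc 0 L, HasDerivAt u (v x) x ∧ HasDerivAt v (q x * u x) x := by
  obtain ⟨B, hB⟩ := (isCompact_Icc (a := (-1 : ℝ)) (b := L + 1)).exists_bound_of_continuousOn
    hq.continuousOn
  set M : ℝ := max 1 B with hM
  have hM1 : 1 ≤ M := le_max_left _ _
  have hqM : ∀ t ∈ Set.Icc (-1 : ℝ) (L + 1), |q t| ≤ M := fun t ht =>
    (hB t ht).trans (le_max_right _ _)
  set R : ℝ := (‖(p, s)‖ + 1) * Real.exp (M * L) with hR
  have hR0 : 0 < R := by positivity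
  let c : ℝ → ℝ := fun x => max (min x R) (-R)
  have hc1 : ∀ x y, |c x - c y| ≤ |x - y| := fun x y =>
    (abs_max_sub_max_le_abs _ _ _).trans (by
      have := abs_min_sub_min_le_max x R y R
      simpa using this)
  have hc2 : ∀ x, |c x| ≤ R := fun x =>
    abs_le.2 ⟨le_max_right _ _, max_le (min_le_right _ _) (by linarith)⟩
  have hc4 : ∀ x, |x| ≤ R → c x = x := fun x hx => by
    have := abs_le.1 hx
    simp only [c]
    rw [min_eq_left this.2, max_eq_left this.1]
  have hc3 : ∀ x, |c x| ≤ |x| := fun x => by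
    have h0 : c 0 = 0 := hc4 0 (by simpa using hR0.le)
    simpa [h0] using hc1 x 0
  let f : ℝ → ℝ × ℝ → ℝ × ℝ := fun t y => (c y.2, q t * c y.1)
  have h0mem : (0 : ℝ) ∈ Set.Icc (-1 : ℝ) (L + 1) := ⟨by norm_num, by linarith⟩
  have hPL : IsPicardLindelof f (tmin := -1) (tmax := L + 1) ⟨0, h0mem⟩ (p, s)
      (Real.toNNReal (M * R * (L + 1))) 0 (Real.toNNReal (M * R)) (Real.toNNReal M) := by
    refine ⟨fun t ht => LipschitzOnWith.of_dist_le_mul fun y _ z _ => ?_, fun y _ => ?_,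
      fun t ht y _ => ?_, ?_⟩
    · rw [Real.coe_toNNReal _ (by linarith), Prod.dist_eq]
      have h1 : |y.1 - z.1| ≤ dist y z := by rw [Prod.dist_eq]; exact le_max_left _ _
      have h2 : |y.2 - z.2| ≤ dist y z := by rw [Prod.dist_eq]; exact le_max_right _ _
      refine max_le ?_ ?_
      · rw [Real.dist_eq]
        calc |c y.2 - c z.2| ≤ dist y z := (hc1 _ _).trans h2
          _ ≤ M * dist y z := le_mul_of_one_le_left dist_nonneg hM1
      · rw [Real.dist_eq]
        change |q t * c y.1 - q t * c z.1| ≤ _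
        rw [← mul_sub, abs_mul]
        exact mul_le_mul (hqM t ht) ((hc1 _ _).trans h1) (abs_nonneg _) (by linarith)
    · exact (continuous_const.prodMk (hq.mul continuous_const)).continuousOn
    · rw [Real.coe_toNNReal _ (by positivity)]
      refine max_le ?_ ?_
      · exact (hc2 _).trans (le_mul_of_one_le_left hR0.le hM1)
      · change ‖q t * c y.1‖ ≤ _
        rw [Real.norm_eq_abs, abs_mul]
        exact mul_le_mul (hqM t ht) (hc2 _) (abs_nonneg _) (by linarith)
    · rw [Real.coe_toNNReal _ (by positivity), Real.coe_toNNReal _ (by positivity)]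
      simp only [sub_zero, zero_sub, neg_neg, NNReal.coe_zero]
      rw [max_eq_left (by linarith)]
  obtain ⟨y, hy0, hy⟩ := hPL.exists_eq_forall_mem_Icc_hasDerivWithinAt₀
  simp only at hy0
  have hyd : ∀ x ∈ Set.Icc 0 L, HasDerivAt y (f x (y x)) x := fun x hx =>
    (hy x ⟨by linarith [hx.1], by linarith [hx.2]⟩).hasDerivAt
      (Icc_mem_nhds (by linarith [hx.1]) (by linarith [hx.2]))
  have hyR : ∀ x ∈ Set.Icc 0 L, ‖y x‖ ≤ R := fun x hx => by
    have := norm_le_gronwallBound_of_norm_deriv_right_le (f := y) (f' := fun x => f x (y x))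
      (δ := ‖(p, s)‖) (K := M) (ε := 0) (a := 0) (b := L)
      (fun x hx => (hyd x hx).continuousAt.continuousWithinAt)
      (fun x hx => (hyd x ⟨hx.1, hx.2.le⟩).hasDerivWithinAt) (by rw [hy0]) (fun x hx => by
        rw [add_zero]
        have h1 : |(y x).1| ≤ ‖y x‖ := norm_fst_le (y x)
        have h2 : |(y x).2| ≤ ‖y x‖ := norm_snd_le (y x)
        refine max_le ?_ ?_
        · exact ((hc3 _).trans h2).trans (le_mul_of_one_le_left (norm_nonneg _) hM1)
        · change ‖q x * c (y x).1‖ ≤ _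
          rw [Real.norm_eq_abs, abs_mul]
          exact mul_le_mul (hqM x ⟨by linarith [hx.1], by linarith [hx.2]⟩) ((hc3 _).trans h1)
            (abs_nonneg _) (by linarith)) x hx
    rw [gronwallBound_ε0, sub_zero] at this
    refine this.trans ?_
    rw [hR]
    have : Real.exp (M * x) ≤ Real.exp (M * L) :=
      Real.exp_le_exp.2 (mul_le_mul_of_nonneg_left hx.2 (by linarith))
    exact mul_le_mul (by linarith) this (Real.exp_pos _).le (by positivity)
  refine ⟨fun x => (y x).1, fun x => (y x).2, congrArg Prod.fst hy0, congrArg Prod.snd hy0,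
    fun x hx => ?_⟩
  have h1 : |(y x).1| ≤ R := (norm_fst_le (y x)).trans (hyR x hx)
  have h2 : |(y x).2| ≤ R := (norm_snd_le (y x)).trans (hyR x hx)
  have hd := hyd x hx
  have e : f x (y x) = ((y x).2, q x * (y x).1) := by
    simp only [f, hc4 _ h1, hc4 _ h2]
  rw [e] at hd
  exact ⟨hd.fst, hd.snd⟩

/-- `(u, v)` is a solution `v = u'`, `u'' = (w - k²) u` on `[0, L]`, with two-sided derivatives also
at the end points. -/
def IsSolution (L : ℝ) (w : ℝ → ℝ) (k : ℝ) (u v : ℝ → ℝ) : Prop :=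
  ∀ x ∈ Set.Icc 0 L, HasDerivAt u (v x) x ∧ HasDerivAt v ((w x - k ^ 2) * u x) x

theorem exists_isSolution {L : ℝ} (hL : 0 < L) {w : ℝ → ℝ} (hw : ContinuousOn w (Set.Icc 0 L))
    (k p s : ℝ) : ∃ y : (ℝ → ℝ) × (ℝ → ℝ), (y.1 0 = p ∧ y.2 0 = s) ∧ IsSolution L w k y.1 y.2 := by
  have hw' : Continuous (Set.IccExtend hL.le (Set.domRestrict (Set.Icc 0 L) w)) :=
    (continuousOn_iff_continuous_domRestrict.1 hw).Icc_extend'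
  obtain ⟨u, v, hu, hv, h⟩ := exists_secondOrder_solution hL
    (hw'.sub (continuous_const (y := k ^ 2))) p s
  refine ⟨(u, v), ⟨hu, hv⟩, fun x hx => ⟨(h x hx).1, ?_⟩⟩
  have := (h x hx).2
  rwa [Pi.sub_apply, Set.IccExtend_of_mem _ _ hx] at this

/-- The pair (solution, derivative) with initial values `p`, `s` at `0`. -/
def solPair (L : ℝ) (w : ℝ → ℝ) (p s k : ℝ) : (ℝ → ℝ) × (ℝ → ℝ) :=
  Classical.epsilon fun y => (y.1 0 = p ∧ y.2 0 = s) ∧ IsSolution L w k y.1 y.2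

/-- The cosine-type solution: `C(0) = 1`, `C'(0) = 0`. -/
def cosSol (L : ℝ) (w : ℝ → ℝ) (k : ℝ) : ℝ → ℝ := (solPair L w 1 0 k).1

/-- The derivative of `cosSol`. -/
def cosSol' (L : ℝ) (w : ℝ → ℝ) (k : ℝ) : ℝ → ℝ := (solPair L w 1 0 k).2

/-- The sine-type solution: `S(0) = 0`, `S'(0) = 1`. -/
def sinSol (L : ℝ) (w : ℝ → ℝ) (k : ℝ) : ℝ → ℝ := (solPair L w 0 1 k).1

/-- The derivative of `sinSol`. -/
def sinSol' (L : ℝ) (w : ℝ → ℝ) (k : ℝ) : ℝ → ℝ := (solPair L w 0 1 k).2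

section
variable {L : ℝ} {w : ℝ → ℝ}

theorem solPair_spec (hL : 0 < L) (hw : ContinuousOn w (Set.Icc 0 L)) (p s k : ℝ) :
    ((solPair L w p s k).1 0 = p ∧ (solPair L w p s k).2 0 = s) ∧
      IsSolution L w k (solPair L w p s k).1 (solPair L w p s k).2 :=
  Classical.epsilon_spec (exists_isSolution hL hw k p s)

theorem cosSol_isSolution (hL : 0 < L) (hw : ContinuousOn w (Set.Icc 0 L)) (k : ℝ) :
    IsSolution L w k (cosSol L w k) (cosSol' L w k) := (solPair_spec hL hw 1 0 k).2

theorem sinSol_isSolution (hL : 0 < L) (hw : ContinuousOn w (Set.Icc 0 L)) (k : ℝ) :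
    IsSolution L w k (sinSol L w k) (sinSol' L w k) := (solPair_spec hL hw 0 1 k).2

theorem cosSol_zero (hL : 0 < L) (hw : ContinuousOn w (Set.Icc 0 L)) (k : ℝ) :
    cosSol L w k 0 = 1 := (solPair_spec hL hw 1 0 k).1.1

theorem cosSol'_zero (hL : 0 < L) (hw : ContinuousOn w (Set.Icc 0 L)) (k : ℝ) :
    cosSol' L w k 0 = 0 := (solPair_spec hL hw 1 0 k).1.2

theorem sinSol_zero (hL : 0 < L) (hw : ContinuousOn w (Set.Icc 0 L)) (k : ℝ) :
    sinSol L w k 0 = 0 := (solPair_spec hL hw 0 1 k).1.1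

theorem sinSol'_zero (hL : 0 < L) (hw : ContinuousOn w (Set.Icc 0 L)) (k : ℝ) :
    sinSol' L w k 0 = 1 := (solPair_spec hL hw 0 1 k).1.2

theorem IsSolution.continuousOn {k : ℝ} {u v : ℝ → ℝ} (h : IsSolution L w k u v) :
    ContinuousOn u (Set.Icc 0 L) :=
  fun x hx => (h x hx).1.continuousAt.continuousWithinAt

/-- Green's identity for two solutions belonging to different spectral parameters. -/
theorem IsSolution.wronskian {k l : ℝ} {u v p q : ℝ → ℝ}
    (h : IsSolution L w k u v) (h' : IsSolution L w l p q) {x : ℝ} (hx : x ∈ Set.Icc 0 L) :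
    u x * q x - v x * p x =
      u 0 * q 0 - v 0 * p 0 + (k ^ 2 - l ^ 2) * ∫ t in (0 : ℝ)..x, u t * p t := by
  have hsub : Set.uIcc 0 x ⊆ Set.Icc 0 L := by
    rw [Set.uIcc_of_le hx.1]; exact Set.Icc_subset_Icc_right hx.2
  have hder : ∀ t ∈ Set.uIcc 0 x, HasDerivAt (fun t => u t * q t - v t * p t)
      ((k ^ 2 - l ^ 2) * (u t * p t)) t := fun t ht => by
    have h1 := h t (hsub ht)
    have h2 := h' t (hsub ht)
    refine ((h1.1.mul h2.2).sub (h1.2.mul h2.1)).congr_deriv ?_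
    ring
  have := intervalIntegral.integral_eq_sub_of_hasDerivAt hder
    (((h.continuousOn.mul h'.continuousOn).mono hsub).const_smul (k ^ 2 - l ^ 2)).intervalIntegrable
  rw [intervalIntegral.integral_const_mul] at this
  rw [this]; ring

theorem fundamental_det (hL : 0 < L) (hw : ContinuousOn w (Set.Icc 0 L)) (k : ℝ) {x : ℝ}
    (hx : x ∈ Set.Icc 0 L) :
    cosSol L w k x * sinSol' L w k x - cosSol' L w k x * sinSol L w k x = 1 := by
  rw [(cosSol_isSolution hL hw k).wronskian (sinSol_isSolution hL hw k) hx,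
    cosSol_zero hL hw, sinSol'_zero hL hw, cosSol'_zero hL hw]
  ring

/-- The energy bound: `u² + (u'/k)²` grows at most by the factor `exp (B L / k)`. -/
theorem IsSolution.energy_le {k B : ℝ} (hk : 0 < k) (hB : ∀ x ∈ Set.Icc 0 L, |w x| ≤ B)
    {u v : ℝ → ℝ} (h : IsSolution L w k u v) {x : ℝ} (hx : x ∈ Set.Icc 0 L) :
    u x ^ 2 + (v x / k) ^ 2 ≤ (u 0 ^ 2 + (v 0 / k) ^ 2) * Real.exp (B / k * x) := by
  have hder : ∀ t ∈ Set.Icc 0 L, HasDerivAt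
      (fun t => (u t ^ 2 + (v t / k) ^ 2) * Real.exp (-(B / k * t)))
      ((2 * w t / k * (u t * (v t / k))  - B / k * (u t ^ 2 + (v t / k) ^ 2)) *
        Real.exp (-(B / k * t))) t := fun t ht => by
    have h1 := h t ht
    have h2 : HasDerivAt (fun t : ℝ => Real.exp (-(B / k * t)))
        (Real.exp (-(B / k * t)) * (-(B / k * 1))) t :=
      (((hasDerivAt_id t).const_mul (B / k)).neg).exp
    have h3 := ((h1.1.pow 2).add ((h1.2.div_const k).pow 2)).mul h2
    refine h3.congr_deriv ?_
    have hk' : k ≠ 0 := hk.ne'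
    simp only [Pi.pow_apply, Pi.add_apply, Nat.cast_ofNat, Nat.add_one_sub_one, pow_one]
    field_simp
    ring
  have hanti : AntitoneOn (fun t => (u t ^ 2 + (v t / k) ^ 2) * Real.exp (-(B / k * t)))
      (Set.Icc 0 L) := by
    refine antitoneOn_of_hasDerivWithinAt_nonpos (convex_Icc 0 L)
      (fun t ht => (hder t ht).continuousAt.continuousWithinAt)
      (fun t ht => (hder t (interior_subset ht)).hasDerivWithinAt) fun t ht => ?_
    have ht' := interior_subset ht
    refine mul_nonpos_of_nonpos_of_nonneg ?_ (Real.exp_pos _).le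
    have hb := hB t ht'
    have h1 : 2 * w t / k * (u t * (v t / k)) ≤ B / k * (2 * |u t * (v t / k)|) := by
      have : w t * (u t * (v t / k)) ≤ B * |u t * (v t / k)| :=
        (le_abs_self _).trans (by rw [abs_mul]; exact mul_le_mul_of_nonneg_right hb (abs_nonneg _))
      calc 2 * w t / k * (u t * (v t / k)) = 2 / k * (w t * (u t * (v t / k))) := by ring
        _ ≤ 2 / k * (B * |u t * (v t / k)|) := mul_le_mul_of_nonneg_left this (by positivity)
        _ = _ := by ring
    have h2 : 2 * |u t * (v t / k)| ≤ u t ^ 2 + (v t / k) ^ 2 := by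
      rw [abs_mul]
      nlinarith [sq_nonneg (|u t| - |v t / k|), sq_abs (u t), sq_abs (v t / k)]
    have hB0 : 0 ≤ B / k := div_nonneg ((abs_nonneg _).trans hb) hk.le
    nlinarith [mul_le_mul_of_nonneg_left h2 hB0]
  have h0 : (0 : ℝ) ∈ Set.Icc 0 L := ⟨le_rfl, hx.1.trans hx.2⟩
  have h1 := hanti h0 hx hx.1
  simp only [mul_zero, neg_zero, Real.exp_zero, mul_one] at h1
  calc u x ^ 2 + (v x / k) ^ 2
      = (u x ^ 2 + (v x / k) ^ 2) * Real.exp (-(B / k * x)) * Real.exp (B / k * x) := by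
        rw [mul_assoc, ← Real.exp_add]; simp
    _ ≤ _ := mul_le_mul_of_nonneg_right h1 (Real.exp_pos _).le

/-- Bounds for the fundamental solutions, uniform in `k ≥ K`. -/
theorem exists_fundamental_bound (hL : 0 < L) (hw : ContinuousOn w (Set.Icc 0 L)) {K : ℝ}
    (hK : 0 < K) : ∃ A : ℝ, 0 ≤ A ∧ ∀ k, K ≤ k → ∀ x ∈ Set.Icc 0 L,
      |cosSol L w k x| ≤ A ∧ |cosSol' L w k x / k| ≤ A ∧
      |k * sinSol L w k x| ≤ A ∧ |sinSol' L w k x| ≤ A := by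
  obtain ⟨B, hB⟩ := isCompact_Icc.exists_bound_of_continuousOn hw
  have hB0 : 0 ≤ B := (norm_nonneg _).trans (hB 0 ⟨le_rfl, hL.le⟩)
  refine ⟨Real.exp (B / K * L), (Real.exp_pos _).le, fun k hk x hx => ?_⟩
  have hk0 : 0 < k := hK.trans_le hk
  have h1 : (1 : ℝ) ≤ Real.exp (B / K * L) := Real.one_le_exp (by positivity)
  have h2 : Real.exp (B / k * x) ≤ Real.exp (B / K * L) := by
    refine Real.exp_le_exp.2 (mul_le_mul ?_ hx.2 hx.1 (by positivity))
    exact div_le_div_of_nonneg_left hB0 hK hk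
  have hc := (cosSol_isSolution hL hw k).energy_le hk0 hB hx
  have hs := (sinSol_isSolution hL hw k).energy_le hk0 hB hx
  rw [cosSol_zero hL hw, cosSol'_zero hL hw] at hc
  rw [sinSol_zero hL hw, sinSol'_zero hL hw] at hs
  have hs' : (k * sinSol L w k x) ^ 2 + sinSol' L w k x ^ 2 ≤ Real.exp (B / k * x) := by
    have := mul_le_mul_of_nonneg_left hs (sq_nonneg k)
    calc _ = k ^ 2 * (sinSol L w k x ^ 2 + (sinSol' L w k x / k) ^ 2) := by
          field_simp
      _ ≤ _ := this
      _ = _ := by field_simp; ring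
  simp only [zero_div, ne_eq, OfNat.ofNat_ne_zero, not_false_eq_true, zero_pow, one_pow, add_zero,
    one_mul] at hc
  have key : ∀ y : ℝ, y ^ 2 ≤ Real.exp (B / K * L) → |y| ≤ Real.exp (B / K * L) := fun y hy => by
    apply abs_le_of_sq_le_sq _ (Real.exp_pos _).le
    nlinarith
  exact ⟨key _ (by nlinarith [sq_nonneg (cosSol' L w k x / k)]),
    key _ (by nlinarith [sq_nonneg (cosSol L w k x)]),
    key _ (by nlinarith [sq_nonneg (sinSol' L w k x)]),
    key _ (by nlinarith [sq_nonneg (k * sinSol L w k x)])⟩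

end

end QuantumGraph

end

noncomputable section

namespace QuantumGraph

open Filter Topology

/-! ### Dependence of the fundamental solutions on the wave number -/

/-- A family of solutions, indexed by the wave number, with initial values that do not depend on
the wave number and with bounds that are uniform for `k ≥ K`. -/
structure IsSolutionFamily (L : ℝ) (w : ℝ → ℝ) (u v : ℝ → ℝ → ℝ) : Prop where
  sol : ∀ k, IsSolution L w k (u k) (v k)
  init : ∀ k l, u k 0 = u l 0 ∧ v k 0 = v l 0
  bdd : ∀ K, 0 < K → ∃ A, ∀ k, K ≤ k → ∀ x ∈ Set.Icc 0 L, |u k x| ≤ A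

section
variable {L : ℝ} {w : ℝ → ℝ}

theorem isSolutionFamily_cosSol (hL : 0 < L) (hw : ContinuousOn w (Set.Icc 0 L)) :
    IsSolutionFamily L w (cosSol L w) (cosSol' L w) where
  sol := cosSol_isSolution hL hw
  init k l := by simp [cosSol_zero hL hw, cosSol'_zero hL hw]
  bdd K hK := by
    obtain ⟨A, _, hA⟩ := exists_fundamental_bound hL hw hK
    exact ⟨A, fun k hk x hx => (hA k hk x hx).1⟩

theorem isSolutionFamily_sinSol (hL : 0 < L) (hw : ContinuousOn w (Set.Icc 0 L)) :
    IsSolutionFamily L w (sinSol L w) (sinSol' L w) where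
  sol := sinSol_isSolution hL hw
  init k l := by simp [sinSol_zero hL hw, sinSol'_zero hL hw]
  bdd K hK := by
    obtain ⟨A, hA0, hA⟩ := exists_fundamental_bound hL hw hK
    refine ⟨A / K, fun k hk x hx => ?_⟩
    have h := (hA k hk x hx).2.2.1
    have hk0 : 0 < k := hK.trans_le hk
    rw [abs_mul, abs_of_pos hk0] at h
    rw [le_div_iff₀ hK]
    nlinarith [abs_nonneg (sinSol L w k x)]

namespace IsSolutionFamily

variable {u v p q : ℝ → ℝ → ℝ}

/-- Variation of constants: comparison of the members of a family at two wave numbers. -/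
theorem variation (hL : 0 < L) (hw : ContinuousOn w (Set.Icc 0 L))
    (h : IsSolutionFamily L w u v) (k l : ℝ) {x : ℝ} (hx : x ∈ Set.Icc 0 L) :
    u l x - u k x = (l ^ 2 - k ^ 2) *
        (cosSol L w k x * (∫ t in (0 : ℝ)..x, u l t * sinSol L w k t) -
          sinSol L w k x * ∫ t in (0 : ℝ)..x, u l t * cosSol L w k t) ∧
    v l x - v k x = (l ^ 2 - k ^ 2) *
        (cosSol' L w k x * (∫ t in (0 : ℝ)..x, u l t * sinSol L w k t) -
          sinSol' L w k x * ∫ t in (0 : ℝ)..x, u l t * cosSol L w k t) := by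
  have hS := sinSol_isSolution hL hw k
  have hC := cosSol_isSolution hL hw k
  have hdet := fundamental_det hL hw k hx
  have e1 := (h.sol l).wronskian hS hx
  have e2 := (h.sol l).wronskian hC hx
  have e3 := (h.sol k).wronskian hS hx
  have e4 := (h.sol k).wronskian hC hx
  rw [(h.init l k).1, (h.init l k).2] at e1 e2
  have e5 : (u l x - u k x) * sinSol' L w k x - (v l x - v k x) * sinSol L w k x =
      (l ^ 2 - k ^ 2) * ∫ t in (0 : ℝ)..x, u l t * sinSol L w k t := by
    linear_combination e1 - e3
  have e6 : (u l x - u k x) * cosSol' L w k x - (v l x - v k x) * cosSol L w k x =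
      (l ^ 2 - k ^ 2) * ∫ t in (0 : ℝ)..x, u l t * cosSol L w k t := by
    linear_combination e2 - e4
  constructor
  · linear_combination -(u l x - u k x) * hdet + cosSol L w k x * e5 - sinSol L w k x * e6
  · linear_combination -(v l x - v k x) * hdet + cosSol' L w k x * e5 - sinSol' L w k x * e6

theorem eventually_bdd (h : IsSolutionFamily L w u v) {k : ℝ} (hk : 0 < k) :
    ∃ A, 0 ≤ A ∧ ∀ᶠ l in 𝓝 k, ∀ x ∈ Set.Icc 0 L, |u l x| ≤ A := by
  obtain ⟨A, hA⟩ := h.bdd (k / 2) (by linarith)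
  refine ⟨|A|, abs_nonneg _, ?_⟩
  filter_upwards [Ici_mem_nhds (show k / 2 < k by linarith)] with l hl x hx
  exact (hA l hl x hx).trans (le_abs_self _)

theorem intervalIntegrable_mul (h : IsSolutionFamily L w u v) (h' : IsSolutionFamily L w p q)
    (k l : ℝ) {x : ℝ} (hx : x ∈ Set.Icc 0 L) :
    IntervalIntegrable (fun t => u k t * p l t) MeasureTheory.volume 0 x := by
  refine ContinuousOn.intervalIntegrable ?_
  rw [Set.uIcc_of_le hx.1]
  exact ((h.sol k).continuousOn.mul (h'.sol l).continuousOn).mono (Set.Icc_subset_Icc_right hx.2)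

theorem tendsto (hL : 0 < L) (hw : ContinuousOn w (Set.Icc 0 L)) (h : IsSolutionFamily L w u v)
    {k : ℝ} (hk : 0 < k) {x : ℝ} (hx : x ∈ Set.Icc 0 L) :
    ContinuousAt (fun l => u l x) k ∧ ContinuousAt (fun l => v l x) k := by
  obtain ⟨A, hA0, hA⟩ := h.eventually_bdd hk
  have hint : ∀ {p q}, IsSolutionFamily L w p q → ∃ B, ∀ᶠ l in 𝓝 k,
      ‖∫ t in (0 : ℝ)..x, u l t * p k t‖ ≤ B := by
    intro p q h'
    obtain ⟨A', hA'0, hA'⟩ := h'.eventually_bdd hk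
    refine ⟨A * A' * |x - 0|, ?_⟩
    filter_upwards [hA] with l hl
    refine intervalIntegral.norm_integral_le_of_norm_le_const fun t ht => ?_
    rw [Set.uIoc_of_le hx.1] at ht
    have ht' : t ∈ Set.Icc 0 L := ⟨ht.1.le, ht.2.trans hx.2⟩
    rw [norm_mul]
    exact mul_le_mul (hl t ht') (hA'.self_of_nhds t ht') (norm_nonneg _) hA0
  obtain ⟨B1, hB1⟩ := hint (isSolutionFamily_sinSol hL hw)
  obtain ⟨B2, hB2⟩ := hint (isSolutionFamily_cosSol hL hw)
  have h0 : Tendsto (fun l : ℝ => l ^ 2 - k ^ 2) (𝓝 k) (𝓝 0) := by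
    have : ContinuousAt (fun l : ℝ => l ^ 2 - k ^ 2) k := by fun_prop
    simpa [ContinuousAt] using this
  have key : ∀ (a b : ℝ) (f : ℝ → ℝ), (∀ l, f l - f k = (l ^ 2 - k ^ 2) *
      (a * (∫ t in (0 : ℝ)..x, u l t * sinSol L w k t) -
          b * ∫ t in (0 : ℝ)..x, u l t * cosSol L w k t)) → ContinuousAt f k := by
    intro a b f hf
    have h1 : Tendsto (fun l => f l - f k) (𝓝 k) (𝓝 0) := by
      simp only [hf]
      refine h0.zero_mul_isBoundedUnder_le ⟨|a| * B1 + |b| * B2, ?_⟩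
      rw [eventually_map]
      filter_upwards [hB1, hB2] with l h1 h2
      simp only [Function.comp]
      refine (norm_sub_le _ _).trans ?_
      rw [norm_mul, norm_mul]
      exact add_le_add (mul_le_mul_of_nonneg_left h1 (abs_nonneg _))
        (mul_le_mul_of_nonneg_left h2 (abs_nonneg _))
    simpa [ContinuousAt] using h1.add_const (f k)
  exact ⟨key _ _ _ fun l => (h.variation hL hw k l hx).1,
    key _ _ _ fun l => (h.variation hL hw k l hx).2⟩

theorem tendsto_integral (hL : 0 < L) (hw : ContinuousOn w (Set.Icc 0 L))
    (h : IsSolutionFamily L w u v) (h' : IsSolutionFamily L w p q)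
    {k : ℝ} (hk : 0 < k) {x : ℝ} (hx : x ∈ Set.Icc 0 L) {g : ℝ → ℝ}
    (hg : ContinuousAt g k) (hgk : g k = k) :
    ContinuousAt (fun l => ∫ t in (0 : ℝ)..x, u l t * p (g l) t) k := by
  obtain ⟨A, hA0, hA⟩ := h.eventually_bdd hk
  obtain ⟨A', hA'0, hA'⟩ := h'.eventually_bdd hk
  have hg' : Tendsto g (𝓝 k) (𝓝 k) := by simpa [ContinuousAt, hgk] using hg
  refine intervalIntegral.tendsto_integral_filter_of_dominated_convergence (fun _ => A * A')
    (.of_forall fun l => ?_) ?_ intervalIntegrable_const (.of_forall fun t ht => ?_)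
  · exact (h.intervalIntegrable_mul h' l (g l) hx).def'.aestronglyMeasurable
  · filter_upwards [hA, hg'.eventually hA'] with l h1 h2
    refine .of_forall fun t ht => ?_
    rw [Set.uIoc_of_le hx.1] at ht
    have ht' : t ∈ Set.Icc 0 L := ⟨ht.1.le, ht.2.trans hx.2⟩
    rw [norm_mul]
    exact mul_le_mul (h1 t ht') (h2 t ht') (norm_nonneg _) hA0
  · rw [Set.uIoc_of_le hx.1] at ht
    have ht' : t ∈ Set.Icc 0 L := ⟨ht.1.le, ht.2.trans hx.2⟩
    have h2 := (h'.tendsto hL hw hk ht').1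
    exact Tendsto.mul (h.tendsto hL hw hk ht').1 (by rw [hgk]; exact Tendsto.comp h2 hg')

/-- The derivative of a family with respect to the wave number. -/
theorem hasDerivAt (hL : 0 < L) (hw : ContinuousOn w (Set.Icc 0 L)) (h : IsSolutionFamily L w u v)
    {k : ℝ} (hk : 0 < k) {x : ℝ} (hx : x ∈ Set.Icc 0 L) :
    HasDerivAt (fun l => u l x) (2 * k *
        (cosSol L w k x * (∫ t in (0 : ℝ)..x, u k t * sinSol L w k t) -
          sinSol L w k x * ∫ t in (0 : ℝ)..x, u k t * cosSol L w k t)) k ∧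
    HasDerivAt (fun l => v l x) (2 * k *
        (cosSol' L w k x * (∫ t in (0 : ℝ)..x, u k t * sinSol L w k t) -
          sinSol' L w k x * ∫ t in (0 : ℝ)..x, u k t * cosSol L w k t)) k := by
  have i1 := h.tendsto_integral hL hw (isSolutionFamily_sinSol hL hw) hk hx
    (g := fun _ => k) continuousAt_const rfl
  have i2 := h.tendsto_integral hL hw (isSolutionFamily_cosSol hL hw) hk hx
    (g := fun _ => k) continuousAt_const rfl
  have key : ∀ (a b : ℝ) (f : ℝ → ℝ), (∀ l, f l - f k = (l ^ 2 - k ^ 2) *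
      (a * (∫ t in (0 : ℝ)..x, u l t * sinSol L w k t) -
          b * ∫ t in (0 : ℝ)..x, u l t * cosSol L w k t)) →
      HasDerivAt f (2 * k * (a * (∫ t in (0 : ℝ)..x, u k t * sinSol L w k t) -
          b * ∫ t in (0 : ℝ)..x, u k t * cosSol L w k t)) k := by
    intro a b f hf
    rw [hasDerivAt_iff_tendsto_slope]
    have hc : ContinuousAt (fun l => (l + k) *
        (a * (∫ t in (0 : ℝ)..x, u l t * sinSol L w k t) -
          b * ∫ t in (0 : ℝ)..x, u l t * cosSol L w k t)) k :=
      (continuousAt_id.add continuousAt_const).mul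
        ((continuousAt_const.mul i1).sub (continuousAt_const.mul i2))
    have hc' := hc.tendsto.mono_left (nhdsWithin_le_nhds (s := {k}ᶜ))
    rw [← two_mul] at hc'
    refine hc'.congr' ?_
    filter_upwards [self_mem_nhdsWithin] with l hl
    have hl' : l - k ≠ 0 := sub_ne_zero.2 hl
    rw [slope_def_field, hf l]
    field_simp
    ring
  exact ⟨key _ _ _ fun l => (h.variation hL hw k l hx).1,
    key _ _ _ fun l => (h.variation hL hw k l hx).2⟩

end IsSolutionFamily

end

/-- `f` is continuously differentiable on the positive half line, and `f` and its derivative are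
bounded on `[K, ∞)` for every `K > 0`. -/
structure IsTame (f : ℝ → ℂ) : Prop where
  diff : ∀ k, 0 < k → DifferentiableAt ℝ f k
  cont : ContinuousOn (deriv f) (Set.Ioi 0)
  bdd : ∀ K, 0 < K → ∃ C, 0 ≤ C ∧ ∀ k, K ≤ k → ‖f k‖ ≤ C ∧ ‖deriv f k‖ ≤ C

namespace IsTame

theorem of_hasDerivAt {f f' : ℝ → ℂ} (h : ∀ k, 0 < k → HasDerivAt f (f' k) k)
    (hc : ∀ k, 0 < k → ContinuousAt f' k)
    (hb : ∀ K, 0 < K → ∃ C, ∀ k, K ≤ k → ‖f k‖ ≤ C)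
    (hb' : ∀ K, 0 < K → ∃ C, ∀ k, K ≤ k → ‖f' k‖ ≤ C) : IsTame f where
  diff k hk := (h k hk).differentiableAt
  cont := by
    have : ContinuousOn f' (Set.Ioi 0) := fun k hk => (hc k hk).continuousWithinAt
    exact this.congr fun k hk => (h k hk).deriv
  bdd K hK := by
    obtain ⟨C, hC⟩ := hb K hK
    obtain ⟨C', hC'⟩ := hb' K hK
    refine ⟨max (max C C') 0, le_max_right _ _, fun k hk => ⟨(hC k hk).trans ?_, ?_⟩⟩
    · exact (le_max_left _ _).trans (le_max_left _ _)
    · rw [(h k (hK.trans_le hk)).deriv]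
      exact (hC' k hk).trans ((le_max_right _ _).trans (le_max_left _ _))

variable {f g : ℝ → ℂ}

theorem contAt (hf : IsTame f) {k : ℝ} (hk : 0 < k) : ContinuousAt (deriv f) k :=
  hf.cont.continuousAt (Ioi_mem_nhds hk)

theorem const (c : ℂ) : IsTame fun _ => c :=
  of_hasDerivAt (f' := fun _ => 0) (fun k _ => hasDerivAt_const k c)
    (fun _ _ => continuousAt_const) (fun _ _ => ⟨‖c‖, fun _ _ => le_rfl⟩)
    (fun _ _ => ⟨0, fun _ _ => by simp⟩)

theorem add (hf : IsTame f) (hg : IsTame g) : IsTame fun k => f k + g k := by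
  refine of_hasDerivAt (f' := fun k => deriv f k + deriv g k)
    (fun k hk => (hf.diff k hk).hasDerivAt.add (hg.diff k hk).hasDerivAt)
    (fun k hk => (hf.contAt hk).add (hg.contAt hk)) (fun K hK => ?_) (fun K hK => ?_)
  all_goals
    obtain ⟨C, _, hC⟩ := hf.bdd K hK
    obtain ⟨C', _, hC'⟩ := hg.bdd K hK
    refine ⟨C + C', fun k hk => (norm_add_le _ _).trans ?_⟩
  · exact add_le_add (hC k hk).1 (hC' k hk).1
  · exact add_le_add (hC k hk).2 (hC' k hk).2

theorem mul (hf : IsTame f) (hg : IsTame g) : IsTame fun k => f k * g k := by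
  refine of_hasDerivAt (f' := fun k => deriv f k * g k + f k * deriv g k)
    (fun k hk => (hf.diff k hk).hasDerivAt.mul (hg.diff k hk).hasDerivAt)
    (fun k hk => ((hf.contAt hk).mul (hg.diff k hk).continuousAt).add
      ((hf.diff k hk).continuousAt.mul (hg.contAt hk))) (fun K hK => ?_) (fun K hK => ?_)
  all_goals
    obtain ⟨C, hC0, hC⟩ := hf.bdd K hK
    obtain ⟨C', hC'0, hC'⟩ := hg.bdd K hK
  · refine ⟨C * C', fun k hk => ?_⟩
    rw [norm_mul]
    exact mul_le_mul (hC k hk).1 (hC' k hk).1 (norm_nonneg _) hC0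
  · refine ⟨C * C' + C * C', fun k hk => (norm_add_le _ _).trans ?_⟩
    rw [norm_mul, norm_mul]
    exact add_le_add (mul_le_mul (hC k hk).2 (hC' k hk).1 (norm_nonneg _) hC0)
      (mul_le_mul (hC k hk).1 (hC' k hk).2 (norm_nonneg _) hC0)

theorem const_mul (c : ℂ) (hf : IsTame f) : IsTame fun k => c * f k := (const c).mul hf

theorem neg (hf : IsTame f) : IsTame fun k => -f k := by simpa using hf.const_mul (-1)

theorem sub (hf : IsTame f) (hg : IsTame g) : IsTame fun k => f k - g k := by
  simpa [sub_eq_add_neg] using hf.add hg.neg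

theorem inv (hf : IsTame f) {c : ℝ} (hc : 0 < c) (h : ∀ k, 0 < k → c ≤ ‖f k‖) :
    IsTame fun k => (f k)⁻¹ := by
  have h0 : ∀ k, 0 < k → f k ≠ 0 := fun k hk e => by
    have := h k hk
    rw [e, norm_zero] at this
    linarith
  have hinv : ∀ k, 0 < k → ‖(f k)⁻¹‖ ≤ c⁻¹ := fun k hk => by
    rw [norm_inv]; exact inv_anti₀ hc (h k hk)
  refine of_hasDerivAt (f' := fun k => -deriv f k * (f k)⁻¹ ^ 2)
    (fun k hk => ((hf.diff k hk).hasDerivAt.inv (h0 k hk)).congr_deriv (by field_simp))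
    (fun k hk => (hf.contAt hk).neg.mul (((hf.diff k hk).continuousAt.inv₀ (h0 k hk)).pow 2))
    (fun K hK => ⟨c⁻¹, fun k hk => hinv k (hK.trans_le hk)⟩) (fun K hK => ?_)
  obtain ⟨C, hC0, hC⟩ := hf.bdd K hK
  refine ⟨C * c⁻¹ ^ 2, fun k hk => ?_⟩
  rw [norm_mul, norm_neg, norm_pow]
  exact mul_le_mul (hC k hk).2 (pow_le_pow_left₀ (norm_nonneg _) (hinv k (hK.trans_le hk)) 2)
    (by positivity) hC0

theorem congr (hf : IsTame f) (h : ∀ k, 0 < k → g k = f k) : IsTame g := by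
  have he : ∀ k, 0 < k → g =ᶠ[𝓝 k] f := fun k hk => by
    filter_upwards [Ioi_mem_nhds hk] with l hl using h l hl
  refine of_hasDerivAt (f' := deriv f)
    (fun k hk => (hf.diff k hk).hasDerivAt.congr_of_eventuallyEq (he k hk))
    (fun k hk => hf.contAt hk) (fun K hK => ?_) (fun K hK => ?_)
  all_goals
    obtain ⟨C, hC0, hC⟩ := hf.bdd K hK
    refine ⟨C, fun k hk => ?_⟩
  · rw [h k (hK.trans_le hk)]; exact (hC k hk).1
  · exact (hC k hk).2

theorem sum {ι : Type*} {s : Finset ι} {F : ι → ℝ → ℂ} (h : ∀ i ∈ s, IsTame (F i)) :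
    IsTame fun k => ∑ i ∈ s, F i k := by
  classical
  induction s using Finset.induction_on with
  | empty => simpa using const 0
  | insert a s ha ih =>
    simp only [Finset.sum_insert ha]
    exact (h a (by simp)).add (ih fun i hi => h i (by simp [hi]))

theorem prod {ι : Type*} {s : Finset ι} {F : ι → ℝ → ℂ} (h : ∀ i ∈ s, IsTame (F i)) :
    IsTame fun k => ∏ i ∈ s, F i k := by
  classical
  induction s using Finset.induction_on with
  | empty => simpa using const 1
  | insert a s ha ih =>
    simp only [Finset.prod_insert ha]
    exact (h a (by simp)).mul (ih fun i hi => h i (by simp [hi]))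

end IsTame

section
variable {L : ℝ} {w : ℝ → ℝ}

theorem abs_integral_mul_le {f g : ℝ → ℝ} {A : ℝ} (hL : 0 < L) (hA : 0 ≤ A)
    (hf : ∀ x ∈ Set.Icc 0 L, |f x| ≤ A) (hg : ∀ x ∈ Set.Icc 0 L, |g x| ≤ A) :
    |∫ t in (0 : ℝ)..L, f t * g t| ≤ A * A * L := by
  have := intervalIntegral.norm_integral_le_of_norm_le_const (a := 0) (b := L) (C := A * A)
    (f := fun t => f t * g t) fun t ht => by
      rw [Set.uIoc_of_le hL.le] at ht
      have ht' : t ∈ Set.Icc 0 L := ⟨ht.1.le, ht.2⟩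
      rw [norm_mul]
      exact mul_le_mul (hf t ht') (hg t ht') (norm_nonneg _) hA
  simpa [abs_of_pos hL] using this

/-- The entries of the transfer matrix of the edge, in the normalised coordinates
`(ψ, ψ' / k)`, are tame functions of the wave number. -/
theorem isTame_fundamental (hL : 0 < L) (hw : ContinuousOn w (Set.Icc 0 L)) :
    IsTame (fun k => (cosSol L w k L : ℂ)) ∧ IsTame (fun k => ((cosSol' L w k L / k : ℝ) : ℂ)) ∧
    IsTame (fun k => ((k * sinSol L w k L : ℝ) : ℂ)) ∧
    IsTame (fun k => (sinSol' L w k L : ℂ)) := by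
  have hLm : L ∈ Set.Icc 0 L := ⟨hL.le, le_rfl⟩
  have fC := isSolutionFamily_cosSol hL hw
  have fS := isSolutionFamily_sinSol hL hw
  have mk : ∀ {f f' : ℝ → ℝ}, (∀ k, 0 < k → HasDerivAt f (f' k) k) →
      (∀ k, 0 < k → ContinuousAt f' k) → (∀ K, 0 < K → ∃ C, ∀ k, K ≤ k → |f k| ≤ C) →
      (∀ K, 0 < K → ∃ C, ∀ k, K ≤ k → |f' k| ≤ C) → IsTame fun k => (f k : ℂ) := by
    intro f f' h1 h2 h3 h4
    refine IsTame.of_hasDerivAt (f' := fun k => (f' k : ℂ)) (fun k hk => (h1 k hk).ofReal_comp)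
      (fun k hk => Complex.continuous_ofReal.continuousAt.comp (h2 k hk)) ?_ ?_
    · intro K hK; simpa using h3 K hK
    · intro K hK; simpa using h4 K hK
  -- the bounds on the functions and on the integrals of their products
  have hbd : ∀ K, 0 < K → ∃ A, 0 ≤ A ∧ ∀ k, K ≤ k →
      (|cosSol L w k L| ≤ A ∧ |cosSol' L w k L / k| ≤ A ∧ |k * sinSol L w k L| ≤ A ∧
        |sinSol' L w k L| ≤ A) ∧
      |∫ t in (0 : ℝ)..L, cosSol L w k t * cosSol L w k t| ≤ A * A * L ∧
      |k * ∫ t in (0 : ℝ)..L, cosSol L w k t * sinSol L w k t| ≤ A * A * L ∧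
      |k * ∫ t in (0 : ℝ)..L, sinSol L w k t * cosSol L w k t| ≤ A * A * L ∧
      |k ^ 2 * ∫ t in (0 : ℝ)..L, sinSol L w k t * sinSol L w k t| ≤ A * A * L := by
    intro K hK
    obtain ⟨A, hA0, hA⟩ := exists_fundamental_bound hL hw hK
    refine ⟨A, hA0, fun k hk => ⟨hA k hk L hLm, ?_, ?_, ?_, ?_⟩⟩
    · exact abs_integral_mul_le hL hA0 (fun x hx => (hA k hk x hx).1) fun x hx => (hA k hk x hx).1
    · have := abs_integral_mul_le hL hA0 (fun x hx => (hA k hk x hx).1)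
        fun x hx => (hA k hk x hx).2.2.1
      rw [← intervalIntegral.integral_const_mul]
      refine (congrArg abs (intervalIntegral.integral_congr fun t _ => ?_)).trans_le this
      ring
    · have := abs_integral_mul_le hL hA0 (fun x hx => (hA k hk x hx).2.2.1)
        fun x hx => (hA k hk x hx).1
      rw [← intervalIntegral.integral_const_mul]
      refine (congrArg abs (intervalIntegral.integral_congr fun t _ => ?_)).trans_le this
      ring
    · have := abs_integral_mul_le hL hA0 (fun x hx => (hA k hk x hx).2.2.1)
        fun x hx => (hA k hk x hx).2.2.1
      rw [← intervalIntegral.integral_const_mul]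
      refine (congrArg abs (intervalIntegral.integral_congr fun t _ => ?_)).trans_le this
      ring
  have hbd2 : ∀ {a b c d A B : ℝ}, 0 ≤ A → 0 ≤ B → |a| ≤ A → |b| ≤ B → |c| ≤ A → |d| ≤ B →
      |2 * (a * b - c * d)| ≤ 2 * (A * B + A * B) := by
    intro a b c d A B hA hB ha hb hc hd
    rw [abs_mul, abs_two]
    refine mul_le_mul_of_nonneg_left ((abs_sub _ _).trans ?_) (by norm_num)
    rw [abs_mul, abs_mul]
    exact add_le_add (mul_le_mul ha hb (abs_nonneg _) hA) (mul_le_mul hc hd (abs_nonneg _) hA)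
  have cC := fun k (hk : 0 < k) => (fC.tendsto hL hw hk hLm).1
  have cC' := fun k (hk : 0 < k) => (fC.tendsto hL hw hk hLm).2
  have cS := fun k (hk : 0 < k) => (fS.tendsto hL hw hk hLm).1
  have cS' := fun k (hk : 0 < k) => (fS.tendsto hL hw hk hLm).2
  have iCC := fun k (hk : 0 < k) =>
    fC.tendsto_integral hL hw fC hk hLm (g := id) continuousAt_id rfl
  have iCS := fun k (hk : 0 < k) =>
    fC.tendsto_integral hL hw fS hk hLm (g := id) continuousAt_id rfl
  have iSC := fun k (hk : 0 < k) =>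
    fS.tendsto_integral hL hw fC hk hLm (g := id) continuousAt_id rfl
  have iSS := fun k (hk : 0 < k) =>
    fS.tendsto_integral hL hw fS hk hLm (g := id) continuousAt_id rfl
  simp only [id] at iCC iCS iSC iSS
  have c2 : ∀ k : ℝ, ContinuousAt (fun k : ℝ => 2 * k) k := fun k => by fun_prop
  refine ⟨mk (fun k hk => (fC.hasDerivAt hL hw hk hLm).1) (fun k hk => ?_) ?_ ?_,
    mk (fun k hk => (fC.hasDerivAt hL hw hk hLm).2.div (hasDerivAt_id k) hk.ne')
      (fun k hk => ?_) ?_ ?_,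
    mk (fun k hk => (hasDerivAt_id k).mul (fS.hasDerivAt hL hw hk hLm).1) (fun k hk => ?_) ?_ ?_,
    mk (fun k hk => (fS.hasDerivAt hL hw hk hLm).2) (fun k hk => ?_) ?_ ?_⟩
  · exact (c2 k).mul (((cC k hk).mul (iCS k hk)).sub ((cS k hk).mul (iCC k hk)))
  · intro K hK
    obtain ⟨A, hA0, hA⟩ := hbd K hK
    exact ⟨A, fun k hk => (hA k hk).1.1⟩
  · intro K hK
    obtain ⟨A, hA0, hA⟩ := hbd K hK
    refine ⟨2 * (A * (A * A * L) + A * (A * A * L)), fun k hk => ?_⟩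
    obtain ⟨⟨h1, h2, h3, h4⟩, h5, h6, h7, h8⟩ := hA k hk
    convert hbd2 hA0 (by positivity) h1 h6 h3 h5 using 2
    ring
  · have := hk.ne'
    refine ContinuousAt.div (.sub (.mul ((c2 k).mul (((cC' k hk).mul (iCS k hk)).sub
      ((cS' k hk).mul (iCC k hk)))) continuousAt_id) ((cC' k hk).mul continuousAt_const))
      (continuousAt_id.pow 2) (by simpa using this)
  · intro K hK
    obtain ⟨A, hA0, hA⟩ := hbd K hK
    exact ⟨A, fun k hk => (hA k hk).1.2.1⟩
  · intro K hK
    obtain ⟨A, hA0, hA⟩ := hbd K hK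
    refine ⟨2 * (A * (A * A * L) + A * (A * A * L)) + A / K, fun k hk => ?_⟩
    obtain ⟨⟨h1, h2, h3, h4⟩, h5, h6, h7, h8⟩ := hA k hk
    have hk0 : 0 < k := hK.trans_le hk
    have e1 := hbd2 hA0 (by positivity) h2 h6 h4 h5
    have e2 : |cosSol' L w k L / k / k| ≤ A / K := by
      rw [abs_div, abs_of_pos hk0]
      exact div_le_div₀ hA0 h2 hK hk
    refine le_trans (le_of_eq ?_) ((abs_sub _ _).trans (add_le_add e1 e2))
    congr 1
    field_simp
  · exact (continuousAt_const.mul (cS k hk)).add (continuousAt_id.mul ((c2 k).mul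
      (((cC k hk).mul (iSS k hk)).sub ((cS k hk).mul (iSC k hk)))))
  · intro K hK
    obtain ⟨A, hA0, hA⟩ := hbd K hK
    exact ⟨A, fun k hk => (hA k hk).1.2.2.1⟩
  · intro K hK
    obtain ⟨A, hA0, hA⟩ := hbd K hK
    refine ⟨A / K + 2 * (A * (A * A * L) + A * (A * A * L)), fun k hk => ?_⟩
    obtain ⟨⟨h1, h2, h3, h4⟩, h5, h6, h7, h8⟩ := hA k hk
    have hk0 : 0 < k := hK.trans_le hk
    have e1 := hbd2 hA0 (by positivity) h1 h8 h3 h7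
    have e2 : |k * sinSol L w k L / k| ≤ A / K := by
      rw [abs_div, abs_of_pos hk0]
      exact div_le_div₀ hA0 h3 hK hk
    refine le_trans (le_of_eq ?_) ((abs_add_le _ _).trans (add_le_add e2 e1))
    congr 1
    simp only [id]
    field_simp
  · exact (c2 k).mul (((cC' k hk).mul (iSS k hk)).sub ((cS' k hk).mul (iSC k hk)))
  · intro K hK
    obtain ⟨A, hA0, hA⟩ := hbd K hK
    exact ⟨A, fun k hk => (hA k hk).1.2.2.2⟩
  · intro K hK
    obtain ⟨A, hA0, hA⟩ := hbd K hK
    refine ⟨2 * (A * (A * A * L) + A * (A * A * L)), fun k hk => ?_⟩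
    obtain ⟨⟨h1, h2, h3, h4⟩, h5, h6, h7, h8⟩ := hA k hk
    have hk0 : 0 < k := hK.trans_le hk
    convert hbd2 hA0 (by positivity) h2 h8 h4 h7 using 2
    field_simp

end

end QuantumGraph

end

noncomputable section

namespace QuantumGraph

open Filter Topology

/-! ### Complex solutions on an edge -/

section
variable {L : ℝ} {w : ℝ → ℝ}

/-- The complex solution `p C + s S` with initial values `p`, `s`. -/
def combo (L : ℝ) (w : ℝ → ℝ) (k : ℝ) (p s : ℂ) (x : ℝ) : ℂ :=
  p * cosSol L w k x + s * sinSol L w k x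

/-- The derivative of `combo`. -/
def combo' (L : ℝ) (w : ℝ → ℝ) (k : ℝ) (p s : ℂ) (x : ℝ) : ℂ :=
  p * cosSol' L w k x + s * sinSol' L w k x

theorem combo_hasDerivAt (hL : 0 < L) (hw : ContinuousOn w (Set.Icc 0 L)) (k : ℝ) (p s : ℂ)
    {x : ℝ} (hx : x ∈ Set.Icc 0 L) :
    HasDerivAt (combo L w k p s) (combo' L w k p s x) x ∧
    HasDerivAt (combo' L w k p s) (((w x - k ^ 2 : ℝ) : ℂ) * combo L w k p s x) x := by
  have hC := cosSol_isSolution hL hw k x hx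
  have hS := sinSol_isSolution hL hw k x hx
  refine ⟨(hC.1.ofReal_comp.const_mul p).add (hS.1.ofReal_comp.const_mul s), ?_⟩
  refine ((hC.2.ofReal_comp.const_mul p).add (hS.2.ofReal_comp.const_mul s)).congr_deriv ?_
  simp only [combo]
  push_cast
  ring

theorem combo_zero (hL : 0 < L) (hw : ContinuousOn w (Set.Icc 0 L)) (k : ℝ) (p s : ℂ) :
    combo L w k p s 0 = p ∧ combo' L w k p s 0 = s := by
  simp [combo, combo', cosSol_zero hL hw, cosSol'_zero hL hw, sinSol_zero hL hw,
    sinSol'_zero hL hw]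

theorem combo_continuousOn (hL : 0 < L) (hw : ContinuousOn w (Set.Icc 0 L)) (k : ℝ) (p s : ℂ) :
    ContinuousOn (combo L w k p s) (Set.Icc 0 L) :=
  fun _ hx => (combo_hasDerivAt hL hw k p s hx).1.continuousAt.continuousWithinAt

/-- Green's identity for complex solutions. -/
theorem combo_green (hL : 0 < L) (hw : ContinuousOn w (Set.Icc 0 L)) (k l : ℝ) (p s p' s' : ℂ) :
    combo L w k p s L * combo' L w l p' s' L - combo' L w k p s L * combo L w l p' s' L -
      (p * s' - s * p') =
    ((k : ℂ) ^ 2 - (l : ℂ) ^ 2) * ∫ x in (0 : ℝ)..L, combo L w k p s x * combo L w l p' s' x := by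
  have hsub : Set.uIcc 0 L = Set.Icc 0 L := Set.uIcc_of_le hL.le
  have hder : ∀ t ∈ Set.uIcc 0 L, HasDerivAt
      (fun x => combo L w k p s x * combo' L w l p' s' x - combo' L w k p s x * combo L w l p' s' x)
      (((k : ℂ) ^ 2 - (l : ℂ) ^ 2) * (combo L w k p s t * combo L w l p' s' t)) t := by
    intro t ht
    rw [hsub] at ht
    have h1 := combo_hasDerivAt hL hw k p s ht
    have h2 := combo_hasDerivAt hL hw l p' s' ht
    refine ((h1.1.mul h2.2).sub (h1.2.mul h2.1)).congr_deriv ?_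
    push_cast
    ring
  have := intervalIntegral.integral_eq_sub_of_hasDerivAt hder (by
    refine ContinuousOn.intervalIntegrable ?_
    rw [hsub]
    exact continuousOn_const.mul ((combo_continuousOn hL hw k p s).mul
      (combo_continuousOn hL hw l p' s')))
  rw [intervalIntegral.integral_const_mul] at this
  rw [this, (combo_zero hL hw k p s).1, (combo_zero hL hw k p s).2, (combo_zero hL hw l p' s').1,
    (combo_zero hL hw l p' s').2]

theorem edgeDeriv_eq {f : ℝ → ℂ} {c : ℂ} {x : ℝ} (hL : 0 < L) (hx : x ∈ Set.Icc 0 L)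
    (h : HasDerivAt f c x) : edgeDeriv L f x = c :=
  h.hasDerivWithinAt.derivWithin (uniqueDiffOn_Icc hL x hx)

/-- A function that agrees with `combo` on the edge solves the differential equation there. -/
theorem solves_of_eqOn_combo (hL : 0 < L) (hw : ContinuousOn w (Set.Icc 0 L)) {k : ℝ} {p s : ℂ}
    {f : ℝ → ℂ} (hf : ∀ x ∈ Set.Icc 0 L, f x = combo L w k p s x) :
    TwiceDiff L f ∧ (∀ x ∈ Set.Icc 0 L, edgeOp L w f x = (k : ℂ) ^ 2 * f x) ∧
      ∀ x ∈ Set.Icc 0 L, edgeDeriv L f x = combo' L w k p s x := by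
  have h1 : ∀ x ∈ Set.Icc 0 L, edgeDeriv L f x = combo' L w k p s x := fun x hx => by
    rw [edgeDeriv_congr hf x hx, edgeDeriv_eq hL hx (combo_hasDerivAt hL hw k p s hx).1]
  refine ⟨⟨?_, ?_⟩, fun x hx => ?_, h1⟩
  · exact DifferentiableOn.congr (fun x hx => (combo_hasDerivAt hL hw k p
      s hx).1.differentiableAt.differentiableWithinAt) hf
  · exact DifferentiableOn.congr (fun x hx => (combo_hasDerivAt hL hw k p
      s hx).2.differentiableAt.differentiableWithinAt) h1
  · rw [edgeOp, edgeDeriv_congr h1 x hx, edgeDeriv_eq hL hx (combo_hasDerivAt hL hw k p s hx).2,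
      hf x hx]
    push_cast
    ring

/-- Uniqueness: a twice differentiable solution is determined by its initial values. The Wronskians
with the two fundamental solutions are constant. -/
theorem eq_combo_of_solves (hL : 0 < L) (hw : ContinuousOn w (Set.Icc 0 L)) {k : ℝ} {f : ℝ → ℂ}
    (hf : TwiceDiff L f) (he : ∀ x ∈ Set.Icc 0 L, edgeOp L w f x = (k : ℂ) ^ 2 * f x)
    {x : ℝ} (hx : x ∈ Set.Icc 0 L) :
    f x = combo L w k (f 0) (edgeDeriv L f 0) x := by
  have key : ∀ p s : ℂ, f x * combo' L w k p s x - edgeDeriv L f x * combo L w k p s x =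
      f 0 * s - edgeDeriv L f 0 * p := by
    intro p s
    have hder : ∀ t ∈ Set.Icc 0 L, HasDerivWithinAt
        (fun t => f t * combo' L w k p s t - edgeDeriv L f t * combo L w k p s t) 0
        (Set.Icc 0 L) t := by
      intro t ht
      have h1 : HasDerivWithinAt f (edgeDeriv L f t) (Set.Icc 0 L) t := (hf.1 t ht).hasDerivWithinAt
      have h2 : HasDerivWithinAt (edgeDeriv L f) (edgeDeriv L (edgeDeriv L f) t) (Set.Icc 0 L) t :=
        (hf.2 t ht).hasDerivWithinAt
      have h3 := combo_hasDerivAt hL hw k p s ht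
      have h4 := he t ht
      rw [edgeOp] at h4
      refine ((h1.mul h3.2.hasDerivWithinAt).sub (h2.mul h3.1.hasDerivWithinAt)).congr_deriv ?_
      push_cast
      linear_combination combo L w k p s t * h4
    have h0 := constant_of_derivWithin_zero (fun t ht => (hder t ht).differentiableWithinAt)
      (fun t ht => (hder t ⟨ht.1, ht.2.le⟩).derivWithin
        (uniqueDiffOn_Icc hL t ⟨ht.1, ht.2.le⟩)) x hx
    rw [h0, (combo_zero hL hw k p s).1, (combo_zero hL hw k p s).2]
  have hdet : ((cosSol L w k x * sinSol' L w k x - cosSol' L w k x * sinSol L w k x : ℝ) : ℂ) =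
      1 := by
    rw [fundamental_det hL hw k hx]; simp
  push_cast at hdet
  have h1 := key 1 0
  have h2 := key 0 1
  simp only [combo, combo', one_mul, zero_mul, add_zero, zero_add, mul_zero, mul_one, zero_sub,
    sub_zero] at h1 h2 ⊢
  linear_combination -f x * hdet + (cosSol L w k x : ℂ) * h2 - (sinSol L w k x : ℂ) * h1

/-- The solution chosen in `edgeSolution` is the combination of the fundamental solutions. -/
theorem edgeSolution_eq (hL : 0 < L) (hw : ContinuousOn w (Set.Icc 0 L)) (k : ℝ) (s : ℂ) :
    (∀ x ∈ Set.Icc 0 L, edgeSolution L w k s x = combo L w k 1 s x) ∧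
      ∀ x ∈ Set.Icc 0 L, edgeDeriv L (edgeSolution L w k s) x = combo' L w k 1 s x := by
  have hex : ∃ f : ℝ → ℂ, TwiceDiff L f ∧
      (∀ x ∈ Set.Icc 0 L, edgeOp L w f x = (k : ℂ) ^ 2 * f x) ∧ f 0 = 1 ∧ edgeDeriv L f 0 = s := by
    have h := solves_of_eqOn_combo (f := combo L w k 1 s) hL hw (fun _ _ => rfl)
    refine ⟨combo L w k 1 s, h.1, h.2.1, (combo_zero hL hw k 1 s).1, ?_⟩
    rw [h.2.2 0 ⟨le_rfl, hL.le⟩, (combo_zero hL hw k 1 s).2]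
  obtain ⟨h1, h2, h3, h4⟩ := Classical.epsilon_spec hex
  have h5 : ∀ x ∈ Set.Icc 0 L, edgeSolution L w k s x = combo L w k 1 s x := fun x hx => by
    have := eq_combo_of_solves hL hw h1 h2 hx
    rw [h3, h4] at this
    exact this
  exact ⟨h5, (solves_of_eqOn_combo hL hw h5).2.2⟩

theorem IsSolution.eq_fundamental (hL : 0 < L) (hw : ContinuousOn w (Set.Icc 0 L)) {k : ℝ}
    {u v : ℝ → ℝ} (h : IsSolution L w k u v) {x : ℝ} (hx : x ∈ Set.Icc 0 L) :
    u x = u 0 * cosSol L w k x + v 0 * sinSol L w k x ∧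
      v x = u 0 * cosSol' L w k x + v 0 * sinSol' L w k x := by
  have e1 := h.wronskian (sinSol_isSolution hL hw k) hx
  have e2 := h.wronskian (cosSol_isSolution hL hw k) hx
  have hdet := fundamental_det hL hw k hx
  rw [sinSol_zero hL hw, sinSol'_zero hL hw] at e1
  rw [cosSol_zero hL hw, cosSol'_zero hL hw] at e2
  constructor
  · linear_combination -u x * hdet + cosSol L w k x * e1 - sinSol L w k x * e2
  · linear_combination -v x * hdet + cosSol' L w k x * e1 - sinSol' L w k x * e2

/-- A solution read from the other end of the edge solves the equation with the reversed
potential. -/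
theorem IsSolution.reverse {w' : ℝ → ℝ} (hw' : ∀ x ∈ Set.Icc 0 L, w' x = w (L - x)) {k : ℝ}
    {u v : ℝ → ℝ} (h : IsSolution L w k u v) :
    IsSolution L w' k (fun x => u (L - x)) (fun x => -v (L - x)) := by
  intro x hx
  have hx' : L - x ∈ Set.Icc 0 L := ⟨by linarith [hx.2], by linarith [hx.1]⟩
  have h0 : HasDerivAt (fun x : ℝ => L - x) (-1) x := by
    simpa using (hasDerivAt_id x).const_sub L
  have h1 := (h _ hx').1.comp x h0
  have h2 := ((h _ hx').2.comp x h0).neg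
  refine ⟨h1.congr_deriv (by ring), h2.congr_deriv ?_⟩
  rw [hw' x hx]; ring

/-- The transfer matrix of the reversed edge. -/
theorem fundamental_reverse (hL : 0 < L) (hw : ContinuousOn w (Set.Icc 0 L)) {w' : ℝ → ℝ}
    (hw'c : ContinuousOn w' (Set.Icc 0 L))
    (hw' : ∀ x ∈ Set.Icc 0 L, w' x = w (L - x)) (k : ℝ) :
    cosSol L w' k L = sinSol' L w k L ∧ sinSol L w' k L = sinSol L w k L ∧
    cosSol' L w' k L = cosSol' L w k L ∧ sinSol' L w' k L = cosSol L w k L := by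
  have hLm : L ∈ Set.Icc 0 L := ⟨hL.le, le_rfl⟩
  have h1 := ((cosSol_isSolution hL hw k).reverse hw').eq_fundamental hL hw'c hLm
  have h2 := ((sinSol_isSolution hL hw k).reverse hw').eq_fundamental hL hw'c hLm
  simp only [sub_self, sub_zero, cosSol_zero hL hw, cosSol'_zero hL hw, sinSol_zero hL hw,
    sinSol'_zero hL hw] at h1 h2
  have hdet := fundamental_det hL hw k hLm
  obtain ⟨a1, a2⟩ := h1
  obtain ⟨b1, b2⟩ := h2
  refine ⟨?_, ?_, ?_, ?_⟩
  · linear_combination -sinSol' L w k L * a1 + cosSol' L w k L * b1 - cosSol L w' k L * hdet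
  · linear_combination -sinSol L w k L * a1 + cosSol L w k L * b1 - sinSol L w' k L * hdet
  · linear_combination -sinSol' L w k L * a2 + cosSol' L w k L * b2 - cosSol' L w' k L * hdet
  · linear_combination -sinSol L w k L * a2 + cosSol L w k L * b2 - sinSol' L w' k L * hdet

/-- Reversal of complex solutions. -/
theorem combo_reverse (hL : 0 < L) (hw : ContinuousOn w (Set.Icc 0 L)) {w' : ℝ → ℝ}
    (hw'c : ContinuousOn w' (Set.Icc 0 L))
    (hw' : ∀ x ∈ Set.Icc 0 L, w' x = w (L - x)) (k : ℝ) (p s : ℂ) {x : ℝ} (hx : x ∈ Set.Icc 0 L) :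
    combo L w k p s (L - x) = combo L w' k (combo L w k p s L) (-combo' L w k p s L) x := by
  have h1 := (((cosSol_isSolution hL hw k).reverse hw').eq_fundamental hL hw'c hx).1
  have h2 := (((sinSol_isSolution hL hw k).reverse hw').eq_fundamental hL hw'c hx).1
  simp only [sub_zero] at h1 h2
  simp only [combo, combo', h1, h2]
  push_cast
  ring

end

end QuantumGraph

end

noncomputable section

namespace QuantumGraph

open Filter Topology

/-! ### The transition matrix for real wave numbers -/

section
variable {V D : Type*} (G : MetricGraph V D) (W : Potential G)

theorem Potential.w_rev_eq (d : D) : ∀ x ∈ Set.Icc 0 (G.len d),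
    W.w (G.rev d) x = W.w d (G.len d - x) := fun x hx => by
  rw [W.w_rev d (G.len d - x) ⟨by linarith [hx.2], by linarith [hx.1]⟩, sub_sub_cancel]

theorem Potential.cont_rev (d : D) : ContinuousOn (W.w (G.rev d)) (Set.Icc 0 (G.len d)) := by
  have := W.cont (G.rev d)
  rwa [G.len_rev] at this

/-- The value at the end of the edge `d` of the cosine-type solution. -/
def cEnd (k : ℝ) (d : D) : ℝ := cosSol (G.len d) (W.w d) k (G.len d)

/-- The derivative at the end of the edge `d` of the cosine-type solution. -/
def cEnd' (k : ℝ) (d : D) : ℝ := cosSol' (G.len d) (W.w d) k (G.len d)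

/-- The value at the end of the edge `d` of the sine-type solution. -/
def sEnd (k : ℝ) (d : D) : ℝ := sinSol (G.len d) (W.w d) k (G.len d)

/-- The derivative at the end of the edge `d` of the sine-type solution. -/
def sEnd' (k : ℝ) (d : D) : ℝ := sinSol' (G.len d) (W.w d) k (G.len d)

theorem end_det (k : ℝ) (d : D) :
    cEnd G W k d * sEnd' G W k d - cEnd' G W k d * sEnd G W k d = 1 :=
  fundamental_det (G.len_pos d) (W.cont d) k ⟨(G.len_pos d).le, le_rfl⟩

theorem end_rev (k : ℝ) (d : D) :
    cEnd G W k (G.rev d) = sEnd' G W k d ∧ sEnd G W k (G.rev d) = sEnd G W k d ∧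
    cEnd' G W k (G.rev d) = cEnd' G W k d ∧ sEnd' G W k (G.rev d) = cEnd G W k d := by
  have := fundamental_reverse (G.len_pos d) (W.cont d) (W.cont_rev G d) (W.w_rev_eq G d) k
  simpa only [cEnd, cEnd', sEnd, sEnd', G.len_rev] using this

/-- The denominator of the entries of the transition matrix, divided by `k`. -/
def redDen (k : ℝ) (d : D) : ℂ :=
  ((k * sEnd G W k d : ℝ) : ℂ) - ((cEnd' G W k d / k : ℝ) : ℂ) +
    Complex.I * (cEnd G W k d + sEnd' G W k d)

/-- The numerator of the reflection amplitude from `rev d` to `d`, divided by `k`. -/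
def redNum (k : ℝ) (d : D) : ℂ :=
  ((k * sEnd G W k d : ℝ) : ℂ) + ((cEnd' G W k d / k : ℝ) : ℂ) +
    Complex.I * (cEnd G W k d - sEnd' G W k d)

variable {k : ℝ}

theorem one_le_norm_redDen (hk : 0 < k) (d : D) : 1 ≤ ‖redDen G W k d‖ := by
  have h : (1 : ℝ) ≤ ‖redDen G W k d‖ ^ 2 := by
    rw [← Complex.normSq_eq_norm_sq, Complex.normSq_apply]
    have hre : (redDen G W k d).re = k * sEnd G W k d - cEnd' G W k d / k := by
      simp [redDen]
    have him : (redDen G W k d).im = cEnd G W k d + sEnd' G W k d := by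
      simp [redDen]
    rw [hre, him]
    have hdet := end_det G W k d
    have h1 : k * sEnd G W k d * (cEnd' G W k d / k) = cEnd' G W k d * sEnd G W k d := by
      field_simp
    nlinarith [sq_nonneg (k * sEnd G W k d), sq_nonneg (cEnd' G W k d / k),
      sq_nonneg (cEnd G W k d), sq_nonneg (sEnd' G W k d)]
  nlinarith [norm_nonneg (redDen G W k d)]

theorem redDen_ne_zero (hk : 0 < k) (d : D) : redDen G W k d ≠ 0 := fun h => by
  have := one_le_norm_redDen G W hk d
  rw [h, norm_zero] at this
  linarith

theorem psi_end (k : ℝ) (d : D) (s : ℂ) :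
    edgeSolution (G.len (G.rev d)) (W.w (G.rev d)) k s (G.len d) =
      sEnd' G W k d + s * sEnd G W k d ∧
    edgeDeriv (G.len d) (edgeSolution (G.len (G.rev d)) (W.w (G.rev d)) k s) (G.len d) =
      cEnd' G W k d + s * cEnd G W k d := by
  have h := edgeSolution_eq (G.len_pos (G.rev d)) (W.cont (G.rev d)) k s
  have hm : G.len d ∈ Set.Icc 0 (G.len (G.rev d)) := by
    rw [G.len_rev]; exact ⟨(G.len_pos d).le, le_rfl⟩
  obtain ⟨e1, e2, e3, e4⟩ := end_rev G W k d
  simp only [cEnd, cEnd', sEnd, sEnd'] at e1 e2 e3 e4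
  have h1 := h.1 _ hm
  have h2 := h.2 _ hm
  rw [G.len_rev] at h1 h2 e1 e2 e3 e4 ⊢
  rw [h1, h2]
  simp only [combo, combo', e1, e2, e3, e4, one_mul]
  exact ⟨rfl, rfl⟩

theorem transDen_eq (hk : 0 < k) (d : D) : transDen G W (k : ℂ) d = k * redDen G W k d := by
  have hk' : (k : ℂ) ≠ 0 := by exact_mod_cast hk.ne'
  have h := psi_end G W k d (-(Complex.I * k))
  rw [transDen, psiPlus, h.1, h.2, redDen]
  push_cast
  field_simp
  linear_combination (-(k : ℂ) ^ 2 * sEnd G W k d) * Complex.I_sq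

theorem transitionMatrix_diag [DecidableEq D] (hk : 0 < k) (d : D) :
    transitionMatrix G W (k : ℂ) d d = 2 * Complex.I * (redDen G W k d)⁻¹ := by
  have hk' : (k : ℂ) ≠ 0 := by exact_mod_cast hk.ne'
  have := redDen_ne_zero G W hk d
  simp only [transitionMatrix, Matrix.of_apply, if_true, transDen_eq G W hk]
  field_simp

theorem transitionMatrix_rev [DecidableEq D] (hk : 0 < k) (d : D) :
    transitionMatrix G W (k : ℂ) d (G.rev d) = redNum G W k d * (redDen G W k d)⁻¹ := by
  have hk' : (k : ℂ) ≠ 0 := by exact_mod_cast hk.ne'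
  have h0 := redDen_ne_zero G W hk d
  have h := psi_end G W k d (Complex.I * k)
  simp only [transitionMatrix, Matrix.of_apply, if_neg (G.rev_ne d), if_true,
    transDen_eq G W hk, psiMinus]
  rw [h.1, h.2, redNum]
  push_cast
  field_simp
  linear_combination (-(k : ℂ) ^ 2 * sEnd G W k d) * Complex.I_sq

theorem transitionMatrix_off [DecidableEq D] (k : ℂ) {d d' : D} (h1 : d' ≠ d)
    (h2 : d' ≠ G.rev d) : transitionMatrix G W k d d' = 0 := by
  simp [transitionMatrix, h1, h2]

/-- The entries are quotients with denominator `redDen`, which is bounded below because the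
Wronskian of the fundamental solutions is `1`. -/
theorem isTame_transitionMatrix [DecidableEq D] (d d' : D) :
    IsTame fun k : ℝ => transitionMatrix G W (k : ℂ) d d' := by
  obtain ⟨hC, hC', hS, hS'⟩ := isTame_fundamental (G.len_pos d) (W.cont d)
  have hden : IsTame fun k => (redDen G W k d)⁻¹ :=
    ((hS.sub hC').add ((hC.add hS').const_mul Complex.I)).inv one_pos
      fun k hk => one_le_norm_redDen G W hk d
  have hnum : IsTame fun k => redNum G W k d :=
    (hS.add hC').add ((hC.sub hS').const_mul Complex.I)
  by_cases h1 : d' = d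
  · subst h1
    exact (hden.const_mul (2 * Complex.I)).congr fun k hk => transitionMatrix_diag G W hk d'
  by_cases h2 : d' = G.rev d
  · subst h2
    exact (hnum.mul hden).congr fun k hk => transitionMatrix_rev G W hk d
  · exact (IsTame.const 0).congr fun k _ => transitionMatrix_off G W k h1 h2

variable [Fintype D] [DecidableEq D]

open Matrix

theorem transitionMatrix_mulVec (k : ℂ) (b : D → ℂ) (d : D) :
    (transitionMatrix G W k *ᵥ b) d = transitionMatrix G W k d d * b d +
      transitionMatrix G W k d (G.rev d) * b (G.rev d) := by
  rw [Matrix.mulVec, dotProduct]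
  refine Fintype.sum_eq_add d (G.rev d) (G.rev_ne d).symm fun x hx => ?_
  rw [transitionMatrix_off G W k hx.1 hx.2, zero_mul]

/-- The amplitudes, seen from the vertices, of the waves that arrive there, as functions of the
amplitudes `b` of the waves that leave the vertices. -/
def inAmp (k : ℝ) (b : D → ℂ) (d : D) : ℂ := (transitionMatrix G W (k : ℂ) *ᵥ b) (G.rev d)

theorem inAmp_mul (hk : 0 < k) (b : D → ℂ) (d : D) :
    inAmp G W k b d * redDen G W k d = 2 * Complex.I * b (G.rev d) +
      (((k * sEnd G W k d : ℝ) : ℂ) + ((cEnd' G W k d / k : ℝ) : ℂ) +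
        Complex.I * (sEnd' G W k d - cEnd G W k d)) * b d := by
  obtain ⟨e1, e2, e3, e4⟩ := end_rev G W k d
  have hden : redDen G W k (G.rev d) = redDen G W k d := by
    simp only [redDen, e1, e2, e3, e4]; ring
  have h0 := redDen_ne_zero G W hk d
  rw [inAmp, transitionMatrix_mulVec, transitionMatrix_diag G W hk, transitionMatrix_rev G W hk,
    hden, G.rev_rev]
  simp only [redNum, e1, e2, e3, e4]
  field_simp

/-- The initial values of the function on the edge `d` with outgoing amplitude `b d` and incoming
amplitude `a d`. -/
def waveInit (k : ℝ) (b : D → ℂ) (d : D) : ℂ × ℂ :=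
  (inAmp G W k b d + b d, Complex.I * k * (b d - inAmp G W k b d))

/-- The function on the edges with outgoing amplitudes `b` has matching values at the two ends of
every edge. -/
theorem waveInit_end (hk : 0 < k) (b : D → ℂ) (d : D) :
    combo (G.len d) (W.w d) k (waveInit G W k b d).1 (waveInit G W k b d).2 (G.len d) =
      (waveInit G W k b (G.rev d)).1 ∧
    combo' (G.len d) (W.w d) k (waveInit G W k b d).1 (waveInit G W k b d).2 (G.len d) =
      -(waveInit G W k b (G.rev d)).2 := by
  have hk' : (k : ℂ) ≠ 0 := by exact_mod_cast hk.ne'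
  obtain ⟨e1, e2, e3, e4⟩ := end_rev G W k d
  have hden : redDen G W k (G.rev d) = redDen G W k d := by
    simp only [redDen, e1, e2, e3, e4]; ring
  have h0 := redDen_ne_zero G W hk d
  have ha := inAmp_mul G W hk b d
  have hr := inAmp_mul G W hk b (G.rev d)
  rw [hden, G.rev_rev, e1, e2, e3, e4] at hr
  have hdet : ((cEnd G W k d * sEnd' G W k d - cEnd' G W k d * sEnd G W k d : ℝ) : ℂ) = 1 := by
    rw [end_det]; simp
  push_cast at hdet ha hr
  constructor
  · refine mul_right_cancel₀ h0 ?_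
    change ((inAmp G W k b d + b d) * (cEnd G W k d : ℂ) +
      (Complex.I * k * (b d - inAmp G W k b d)) * (sEnd G W k d : ℂ)) * redDen G W k d =
        (inAmp G W k b (G.rev d) + b (G.rev d)) * redDen G W k d
    have e : redDen G W k d = k * sEnd G W k d - cEnd' G W k d / k +
      Complex.I * (cEnd G W k d + sEnd' G W k d) := by simp [redDen]
    generalize redDen G W k d = Δ at ha hr e ⊢
    generalize inAmp G W k b d = a at ha ⊢
    generalize inAmp G W k b (G.rev d) = a' at hr ⊢
    generalize (cEnd G W k d : ℂ) = c at *
    generalize (cEnd' G W k d : ℂ) = c' at *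
    generalize (sEnd G W k d : ℂ) = s at *
    generalize (sEnd' G W k d : ℂ) = s' at *
    have hkk : c' / k * k = c' := by field_simp
    generalize c' / (k : ℂ) = cd at *
    subst hkk
    linear_combination (c - Complex.I * k * s) * ha - hr + (b d * (c + Complex.I * k * s) -
      b (G.rev d)) * e + 2 * Complex.I * b d * hdet +
      2 * k * s * (c * b d - b (G.rev d)) * Complex.I_sq
  · refine mul_right_cancel₀ h0 ?_
    change ((inAmp G W k b d + b d) * (cEnd' G W k d : ℂ) +
      (Complex.I * k * (b d - inAmp G W k b d)) * (sEnd' G W k d : ℂ)) * redDen G W k d =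
        -(Complex.I * k * (b (G.rev d) - inAmp G W k b (G.rev d))) * redDen G W k d
    have e : redDen G W k d = k * sEnd G W k d - cEnd' G W k d / k +
      Complex.I * (cEnd G W k d + sEnd' G W k d) := by simp [redDen]
    generalize redDen G W k d = Δ at ha hr e ⊢
    generalize inAmp G W k b d = a at ha ⊢
    generalize inAmp G W k b (G.rev d) = a' at hr ⊢
    generalize (cEnd G W k d : ℂ) = c at *
    generalize (cEnd' G W k d : ℂ) = c' at *
    generalize (sEnd G W k d : ℂ) = s at *
    generalize (sEnd' G W k d : ℂ) = s' at *
    have hkk : c' / k * k = c' := by field_simp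
    generalize c' / (k : ℂ) = cd at *
    subst hkk
    linear_combination (cd * k - Complex.I * k * s') * ha - Complex.I * k * hr +
      (b d * (cd * k + Complex.I * k * s') + Complex.I * k * b (G.rev d)) * e -
      2 * k * b d * hdet + (2 * k * b d * (s' * c - 1)) * Complex.I_sq

end

end QuantumGraph

end

noncomputable section

namespace QuantumGraph

open Filter Topology Matrix ComplexConjugate

/-! ### Unitarity and the energy identity -/

section
variable {V D : Type*} (G : MetricGraph V D) (W : Potential G)

/-- Reversal as a permutation of the directed edges. -/
def revEquiv : Equiv.Perm D := ⟨G.rev, G.rev, G.rev_rev, G.rev_rev⟩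

theorem sum_rev [Fintype D] (f : D → ℂ) : ∑ d, f (G.rev d) = ∑ d, f d :=
  Equiv.sum_comp (revEquiv G) f

theorem conj_combo (L : ℝ) (w : ℝ → ℝ) (k : ℝ) (p s : ℂ) (x : ℝ) :
    conj (combo L w k p s x) = combo L w k (conj p) (conj s) x := by
  simp [combo]

theorem conj_combo' (L : ℝ) (w : ℝ → ℝ) (k : ℝ) (p s : ℂ) (x : ℝ) :
    conj (combo' L w k p s x) = combo' L w k (conj p) (conj s) x := by
  simp [combo']

variable [Fintype D] [DecidableEq D]

/-- The `L²` product on the edge `d` of the functions with outgoing amplitudes `b` and `β`,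
for the wave numbers `k` and `l`. -/
def waveInner (k l : ℝ) (b β : D → ℂ) (d : D) : ℂ :=
  ∫ x in (0 : ℝ)..G.len d,
    combo (G.len d) (W.w d) k (conj (waveInit G W k b d).1) (conj (waveInit G W k b d).2) x *
      combo (G.len d) (W.w d) l (waveInit G W l β d).1 (waveInit G W l β d).2 x

/-- Green's identity on all edges, in terms of the amplitudes. For `k = l` it says that the
transition matrix is unitary; the first order term at `k = l` gives its derivative. -/
theorem green_scattering {k l : ℝ} (hk : 0 < k) (hl : 0 < l) (b β : D → ℂ) :
    ∑ d, (conj (b d) * β d - conj (inAmp G W k b d) * inAmp G W l β d) =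
      ((k : ℂ) - l) * (Complex.I / 2 * (∑ d, waveInner G W k l b β d) +
        1 / ((k : ℂ) + l) *
          ∑ d, (conj (inAmp G W k b d) * β d - conj (b d) * inAmp G W l β d)) := by
  set p := waveInit G W k b with hp
  set q := waveInit G W l β with hq
  obtain ⟨ω, hω⟩ : ∃ ω : D → ℂ, ∀ d, ω d = conj (p d).1 * (q d).2 - conj (p d).2 * (q d).1 :=
    ⟨_, fun _ => rfl⟩
  have h1 : ∀ d, -ω (G.rev d) - ω d = ((k : ℂ) ^ 2 - (l : ℂ) ^ 2) * waveInner G W k l b β d := by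
    intro d
    have hg := combo_green (G.len_pos d) (W.cont d) k l (conj (p d).1) (conj (p d).2) (q d).1
      (q d).2
    rw [← conj_combo, ← conj_combo', (waveInit_end G W hk b d).1, (waveInit_end G W hk b d).2,
      (waveInit_end G W hl β d).1, (waveInit_end G W hl β d).2] at hg
    rw [waveInner, ← hg]
    simp only [hω, map_neg, ← hp, ← hq]
    ring
  have h2 : -2 * ∑ d, ω d = ((k : ℂ) ^ 2 - (l : ℂ) ^ 2) * ∑ d, waveInner G W k l b β d := by
    rw [Finset.mul_sum (f := fun d => waveInner G W k l b β d),
      ← Finset.sum_congr rfl fun d _ => h1 d, Finset.sum_sub_distrib,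
      Finset.sum_neg_distrib, sum_rev G ω]
    ring
  have h3 : ∑ d, ω d = Complex.I * (((k : ℂ) + l) *
      (∑ d, (conj (b d) * β d - conj (inAmp G W k b d) * inAmp G W l β d)) +
      ((l : ℂ) - k) * ∑ d, (conj (inAmp G W k b d) * β d - conj (b d) * inAmp G W l β d)) := by
    rw [Finset.mul_sum, Finset.mul_sum, ← Finset.sum_add_distrib, Finset.mul_sum]
    refine Finset.sum_congr rfl fun d _ => ?_
    simp only [hω, hp, hq, waveInit, map_mul, map_add, map_sub, Complex.conj_I, Complex.conj_ofReal]
    ring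
  have hkl : (k : ℂ) + l ≠ 0 := by
    have : k + l ≠ 0 := by positivity
    exact_mod_cast this
  rw [h3] at h2
  refine mul_left_cancel₀ hkl ?_
  field_simp
  linear_combination (Complex.I) * h2 + 2 * (((k : ℂ) + l) *
      (∑ d, (conj (b d) * β d - conj (inAmp G W k b d) * inAmp G W l β d)) +
      ((l : ℂ) - k) * ∑ d, (conj (inAmp G W k b d) * β d - conj (b d) * inAmp G W l β d)) *
        Complex.I_sq

theorem sum_conj_inAmp (k l : ℝ) (b β : D → ℂ) :
    ∑ d, conj (inAmp G W k b d) * inAmp G W l β d =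
      star (transitionMatrix G W (k : ℂ) *ᵥ b) ⬝ᵥ (transitionMatrix G W (l : ℂ) *ᵥ β) :=
  sum_rev G fun d => conj ((transitionMatrix G W (k : ℂ) *ᵥ b) d) *
    (transitionMatrix G W (l : ℂ) *ᵥ β) d

theorem eq_one_of_isometry {A : Matrix D D ℂ}
    (h : ∀ b β : D → ℂ, star (A *ᵥ b) ⬝ᵥ (A *ᵥ β) = star b ⬝ᵥ β) : Aᴴ * A = 1 := by
  ext i j
  have := h (Pi.single i 1) (Pi.single j 1)
  simp only [mulVec_single_one] at this
  rw [← Pi.single_star, star_one, single_one_dotProduct] at this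
  rw [Matrix.mul_apply, Matrix.one_apply]
  rw [Pi.single_apply] at this
  rw [← this]
  rfl

theorem transitionMatrix_unitary {k : ℝ} (hk : 0 < k) :
    (transitionMatrix G W (k : ℂ))ᴴ * transitionMatrix G W (k : ℂ) = 1 := by
  refine eq_one_of_isometry fun b β => ?_
  have h := green_scattering G W hk hk b β
  rw [sub_self, zero_mul, Finset.sum_sub_distrib, sum_conj_inAmp, sub_eq_zero] at h
  rw [← h]; rfl

/-! ### The vertex conditions -/

section
variable {V D : Type*} (G : MetricGraph V D) [Fintype D] [DecidableEq V]

/-- The sum of `c` over the directed edges that start at `v`. -/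
def vertexSum (c : D → ℂ) (v : V) : ℂ := ∑ d with G.init d = v, c d

theorem vertexSum_mul (z : D → ℂ) (h : V → ℂ) (v : V) :
    vertexSum G (fun d => h (G.init d) * z d) v = h v * vertexSum G z v := by
  rw [vertexSum, vertexSum, Finset.mul_sum]
  refine Finset.sum_congr rfl fun d hd => ?_
  rw [(Finset.mem_filter.1 hd).2]

theorem vertexSum_const (h : V → ℂ) (v : V) :
    vertexSum G (fun d => h (G.init d)) v = h v * (G.degree v : ℂ) := by
  have := vertexSum_mul G (fun _ => 1) h v
  simp only [mul_one] at this
  rw [this, vertexSum, DGraph.degree]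
  simp

theorem vertexSum_conj (z : D → ℂ) (v : V) :
    vertexSum G (fun d => conj (z d)) v = conj (vertexSum G z v) := by
  rw [vertexSum, vertexSum, map_sum]

theorem vertexSum_add (y z : D → ℂ) (v : V) :
    vertexSum G (fun d => y d + z d) v = vertexSum G y v + vertexSum G z v :=
  Finset.sum_add_distrib

theorem sum_vertexSum [Fintype V] (z : D → ℂ) : ∑ v, vertexSum G z v = ∑ d, z d :=
  Finset.sum_fiberwise _ _ _

end

variable [DecidableEq V]

theorem vertexMatrix_mulVec (c : D → ℂ) (d : D) :
    (vertexMatrix G *ᵥ c) d = -c (G.rev d) + 2 / (G.degree (G.init d) : ℂ) *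
      vertexSum G (fun e => c (G.rev e)) (G.init d) := by
  have h1 : ∀ d', vertexMatrix G d d' * c d' = -(if d' = G.rev d then c d' else 0) +
      2 / (G.degree (G.init d) : ℂ) * (if G.init (G.rev d') = G.init d then c d' else 0) := by
    intro d'
    simp only [vertexMatrix, Matrix.of_apply, DGraph.term]
    by_cases h : d' = G.rev d
    · simp only [h, if_true, G.rev_rev]
      ring
    · simp only [h, if_false]
      split_ifs <;> ring
  rw [Matrix.mulVec, dotProduct, Finset.sum_congr rfl fun d' _ => h1 d', Finset.sum_add_distrib,
    Finset.sum_neg_distrib, Finset.sum_ite_eq' , if_pos (Finset.mem_univ _), ← Finset.mul_sum,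
    ← sum_rev G, vertexSum, Finset.sum_filter]
  simp only [G.rev_rev]

/-- On the edges at a vertex of degree `n` the matrix `Σ` acts, up to reversal, as `-1 + (2 / n) J`
with `J` the all-ones matrix, and `J² = n J`. -/
theorem vertexMatrix_unitary [Fintype V] : (vertexMatrix G)ᴴ * vertexMatrix G = 1 := by
  refine eq_one_of_isometry fun c c' => ?_
  let x : D → ℂ := fun d => c (G.rev d)
  let y : D → ℂ := fun d => c' (G.rev d)
  let g : V → ℂ := fun v => 2 / (G.degree v : ℂ)
  have hg : ∀ v, conj (g v) = g v := fun v => by simp [g, map_ofNat]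
  have h0 : star c ⬝ᵥ c' = ∑ d, conj (x d) * y d :=
    (sum_rev G fun d => conj (c d) * c' d).symm
  have h1 : star (vertexMatrix G *ᵥ c) ⬝ᵥ (vertexMatrix G *ᵥ c') = ∑ d, (conj (x d) * y d +
      ((-(g (G.init d) * vertexSum G y (G.init d))) * conj (x d) +
      ((-(g (G.init d) * conj (vertexSum G x (G.init d)))) * y d +
        g (G.init d) ^ 2 * conj (vertexSum G x (G.init d)) * vertexSum G y (G.init d)))) := by
    rw [dotProduct]
    refine Finset.sum_congr rfl fun d _ => ?_
    rw [Pi.star_apply, vertexMatrix_mulVec, vertexMatrix_mulVec]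
    change conj (-x d + g (G.init d) * vertexSum G x (G.init d)) *
      (-y d + g (G.init d) * vertexSum G y (G.init d)) = _
    rw [map_add, map_mul, map_neg, hg]
    ring
  rw [h0, h1, Finset.sum_add_distrib, add_eq_left, ← sum_vertexSum G]
  refine Finset.sum_eq_zero fun v _ => ?_
  rw [vertexSum_add, vertexSum_add,
    vertexSum_mul G (fun d => conj (x d)) (fun v => -(g v * vertexSum G y v)),
    vertexSum_mul G y (fun v => -(g v * conj (vertexSum G x v))),
    vertexSum_const G (fun v => g v ^ 2 * conj (vertexSum G x v) * vertexSum G y v), vertexSum_conj]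
  by_cases hv : (G.degree v : ℂ) = 0
  · simp [g, hv]
  · have : g v * (G.degree v : ℂ) = 2 := by simp only [g]; field_simp
    linear_combination (g v * conj (vertexSum G x v) * vertexSum G y v) * this

/-- The unitary evolution matrix of the graph for real wave numbers. -/
def evol (k : ℝ) : Matrix D D ℂ := vertexMatrix G * transitionMatrix G W (k : ℂ)

theorem evol_unitary [Fintype V] {k : ℝ} (hk : 0 < k) : (evol G W k)ᴴ * evol G W k = 1 := by
  rw [evol, conjTranspose_mul, Matrix.mul_assoc, ← Matrix.mul_assoc _ (vertexMatrix G),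
    vertexMatrix_unitary, Matrix.one_mul, transitionMatrix_unitary G W hk]

theorem evol_mulVec (k : ℝ) (b : D → ℂ) (d : D) :
    (evol G W k *ᵥ b) d = -inAmp G W k b d + 2 / (G.degree (G.init d) : ℂ) *
      vertexSum G (inAmp G W k b) (G.init d) := by
  rw [evol, ← mulVec_mulVec, vertexMatrix_mulVec]; rfl

/-- At an eigenfunction the boundary terms in Green's identity cancel: since `b = -a + g ∑ a` with
real `g`, the sum over the edges at a vertex is `g |∑ a|² - g |∑ a|²`. -/
theorem sum_cross_eq_zero [Fintype V] {k : ℝ} {b : D → ℂ} (hb : evol G W k *ᵥ b = b) :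
    ∑ d, (conj (inAmp G W k b d) * b d - conj (b d) * inAmp G W k b d) = 0 := by
  let a := inAmp G W k b
  let g : V → ℂ := fun v => 2 / (G.degree v : ℂ)
  have hg : ∀ v, conj (g v) = g v := fun v => by simp [g, map_ofNat]
  have h1 : ∀ d, b d = -a d + g (G.init d) * vertexSum G a (G.init d) := fun d => by
    rw [← evol_mulVec, hb]
  have h2 : ∀ d, conj (a d) * b d - conj (b d) * a d =
      (g (G.init d) * vertexSum G a (G.init d)) * conj (a d) +
        (-(g (G.init d) * conj (vertexSum G a (G.init d)))) * a d := fun d => by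
    rw [h1 d, map_add, map_mul, map_neg, hg]
    ring
  rw [Finset.sum_congr rfl fun d _ => h2 d, ← sum_vertexSum G]
  refine Finset.sum_eq_zero fun v _ => ?_
  rw [vertexSum_add, vertexSum_mul G (fun d => conj (a d)) (fun v => g v * vertexSum G a v),
    vertexSum_mul G a (fun v => -(g v * conj (vertexSum G a v))), vertexSum_conj]
  ring

/-! ### Eigenfunctions and fixed vectors of the evolution matrix -/

/-- The outgoing amplitudes of an eigenfunction. -/
def outAmp (k : ℝ) : eigenspace G W ((k : ℂ) ^ 2) →ₗ[ℂ] (D → ℂ) where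
  toFun f d := (f.1 d 0 + edgeDeriv (G.len d) (f.1 d) 0 / (Complex.I * k)) / 2
  map_add' f g := by
    ext d
    have h := edgeDeriv_add (f.2.1.2.1 d).1 (g.2.1.2.1 d).1 0 ⟨le_rfl, (G.len_pos d).le⟩
    simp only [Submodule.coe_add, Pi.add_apply] at h ⊢
    rw [h]; ring
  map_smul' c f := by
    ext d
    have h := edgeDeriv_smul c (f.2.1.2.1 d).1 0 ⟨le_rfl, (G.len_pos d).le⟩
    simp only [Submodule.coe_smul, Pi.smul_apply, smul_eq_mul, RingHom.id_apply] at h ⊢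
    rw [h]; ring

theorem outAmp_spec {k : ℝ} (hk : 0 < k) (f : eigenspace G W ((k : ℂ) ^ 2)) (d : D) :
    waveInit G W k (outAmp G W k f) d = (f.1 d 0, edgeDeriv (G.len d) (f.1 d) 0) := by
  have hk' : (k : ℂ) ≠ 0 := by exact_mod_cast hk.ne'
  have hI : Complex.I * (k : ℂ) ≠ 0 := mul_ne_zero Complex.I_ne_zero hk'
  set b := outAmp G W k f with hb
  let a : D → ℂ := fun d => (f.1 d 0 - edgeDeriv (G.len d) (f.1 d) 0 / (Complex.I * k)) / 2
  have hbd : ∀ d, b d = (f.1 d 0 + edgeDeriv (G.len d) (f.1 d) 0 / (Complex.I * k)) / 2 :=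
    fun d => rfl
  have hsum : ∀ d, a d + b d = f.1 d 0 := fun d => by rw [hbd]; simp only [a]; ring
  have hdiff : ∀ d, a d * -(Complex.I * k) + b d * (Complex.I * k) =
      edgeDeriv (G.len d) (f.1 d) 0 := fun d => by
    rw [hbd]; simp only [a]; field_simp; ring
  have hcombo : ∀ d, ∀ x ∈ Set.Icc 0 (G.len d), f.1 d x = combo (G.len d) (W.w d) k (f.1 d 0)
      (edgeDeriv (G.len d) (f.1 d) 0) x := fun d x hx =>
    eq_combo_of_solves (G.len_pos d) (W.cont d) (f.2.1.2.1 d) (f.2.2 d) hx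
  have hend : ∀ d, combo (G.len d) (W.w d) k (f.1 d 0) (edgeDeriv (G.len d) (f.1 d) 0) (G.len d) =
      f.1 (G.rev d) 0 ∧ combo' (G.len d) (W.w d) k (f.1 d 0) (edgeDeriv (G.len d) (f.1 d) 0)
        (G.len d) = -edgeDeriv (G.len d) (f.1 (G.rev d)) 0 := by
    intro d
    have h0 : (0 : ℝ) ∈ Set.Icc 0 (G.len d) := ⟨le_rfl, (G.len_pos d).le⟩
    have h1 : ∀ x ∈ Set.Icc 0 (G.len d), f.1 (G.rev d) x = combo (G.len d) (W.w (G.rev d)) k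
        (combo (G.len d) (W.w d) k (f.1 d 0) (edgeDeriv (G.len d) (f.1 d) 0) (G.len d))
        (-combo' (G.len d) (W.w d) k (f.1 d 0) (edgeDeriv (G.len d) (f.1 d) 0) (G.len d)) x := by
      intro x hx
      have hx' : G.len d - x ∈ Set.Icc 0 (G.len d) := ⟨by linarith [hx.2], by linarith [hx.1]⟩
      rw [← combo_reverse (G.len_pos d) (W.cont d) (W.cont_rev G d) (W.w_rev_eq G d) k _ _ hx,
        ← hcombo d _ hx', f.2.1.2.2.1 d _ hx', sub_sub_cancel]
    have h2 := (solves_of_eqOn_combo (G.len_pos d) (W.cont_rev G d) h1).2.2 0 h0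
    have h3 := combo_zero (G.len_pos d) (W.cont_rev G d) k
        (combo (G.len d) (W.w d) k (f.1 d 0) (edgeDeriv (G.len d) (f.1 d) 0) (G.len d))
        (-combo' (G.len d) (W.w d) k (f.1 d 0) (edgeDeriv (G.len d) (f.1 d) 0) (G.len d))
    have h4 := h1 0 h0
    rw [h3.1] at h4
    rw [h3.2] at h2
    exact ⟨h4.symm, by rw [h2, neg_neg]⟩
  have hpsi : ∀ d (s : ℂ), edgeSolution (G.len d) (W.w d) k s (G.len d) =
      combo (G.len d) (W.w d) k 1 s (G.len d) ∧ edgeDeriv (G.len d)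
        (edgeSolution (G.len d) (W.w d) k s) (G.len d) = combo' (G.len d) (W.w d) k 1 s (G.len d) :=
    fun d s => ⟨(edgeSolution_eq (G.len_pos d) (W.cont d) k s).1 _ ⟨(G.len_pos d).le, le_rfl⟩,
      (edgeSolution_eq (G.len_pos d) (W.cont d) k s).2 _ ⟨(G.len_pos d).le, le_rfl⟩⟩
  have ha : ∀ d, inAmp G W k b d = a d := by
    intro d
    have hden : transDen G W (k : ℂ) (G.rev d) ≠ 0 := by
      rw [transDen_eq G W hk]
      exact mul_ne_zero (by exact_mod_cast hk.ne') (redDen_ne_zero G W hk _)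
    have := transitionMatrix_spec G W (k : ℂ) (G.rev d) a b hden (by
      rw [hsum, G.rev_rev, G.len_rev, psiPlus, psiMinus, (hpsi d _).1, (hpsi d _).1,
        ← (hend d).1]
      simp only [combo]
      linear_combination (-(cosSol (G.len d) (W.w d) k (G.len d) : ℂ)) * hsum d -
        (sinSol (G.len d) (W.w d) k (G.len d) : ℂ) * hdiff d) (by
      rw [hdiff, G.rev_rev, G.len_rev, psiPlus, psiMinus, (hpsi d _).2, (hpsi d _).2]
      have := (hend d).2
      rw [eq_neg_iff_add_eq_zero] at this
      simp only [combo'] at this ⊢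
      linear_combination this + (cosSol' (G.len d) (W.w d) k (G.len d) : ℂ) * hsum d +
        (sinSol' (G.len d) (W.w d) k (G.len d) : ℂ) * hdiff d)
    rw [inAmp, transitionMatrix_mulVec]
    simpa only [G.rev_rev] using this.symm
  rw [waveInit, ha, hsum, ← hdiff d]
  congr 1
  ring

/-- An eigenfunction without outgoing waves has no incoming waves either, so it vanishes. -/
theorem outAmp_injective {k : ℝ} (hk : 0 < k) : Function.Injective (outAmp G W k) := by
  rw [injective_iff_map_eq_zero]
  intro f hf
  have h0 : ∀ d, waveInit G W k 0 d = 0 := fun d => by simp [waveInit, inAmp]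
  ext d x
  by_cases hx : x ∈ Set.Icc 0 (G.len d)
  · rw [eq_combo_of_solves (G.len_pos d) (W.cont d) (f.2.1.2.1 d) (f.2.2 d) hx]
    have h := outAmp_spec G W hk f d
    rw [hf, h0] at h
    have h1 : f.1 d 0 = 0 := (congrArg Prod.fst h).symm
    have h2 : edgeDeriv (G.len d) (f.1 d) 0 = 0 := (congrArg Prod.snd h).symm
    simp [combo, h1, h2]
  · simpa using f.2.1.1 d x hx

/-- In terms of the amplitudes `a`, `b`, continuity at a vertex says that `a + b` is constant on the
edges that start there, the Kirchhoff condition that `b - a` has sum zero; together they say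
`b = -a + (2 / deg) ∑ a`, that is, `b = Σ T b`. -/
theorem range_outAmp {k : ℝ} (hk : 0 < k) :
    LinearMap.range (outAmp G W k) = LinearMap.ker (1 - evol G W k).mulVecLin := by
  have hk' : (k : ℂ) ≠ 0 := by exact_mod_cast hk.ne'
  have hI : Complex.I * (k : ℂ) ≠ 0 := mul_ne_zero Complex.I_ne_zero hk'
  ext b
  rw [LinearMap.mem_ker, mulVecLin_apply, sub_mulVec, one_mulVec, sub_eq_zero]
  constructor
  · rintro ⟨f, rfl⟩
    set b := outAmp G W k f
    set a := inAmp G W k b with ha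
    have h1 : ∀ d, a d + b d = f.1 d 0 := fun d => congrArg Prod.fst (outAmp_spec G W hk f d)
    have h2 : ∀ d, Complex.I * k * (b d - a d) = edgeDeriv (G.len d) (f.1 d) 0 :=
      fun d => congrArg Prod.snd (outAmp_spec G W hk f d)
    ext d
    rw [evol_mulVec, ← ha]
    have h3 : vertexSum G (fun e => a e + b e) (G.init d) =
        (G.degree (G.init d) : ℂ) * (a d + b d) := by
      have e : vertexSum G (fun e => a e + b e) (G.init d) =
          vertexSum G (fun _ => (a d + b d) * 1) (G.init d) := by
        refine Finset.sum_congr rfl fun e he => ?_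
        change a e + b e = (a d + b d) * 1
        rw [h1, h1, mul_one]
        exact f.2.1.2.2.2.1 e d (Finset.mem_filter.1 he).2
      rw [e]
      have := vertexSum_const G (fun _ => (a d + b d) * 1) (G.init d)
      rw [this]; ring
    have h4 : vertexSum G b (G.init d) = vertexSum G a (G.init d) := by
      have := f.2.1.2.2.2.2 (G.init d)
      rw [Finset.sum_congr rfl fun e _ => (h2 e).symm, ← Finset.mul_sum, mul_eq_zero] at this
      have := this.resolve_left hI
      rwa [Finset.sum_sub_distrib, sub_eq_zero] at this
    rw [vertexSum_add, h4] at h3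
    have h5 : (G.degree (G.init d) : ℂ) ≠ 0 := by
      have : 0 < G.degree (G.init d) := Finset.card_pos.2 ⟨d, by simp⟩
      exact_mod_cast this.ne'
    field_simp
    linear_combination -h3
  · intro hb
    set a := inAmp G W k b with ha
    let f : D → ℝ → ℂ := fun d => Set.indicator (Set.Icc 0 (G.len d))
      (combo (G.len d) (W.w d) k (waveInit G W k b d).1 (waveInit G W k b d).2)
    have hf : ∀ d, ∀ x ∈ Set.Icc 0 (G.len d), f d x =
        combo (G.len d) (W.w d) k (waveInit G W k b d).1 (waveInit G W k b d).2 x :=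
      fun d x hx => Set.indicator_of_mem hx _
    have hs := fun d => solves_of_eqOn_combo (G.len_pos d) (W.cont d) (hf d)
    have h00 : ∀ d, (0 : ℝ) ∈ Set.Icc 0 (G.len d) := fun d => ⟨le_rfl, (G.len_pos d).le⟩
    have hf0 : ∀ d, f d 0 = a d + b d := fun d => by
      rw [hf d 0 (h00 d), (combo_zero (G.len_pos d) (W.cont d) k _ _).1]; rfl
    have hf0' : ∀ d, edgeDeriv (G.len d) (f d) 0 = Complex.I * k * (b d - a d) := fun d => by
      rw [(hs d).2.2 0 (h00 d), (combo_zero (G.len_pos d) (W.cont d) k _ _).2]; rfl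
    have hbd : ∀ d, b d = -a d + 2 / (G.degree (G.init d) : ℂ) * vertexSum G a (G.init d) :=
      fun d => by rw [ha, ← evol_mulVec, ← hb]
    have hmem : f ∈ eigenspace G W ((k : ℂ) ^ 2) := by
      refine ⟨⟨fun d x hx => Set.indicator_of_notMem hx _, fun d => (hs d).1, fun d x hx => ?_,
        fun d d' hd => ?_, fun v => ?_⟩, fun d => (hs d).2.1⟩
      · have hx' : G.len d - x ∈ Set.Icc 0 (G.len d) := ⟨by linarith [hx.2], by linarith [hx.1]⟩
        have hx'' : G.len d - x ∈ Set.Icc 0 (G.len (G.rev d)) := by rwa [G.len_rev]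
        rw [hf d x hx, hf (G.rev d) _ hx'']
        have h1 := combo_reverse (G.len_pos d) (W.cont d) (W.cont_rev G d) (W.w_rev_eq G d) k
          (waveInit G W k b d).1 (waveInit G W k b d).2 hx'
        rw [(waveInit_end G W hk b d).1, (waveInit_end G W hk b d).2, neg_neg, sub_sub_cancel] at h1
        rw [h1, G.len_rev]
      · rw [hf0, hf0, hbd, hbd d', hd]; ring
      · rw [Finset.sum_congr rfl fun d _ => hf0' d, ← Finset.mul_sum]
        refine mul_eq_zero_of_right _ ?_
        have h1 : ∀ d, b d - a d = 2 / (G.degree (G.init d) : ℂ) * vertexSum G a (G.init d) +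
            (-2) * a d := fun d => by rw [hbd d]; ring
        change vertexSum G (fun d => b d - a d) v = 0
        simp only [h1]
        rw [vertexSum_add, vertexSum_const G (fun v => 2 / (G.degree v : ℂ) * vertexSum G a v),
          vertexSum_mul G a (fun _ => -2)]
        by_cases hv : (G.degree v : ℂ) = 0
        · have : vertexSum G a v = 0 := by
            have h2 : G.degree v = 0 := by exact_mod_cast hv
            rw [DGraph.degree, Finset.card_eq_zero] at h2
            rw [vertexSum, h2, Finset.sum_empty]
          rw [this]; ring
        · field_simp; ring
    refine ⟨⟨f, hmem⟩, ?_⟩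
    ext d
    change (f d 0 + edgeDeriv (G.len d) (f d) 0 / (Complex.I * k)) / 2 = b d
    rw [hf0, hf0']
    field_simp
    ring

theorem finite_eigenspace {k : ℝ} (hk : 0 < k) :
    Module.Finite ℂ (eigenspace G W ((k : ℂ) ^ 2)) :=
  Module.Finite.of_injective _ (outAmp_injective G W hk)

/-- The outgoing amplitudes identify the eigenfunctions with the vectors fixed by the evolution
matrix. -/
theorem multiplicity_eq {k : ℝ} (hk : 0 < k) :
    multiplicity G W k = Module.finrank ℂ (LinearMap.ker (1 - evol G W k).mulVecLin) := by
  rw [← range_outAmp G W hk, multiplicity]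
  exact (LinearEquiv.ofInjective _ (outAmp_injective G W hk)).finrank_eq

end

end QuantumGraph

end

noncomputable section

namespace QuantumGraph

open Filter Topology Matrix ComplexConjugate

/-! ### Monotonicity of the eigenphases at the eigenvalue one -/

section
variable {L : ℝ} {w : ℝ → ℝ}

theorem integral_combo_mul (hL : 0 < L) (hw : ContinuousOn w (Set.Icc 0 L)) (k l : ℝ)
    (p s p' s' : ℂ) :
    ∫ x in (0 : ℝ)..L, combo L w l p s x * combo L w k p' s' x =
      p * p' * (∫ x in (0 : ℝ)..L, cosSol L w l x * cosSol L w k x : ℝ) +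
      p * s' * (∫ x in (0 : ℝ)..L, cosSol L w l x * sinSol L w k x : ℝ) +
      s * p' * (∫ x in (0 : ℝ)..L, sinSol L w l x * cosSol L w k x : ℝ) +
      s * s' * (∫ x in (0 : ℝ)..L, sinSol L w l x * sinSol L w k x : ℝ) := by
  have hLm : L ∈ Set.Icc 0 L := ⟨hL.le, le_rfl⟩
  have fC := isSolutionFamily_cosSol hL hw
  have fS := isSolutionFamily_sinSol hL hw
  have toC : ∀ {f : ℝ → ℝ}, IntervalIntegrable f MeasureTheory.volume 0 L →
      IntervalIntegrable (fun x => (f x : ℂ)) MeasureTheory.volume 0 L :=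
    fun h => ⟨h.1.ofReal, h.2.ofReal⟩
  have i1 := (toC (fC.intervalIntegrable_mul fC l k hLm)).const_mul (p * p')
  have i2 := (toC (fC.intervalIntegrable_mul fS l k hLm)).const_mul (p * s')
  have i3 := (toC (fS.intervalIntegrable_mul fC l k hLm)).const_mul (s * p')
  have i4 := (toC (fS.intervalIntegrable_mul fS l k hLm)).const_mul (s * s')
  simp only [← intervalIntegral.integral_ofReal, ← intervalIntegral.integral_const_mul]
  rw [← intervalIntegral.integral_add i1 i2, ← intervalIntegral.integral_add (i1.add i2) i3,
    ← intervalIntegral.integral_add ((i1.add i2).add i3) i4]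
  refine intervalIntegral.integral_congr fun x _ => ?_
  simp only [combo]
  push_cast
  ring

/-- The `L²` norm of a nonzero solution is positive. -/
theorem combo_norm_pos (hL : 0 < L) (hw : ContinuousOn w (Set.Icc 0 L)) (k : ℝ) (p s : ℂ) :
    ∃ r : ℝ, 0 ≤ r ∧ (∫ x in (0 : ℝ)..L, combo L w k (conj p) (conj s) x * combo L w k p s x) = r ∧
      (r = 0 → p = 0 ∧ s = 0) := by
  have hc := combo_continuousOn hL hw k p s
  refine ⟨∫ x in (0 : ℝ)..L, ‖combo L w k p s x‖ ^ 2,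
    intervalIntegral.integral_nonneg hL.le fun _ _ => by positivity, ?_, fun h0 => ?_⟩
  · rw [← intervalIntegral.integral_ofReal]
    refine intervalIntegral.integral_congr fun x _ => ?_
    simp only [← conj_combo, mul_comm (conj _), Complex.mul_conj, Complex.normSq_eq_norm_sq]
  · have hz : ∀ x ∈ Set.Icc 0 L, combo L w k p s x = 0 := by
      intro x hx
      by_contra hne
      have := intervalIntegral.integral_pos hL (hc.norm.pow 2) (fun _ _ => sq_nonneg _)
        ⟨x, hx, pow_pos (norm_pos_iff.2 hne) 2⟩
      exact this.ne' h0
    have h00 : (0 : ℝ) ∈ Set.Icc 0 L := ⟨le_rfl, hL.le⟩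
    have h1 := edgeDeriv_congr (g := fun _ => 0) hz 0 h00
    rw [edgeDeriv_eq hL h00 (combo_hasDerivAt hL hw k p s h00).1,
      edgeDeriv_eq hL h00 (hasDerivAt_const 0 0), (combo_zero hL hw k p s).2] at h1
    have h2 := hz 0 h00
    rw [(combo_zero hL hw k p s).1] at h2
    exact ⟨h2, h1⟩

end

section
variable {V D : Type*} (G : MetricGraph V D) (W : Potential G) [Fintype D] [DecidableEq D]

theorem continuousAt_inAmp {k : ℝ} (hk : 0 < k) (b : D → ℂ) (d : D) :
    ContinuousAt (fun l => inAmp G W l b d) k := by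
  simp only [inAmp, Matrix.mulVec, dotProduct]
  exact tendsto_finsetSum _ fun e _ =>
    ((isTame_transitionMatrix G W (G.rev d) e).diff k hk).continuousAt.mul continuousAt_const

theorem continuousAt_waveInner {k : ℝ} (hk : 0 < k) (b : D → ℂ) (d : D) :
    ContinuousAt (fun l => waveInner G W k l b b d) k := by
  have hL := G.len_pos d
  have hw := W.cont d
  have hLm : G.len d ∈ Set.Icc 0 (G.len d) := ⟨hL.le, le_rfl⟩
  have fC := isSolutionFamily_cosSol hL hw
  have fS := isSolutionFamily_sinSol hL hw
  have ha := continuousAt_inAmp G W hk b d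
  have hp : ContinuousAt (fun l => (waveInit G W l b d).1) k := ha.add continuousAt_const
  have hs : ContinuousAt (fun l => (waveInit G W l b d).2) k :=
    (continuousAt_const.mul Complex.continuous_ofReal.continuousAt).mul (continuousAt_const.sub ha)
  simp only [waveInner, mul_comm (combo (G.len d) (W.w d) k _ _ _), integral_combo_mul hL hw]
  have hint : ∀ {u v p q : ℝ → ℝ → ℝ}, IsSolutionFamily (G.len d) (W.w d) u v →
      IsSolutionFamily (G.len d) (W.w d) p q →
      ContinuousAt (fun l => ((∫ t in (0 : ℝ)..G.len d, u l t * p k t : ℝ) : ℂ)) k :=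
    fun h h' => Complex.continuous_ofReal.continuousAt.comp
      (h.tendsto_integral hL hw h' hk hLm (g := fun _ => k) continuousAt_const rfl)
  exact ((((hp.mul continuousAt_const).mul (hint fC fC)).add
    ((hp.mul continuousAt_const).mul (hint fC fS))).add
    ((hs.mul continuousAt_const).mul (hint fS fC))).add
    ((hs.mul continuousAt_const).mul (hint fS fS))

variable [Fintype V] [DecidableEq V]

/-- On the fixed space of the evolution matrix the quadratic form of its derivative has positive
imaginary part: it is `i / 2` times the squared `L²` norm of the eigenfunction. -/
theorem evol_deriv_pos {k : ℝ} (hk : 0 < k) {b : D → ℂ} (hb : evol G W k *ᵥ b = b) (hb0 : b ≠ 0) :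
    ∃ c : ℂ, 0 < c.im ∧ Tendsto (fun l : ℝ =>
      (star b ⬝ᵥ ((evol G W l - evol G W k) *ᵥ b)) / ((l : ℂ) - k)) (𝓝[≠] k) (𝓝 c) := by
  choose r hr0 hr hr' using fun d => combo_norm_pos (G.len_pos d) (W.cont d) k
    (waveInit G W k b d).1 (waveInit G W k b d).2
  have hpos : 0 < ∑ d, r d := by
    obtain ⟨d, hd⟩ := Function.ne_iff.1 hb0
    refine Finset.sum_pos' (fun d _ => hr0 d) ⟨d, Finset.mem_univ d,
      lt_of_le_of_ne (hr0 d) fun h => hd ?_⟩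
    obtain ⟨h1, h2⟩ := hr' d h.symm
    simp only [waveInit, mul_eq_zero, Complex.I_ne_zero, Complex.ofReal_eq_zero, hk.ne',
      false_or] at h1 h2
    simp only [Pi.zero_apply]
    linear_combination (h1 + h2) / 2
  refine ⟨Complex.I / 2 * (∑ d, waveInner G W k k b b d) + 1 / ((k : ℂ) + k) *
    ∑ d, (conj (inAmp G W k b d) * b d - conj (b d) * inAmp G W k b d), ?_, ?_⟩
  · rw [sum_cross_eq_zero G W hb, mul_zero, add_zero]
    have h : ∑ d, waveInner G W k k b b d = ((∑ d, r d : ℝ) : ℂ) := by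
      push_cast
      exact Finset.sum_congr rfl fun d _ => hr d
    rw [h, div_mul_eq_mul_div]
    simp [hpos]
  have hc : ContinuousAt (fun l : ℝ => Complex.I / 2 * (∑ d, waveInner G W k l b b d) +
      1 / ((k : ℂ) + l) *
        ∑ d, (conj (inAmp G W k b d) * b d - conj (b d) * inAmp G W l b d)) k := by
    refine (continuousAt_const.mul (tendsto_finsetSum _ fun d _ =>
      continuousAt_waveInner G W hk b d)).add (.mul ?_ (tendsto_finsetSum _ fun d _ =>
        continuousAt_const.sub (continuousAt_const.mul (continuousAt_inAmp G W hk b d))))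
    refine continuousAt_const.div (continuousAt_const.add
      Complex.continuous_ofReal.continuousAt) ?_
    have : k + k ≠ 0 := by positivity
    exact_mod_cast this
  refine (hc.tendsto.mono_left nhdsWithin_le_nhds).congr' ?_
  filter_upwards [self_mem_nhdsWithin, nhdsWithin_le_nhds (Ioi_mem_nhds hk)] with l hl hl0
  have hkl : (l : ℂ) - k ≠ 0 := by
    rw [sub_ne_zero]; exact_mod_cast hl
  have hiso : star b ⬝ᵥ (evol G W l *ᵥ b) = ∑ d, conj (inAmp G W k b d) * inAmp G W l b d := by
    rw [sum_conj_inAmp]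
    nth_rewrite 1 [← hb]
    rw [evol, evol, ← mulVec_mulVec, ← mulVec_mulVec, star_mulVec (vertexMatrix G),
      dotProduct_mulVec, vecMul_vecMul, vertexMatrix_unitary, vecMul_one]
  have hg := green_scattering G W hk hl0 b b
  have h2 : ∑ d, (conj (b d) * b d - conj (inAmp G W k b d) * inAmp G W l b d) =
      -(star b ⬝ᵥ ((evol G W l - evol G W k) *ᵥ b)) := by
    rw [Finset.sum_sub_distrib, sub_mulVec, dotProduct_sub, hiso, hb, neg_sub]
    rfl
  rw [h2] at hg
  rw [eq_div_iff hkl]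
  linear_combination hg

end

end QuantumGraph

end

noncomputable section

namespace QuantumGraph

open Filter Topology Matrix ComplexConjugate

/-! ### Diagonalisation of unitary matrices -/

open scoped ComplexOrder in
theorem star_dotProduct_self_ne_zero {n : Type*} [Fintype n] {x : n → ℂ} (hx : x ≠ 0) :
    star x ⬝ᵥ x ≠ 0 := by
  rw [Ne, dotProduct_star_self_eq_zero]; exact hx

section
variable {n : Type*} [Fintype n] [DecidableEq n]

/-- The eigenvectors of a unitary matrix span the space: the Hermitian and the skew-Hermitian part
commute, so that they can be diagonalised simultaneously. -/
theorem span_eigenvectors_eq_top {U : Matrix n n ℂ} (hU : Uᴴ * U = 1) :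
    Submodule.span ℂ {x : n → ℂ | ∃ z : ℂ, U *ᵥ x = z • x} = ⊤ := by
  have hU' : U * Uᴴ = 1 := mul_eq_one_comm.1 hU
  obtain ⟨A, hAd⟩ : ∃ A : Matrix n n ℂ, A = (1 / 2 : ℂ) • (U + Uᴴ) := ⟨_, rfl⟩
  obtain ⟨B, hBd⟩ : ∃ B : Matrix n n ℂ, B = (Complex.I / 2) • (Uᴴ - U) := ⟨_, rfl⟩
  have hA : A.IsHermitian := by
    simp only [hAd, IsHermitian, conjTranspose_smul, conjTranspose_add, conjTranspose_conjTranspose]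
    rw [add_comm Uᴴ U]; congr 1; simp
  have hB : B.IsHermitian := by
    simp only [hBd, IsHermitian, conjTranspose_smul, conjTranspose_sub, conjTranspose_conjTranspose]
    rw [← neg_sub Uᴴ U, smul_neg, ← neg_smul]
    congr 1
    simp [neg_div]
  have hAB : A * B = B * A := by
    simp only [hAd, hBd, smul_mul_smul_comm, add_mul, mul_sub, mul_add, sub_mul, hU, hU']
    rw [mul_comm (1 / 2 : ℂ)]
    congr 1
    abel
  have hAB' : Commute (toEuclideanLin A) (toEuclideanLin B) := by
    have h1 := toLpLin_mul_same 2 A B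
    have h2 := toLpLin_mul_same 2 B A
    rw [hAB, h2] at h1
    exact h1.symm
  have htop := LinearMap.IsSymmetric.iSup_iSup_eigenspace_inf_eigenspace_eq_top_of_commute
    (isSymmetric_toEuclideanLin_iff.2 hA) (isSymmetric_toEuclideanLin_iff.2 hB) hAB'
  have hle : (⨆ α, ⨆ γ, Module.End.eigenspace (toEuclideanLin A) α ⊓
      Module.End.eigenspace (toEuclideanLin B) γ) ≤
      (Submodule.span ℂ {x : n → ℂ | ∃ z : ℂ, U *ᵥ x = z • x}).comap
        (WithLp.linearEquiv 2 ℂ (n → ℂ)).toLinearMap := by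
    refine iSup_le fun α => iSup_le fun γ => ?_
    rintro x ⟨h1, h2⟩
    rw [SetLike.mem_coe, Module.End.mem_eigenspace_iff] at h1 h2
    have h1' : A *ᵥ x.ofLp = α • x.ofLp := congrArg WithLp.ofLp h1
    have h2' : B *ᵥ x.ofLp = γ • x.ofLp := congrArg WithLp.ofLp h2
    refine Submodule.subset_span ⟨α + Complex.I * γ, ?_⟩
    have hUAB : U = A + Complex.I • B := by
      have : Complex.I * (Complex.I / 2) = -(1 / 2) := by
        rw [mul_div_assoc', Complex.I_mul_I]; norm_num
      simp only [hAd, hBd, smul_smul, this, smul_add, smul_sub]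
      module
    change U *ᵥ x.ofLp = (α + Complex.I * γ) • x.ofLp
    have h3 : U *ᵥ x.ofLp = (A + Complex.I • B) *ᵥ x.ofLp := by rw [← hUAB]
    rw [h3, add_mulVec, smul_mulVec, h1', h2', add_smul, smul_smul]
  rw [htop, top_le_iff] at hle
  rw [eq_top_iff]
  intro x _
  have : WithLp.toLp 2 x ∈ (⊤ : Submodule ℂ (EuclideanSpace ℂ n)) := trivial
  rw [← hle] at this
  exact this

theorem exists_diagonalization {U : Matrix n n ℂ} (hU : Uᴴ * U = 1) :
    ∃ (P Q : Matrix n n ℂ) (u : n → ℂ), P * Q = 1 ∧ Q * P = 1 ∧ U = P * diagonal u * Q := by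
  obtain ⟨s, hs, hspan, hli⟩ := exists_linearIndependent ℂ {x : n → ℂ | ∃ z : ℂ, U *ᵥ x = z • x}
  rw [span_eigenvectors_eq_top hU] at hspan
  let e₀ : Module.Basis s ℂ (n → ℂ) := Module.Basis.mk hli (by simp [hspan])
  have : Fintype s := Module.Basis.fintypeIndexOfRankLtAleph0 e₀ (Module.rank_lt_aleph0 ℂ (n → ℂ))
  have hcard : Fintype.card s = Fintype.card n := by
    rw [← Module.finrank_eq_card_basis e₀, Module.finrank_fintype_fun_eq_card]
  let e : Module.Basis n ℂ (n → ℂ) := e₀.reindex (Fintype.equivOfCardEq hcard)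
  have he : ∀ j, ∃ z : ℂ, U *ᵥ e j = z • e j := by
    intro j
    have : e j = ((Fintype.equivOfCardEq hcard).symm j : s) := by
      simp [e, e₀, Module.Basis.reindex_apply]
    rw [this]
    exact hs ((Fintype.equivOfCardEq hcard).symm j).2
  choose u hu using he
  let P : Matrix n n ℂ := (Pi.basisFun ℂ n).toMatrix e
  let Q : Matrix n n ℂ := e.toMatrix (Pi.basisFun ℂ n)
  have hPQ : P * Q = 1 := Module.Basis.toMatrix_mul_toMatrix_flip _ _
  have hP : ∀ i j, P i j = e j i := fun i j => by simp [P, Module.Basis.toMatrix_apply]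
  refine ⟨P, Q, u, hPQ, Module.Basis.toMatrix_mul_toMatrix_flip _ _, ?_⟩
  have h : U * P = P * diagonal u := by
    ext i j
    rw [mul_diagonal, Matrix.mul_apply, hP]
    simp only [hP]
    have := congrFun (hu j) i
    rw [Pi.smul_apply, smul_eq_mul, mul_comm] at this
    exact this
  rw [← h, Matrix.mul_assoc, hPQ, Matrix.mul_one]

/-- The eigenvalues of a unitary matrix, listed with multiplicity, and their relation to traces of
powers, determinant, and fixed space. -/
theorem exists_eigenvalues {U : Matrix n n ℂ} (hU : Uᴴ * U = 1) :
    ∃ u : n → ℂ, (∀ j, ‖u j‖ = 1) ∧ (∀ j, ∃ x, x ≠ 0 ∧ U *ᵥ x = u j • x) ∧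
      (∀ m : ℕ, (U ^ m).trace = ∑ j, u j ^ m) ∧ U.det = ∏ j, u j ∧
      Module.finrank ℂ (LinearMap.ker (1 - U).mulVecLin) = (Finset.univ.filter (u · = 1)).card := by
  obtain ⟨P, Q, u, hPQ, hQP, hUd⟩ := exists_diagonalization hU
  have hvec : ∀ j, ∃ x, x ≠ 0 ∧ U *ᵥ x = u j • x := by
    intro j
    refine ⟨P *ᵥ Pi.single j 1, fun h => ?_, ?_⟩
    · have h1 := congrArg (Q *ᵥ ·) h
      simp only [mulVec_mulVec, hQP, one_mulVec, mulVec_zero] at h1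
      have := congrFun h1 j
      simp at this
    · rw [hUd, mulVec_mulVec, Matrix.mul_assoc, hQP, Matrix.mul_one, ← mulVec_mulVec,
        ← mulVec_smul]
      congr 1
      ext i
      rw [mulVec_diagonal]
      by_cases h : i = j
      · subst h; simp
      · simp [h]
  refine ⟨u, fun j => ?_, hvec, fun m => ?_, ?_, ?_⟩
  · obtain ⟨x, hx, hxU⟩ := hvec j
    have h1 : star (U *ᵥ x) ⬝ᵥ (U *ᵥ x) = star x ⬝ᵥ x := by
      rw [star_mulVec, dotProduct_mulVec, vecMul_vecMul, hU, vecMul_one]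
    rw [hxU, star_smul, smul_dotProduct, dotProduct_smul, smul_eq_mul, smul_eq_mul,
      ← mul_assoc] at h1
    have h2 := mul_right_cancel₀ (star_dotProduct_self_ne_zero hx) (h1.trans (one_mul _).symm)
    rw [mul_comm] at h2
    change u j * conj (u j) = 1 at h2
    rw [Complex.mul_conj, Complex.normSq_eq_norm_sq] at h2
    have h3 : ‖u j‖ ^ 2 = 1 := by exact_mod_cast h2
    nlinarith [norm_nonneg (u j)]
  · have hpow : U ^ m = P * diagonal (u ^ m) * Q := by
      have : U = (⟨P, Q, hPQ, hQP⟩ : (Matrix n n ℂ)ˣ) * diagonal u *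
          ((⟨P, Q, hPQ, hQP⟩ : (Matrix n n ℂ)ˣ)⁻¹ : (Matrix n n ℂ)ˣ) := hUd
      rw [this, Units.conj_pow, diagonal_pow]
      rfl
    rw [hpow, trace_mul_comm, ← Matrix.mul_assoc, hQP, Matrix.one_mul, trace_diagonal]
    rfl
  · rw [hUd, det_mul, det_mul, det_diagonal, mul_right_comm, ← det_mul, hPQ, det_one, one_mul]
  · have h1 : 1 - U = P * diagonal (fun j => 1 - u j) * Q := by
      have : diagonal (fun j => 1 - u j) = 1 - diagonal u := by
        rw [← diagonal_one, diagonal_sub]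
      rw [this, Matrix.mul_sub, Matrix.sub_mul, ← hUd, Matrix.mul_one, hPQ]
    have hQ : IsUnit Q.det := by
      rw [← Matrix.isUnit_iff_isUnit_det]; exact IsUnit.of_mul_eq_one _ hQP
    have hP : IsUnit P.det := by
      rw [← Matrix.isUnit_iff_isUnit_det]; exact IsUnit.of_mul_eq_one _ hPQ
    have h2 : (1 - U).rank = Fintype.card {i // 1 - u i ≠ 0} := by
      rw [h1, rank_mul_eq_left_of_isUnit_det _ _ hQ, rank_mul_eq_right_of_isUnit_det _ _ hP,
        rank_diagonal]
    have h3 := LinearMap.finrank_range_add_finrank_ker (1 - U).mulVecLin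
    rw [Module.finrank_fintype_fun_eq_card] at h3
    change (1 - U).rank + _ = _ at h3
    have h4 : Fintype.card {i // 1 - u i ≠ 0} = (Finset.univ.filter fun i => ¬ u i = 1).card := by
      rw [Fintype.card_subtype]
      congr 1
      ext i
      simp only [Finset.mem_filter, Finset.mem_univ, true_and, ne_eq, sub_eq_zero]
      exact not_congr eq_comm
    have h5 := Finset.card_filter_add_card_filter_not (s := Finset.univ) (fun i => u i = 1)
    rw [Finset.card_univ] at h5
    omega

end

end QuantumGraph

end

noncomputable section

namespace QuantumGraph

open Filter Topology ComplexConjugate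

/-! ### The sawtooth function -/

/-- The sawtooth function on the unit circle: `(π - θ) / 2` at `exp (iθ)` for `0 < θ < 2π`, and `0`
at `1` (where `arg 0 = 0` is used). -/
def sawtooth (z : ℂ) : ℝ := -Complex.arg (1 - z)

theorem sawtooth_one : sawtooth 1 = 0 := by simp [sawtooth]

theorem abs_sawtooth_le (z : ℂ) : |sawtooth z| ≤ Real.pi := by
  rw [sawtooth, abs_neg]; exact Complex.abs_arg_le_pi _

/-- The partial sums of `∑ zⁿ / n` have uniformly bounded imaginary parts on the unit circle. The
partial sum with `N` terms is compared with `-log (1 - r z)` for `r = 1 - 1 / N`. -/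
theorem abs_im_sum_le {z : ℂ} (hz : ‖z‖ = 1) (N : ℕ) :
    |(∑ n ∈ Finset.range N, z ^ n / n).im| ≤ Real.pi + 2 := by
  rcases Nat.eq_zero_or_pos N with rfl | hN
  · simp only [Finset.range_zero, Finset.sum_empty, Complex.zero_im, abs_zero]
    linarith [Real.pi_pos]
  have hN' : (0 : ℝ) < N := by exact_mod_cast hN
  have hN1 : (1 : ℝ) ≤ N := by exact_mod_cast hN
  set r : ℝ := 1 - 1 / N with hr
  have hr0 : 0 ≤ r := by
    rw [hr, sub_nonneg, div_le_one hN']; exact hN1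
  have hr1 : r < 1 := by rw [hr]; linarith [div_pos one_pos hN']
  have h1r : 1 - r = 1 / N := by rw [hr]; ring
  have hrz : ‖(r : ℂ) * z‖ = r := by
    rw [norm_mul, hz, mul_one, Complex.norm_real, Real.norm_of_nonneg hr0]
  have hs := Complex.hasSum_taylorSeries_neg_log (z := r * z) (by rw [hrz]; exact hr1)
  have hsplit := hs.summable.sum_add_tsum_nat_add N
  rw [hs.tsum_eq] at hsplit
  have htail : ‖∑' n : ℕ, ((r : ℂ) * z) ^ (n + N) / ((n + N : ℕ) : ℂ)‖ ≤ 1 := by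
    have hg : HasSum (fun n : ℕ => r ^ n * (1 / N)) (1 : ℝ) := by
      have := (hasSum_geometric_of_lt_one hr0 hr1).mul_right (1 / (N : ℝ))
      rwa [h1r, inv_mul_cancel₀ (by positivity)] at this
    refine tsum_of_norm_bounded hg fun n => ?_
    rw [norm_div, norm_pow, hrz, Complex.norm_natCast, div_eq_mul_one_div]
    have h1 : r ^ (n + N) ≤ r ^ n := pow_le_pow_of_le_one hr0 hr1.le (Nat.le_add_right _ _)
    have h2 : 1 / ((n + N : ℕ) : ℝ) ≤ 1 / N :=
      one_div_le_one_div_of_le hN' (by push_cast; linarith [(Nat.cast_nonneg n : (0 : ℝ) ≤ n)])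
    exact mul_le_mul h1 h2 (by positivity) (by positivity)
  -- Bernoulli's inequality bounds each of the first `N` differences by `1 - r = 1 / N`
  have hhead : ‖∑ n ∈ Finset.range N, (z ^ n / n - ((r : ℂ) * z) ^ n / n)‖ ≤ 1 := by
    calc ‖∑ n ∈ Finset.range N, (z ^ n / n - ((r : ℂ) * z) ^ n / n)‖
        ≤ ∑ n ∈ Finset.range N, (1 / N : ℝ) := by
          refine norm_sum_le_of_le _ fun n _ => ?_
          rcases Nat.eq_zero_or_pos n with rfl | hn
          · simp
          have hn' : (0 : ℝ) < n := by exact_mod_cast hn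
          have e : z ^ n / n - ((r : ℂ) * z) ^ n / n = z ^ n * (((1 - r ^ n) / n : ℝ) : ℂ) := by
            push_cast
            rw [mul_pow]; ring
          have hb : 1 - r ^ n ≤ n * (1 - r) := by
            have := one_add_mul_le_pow (a := r - 1) (by linarith) n
            rw [add_sub_cancel] at this
            linarith
          have hle : r ^ n ≤ 1 := pow_le_one₀ hr0 hr1.le
          rw [e, norm_mul, norm_pow, hz, one_pow, one_mul, Complex.norm_real, Real.norm_of_nonneg
            (div_nonneg (by linarith) hn'.le), ← h1r, div_le_iff₀ hn']
          linarith
      _ = 1 := by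
          rw [Finset.sum_const, Finset.card_range, nsmul_eq_mul]; field_simp
  rw [Finset.sum_sub_distrib] at hhead
  -- the imaginary part of the logarithm is an argument
  have hlog : |(-Complex.log (1 - r * z)).im| ≤ Real.pi := by
    rw [Complex.neg_im, abs_neg, Complex.log_im]; exact Complex.abs_arg_le_pi _
  have e : ∑ n ∈ Finset.range N, z ^ n / n = (∑ n ∈ Finset.range N, z ^ n / n -
      ∑ n ∈ Finset.range N, ((r : ℂ) * z) ^ n / n) + -Complex.log (1 - r * z) -
        ∑' n : ℕ, ((r : ℂ) * z) ^ (n + N) / ((n + N : ℕ) : ℂ) := by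
    linear_combination hsplit
  rw [e, Complex.sub_im, Complex.add_im]
  have h1 := (Complex.abs_im_le_norm _).trans hhead
  have h2 := (Complex.abs_im_le_norm _).trans htail
  rw [abs_le] at h1 h2 hlog ⊢
  constructor <;> linarith [h1.1, h1.2, h2.1, h2.2, hlog.1, hlog.2]

theorem re_one_sub_pos {z : ℂ} (hz : ‖z‖ = 1) (h1 : z ≠ 1) : 0 < (1 - z).re := by
  have h : z.re ^ 2 + z.im ^ 2 = 1 := by
    have := Complex.normSq_eq_norm_sq z
    rw [hz, Complex.normSq_apply] at this
    linarith
  rw [Complex.sub_re, Complex.one_re, sub_pos]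
  by_contra hle
  push Not at hle
  have him : z.im = 0 := by nlinarith [sq_nonneg z.im]
  have hre : z.re = 1 := by nlinarith [sq_nonneg z.im]
  exact h1 (Complex.ext (by simpa using hre) (by simpa using him))

/-- The Fourier series of the sawtooth function. Convergence is Dirichlet's test, the limit is
identified by Abel's theorem. -/
theorem tendsto_im_sum {z : ℂ} (hz : ‖z‖ = 1) :
    Tendsto (fun N => (∑ n ∈ Finset.range N, z ^ n / n).im) atTop (𝓝 (sawtooth z)) := by
  by_cases h1 : z = 1
  · have : ∀ N, (∑ n ∈ Finset.range N, z ^ n / (n : ℂ)).im = 0 := fun N => by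
      rw [h1, Complex.im_sum]
      refine Finset.sum_eq_zero fun n _ => ?_
      rw [one_pow, one_div, ← Complex.ofReal_natCast, ← Complex.ofReal_inv, Complex.ofReal_im]
    rw [show sawtooth z = 0 by rw [h1, sawtooth_one]]
    exact (tendsto_const_nhds (x := (0 : ℝ))).congr fun N => (this N).symm
  have hne : z - 1 ≠ 0 := sub_ne_zero.2 h1
  have hbdd : ∀ N, ‖∑ i ∈ Finset.range N, z ^ (i + 1)‖ ≤ 2 / ‖z - 1‖ := by
    intro N
    have : ∑ i ∈ Finset.range N, z ^ (i + 1) = z * ((z ^ N - 1) / (z - 1)) := by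
      rw [← geom_sum_eq h1, Finset.mul_sum]
      exact Finset.sum_congr rfl fun i _ => by ring
    rw [this, norm_mul, hz, one_mul, norm_div]
    refine div_le_div_of_nonneg_right ?_ (norm_nonneg _)
    refine (norm_sub_le _ _).trans ?_
    rw [norm_pow, hz]; norm_num
  have hanti : Antitone fun n : ℕ => 1 / ((n : ℝ) + 1) := fun a b hab => by
    have : (a : ℝ) ≤ b := by exact_mod_cast hab
    exact one_div_le_one_div_of_le (by positivity) (by linarith)
  obtain ⟨l, hl⟩ := cauchySeq_tendsto_of_complete
    (hanti.cauchySeq_series_mul_of_tendsto_zero_of_bounded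
      tendsto_one_div_add_atTop_nhds_zero_nat hbdd)
  have hl' : Tendsto (fun N => ∑ n ∈ Finset.range N, z ^ n / (n : ℂ)) atTop (𝓝 l) := by
    rw [← tendsto_add_atTop_iff_nat 1]
    refine hl.congr fun N => ?_
    rw [Finset.sum_range_succ']
    simp only [pow_zero, Nat.cast_zero, div_zero, add_zero]
    refine Finset.sum_congr rfl fun n _ => ?_
    rw [Complex.real_smul]
    push_cast
    ring
  have habel := Complex.tendsto_tsum_powerSeries_nhdsWithin_lt hl'
  rw [tendsto_map'_iff] at habel
  have hcont : Tendsto (fun x : ℝ => -Complex.log (1 - x * z)) (𝓝[<] 1)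
      (𝓝 (-Complex.log (1 - z))) := by
    have : ContinuousAt (fun x : ℝ => -Complex.log (1 - x * z)) 1 := by
      refine (ContinuousAt.clog ?_ ?_).neg
      · fun_prop
      · left; simpa using re_one_sub_pos hz h1
    simpa [ContinuousAt] using this.tendsto.mono_left nhdsWithin_le_nhds
  have hlim : l = -Complex.log (1 - z) := by
    refine tendsto_nhds_unique (habel.congr' ?_) hcont
    filter_upwards [Ioo_mem_nhdsLT (show (0 : ℝ) < 1 by norm_num)] with x hx
    have hxz : ‖(x : ℂ) * z‖ < 1 := by
      rw [norm_mul, hz, mul_one, Complex.norm_real, Real.norm_of_nonneg hx.1.le]; exact hx.2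
    rw [← (Complex.hasSum_taylorSeries_neg_log hxz).tsum_eq]
    refine tsum_congr fun n => ?_
    rw [mul_pow]; ring
  rw [hlim] at hl'
  have := (Complex.continuous_im.tendsto _).comp hl'
  rwa [Complex.neg_im, Complex.log_im] at this

theorem exp_sawtooth {z : ℂ} (hz : ‖z‖ = 1) (h1 : z ≠ 1) :
    Complex.exp (Complex.I * (2 * sawtooth z : ℝ)) = -conj z := by
  have hw : (1 - z) ≠ 0 := sub_ne_zero.2 (Ne.symm h1)
  have hz2 : z * conj z = 1 := by
    rw [Complex.mul_conj, Complex.normSq_eq_norm_sq, hz]; norm_num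
  have hpol := Complex.norm_mul_exp_arg_mul_I (1 - z)
  have he : Complex.exp (Complex.I * (2 * sawtooth z : ℝ)) *
      Complex.exp (Complex.arg (1 - z) * Complex.I) ^ 2 = 1 := by
    rw [← Complex.exp_nat_mul, ← Complex.exp_add, sawtooth]
    push_cast
    rw [← Complex.exp_zero]
    congr 1
    ring
  have hn2 : (‖1 - z‖ : ℂ) ^ 2 = (1 - z) * (1 - conj z) := by
    have := Complex.mul_conj (1 - z)
    rw [Complex.normSq_eq_norm_sq, map_sub, map_one] at this
    rw [this]; push_cast; rfl
  have hnz : (‖1 - z‖ : ℂ) ^ 2 ≠ 0 := by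
    have := norm_ne_zero_iff.2 hw
    exact pow_ne_zero 2 (by exact_mod_cast this)
  have h2 : Complex.exp (Complex.I * (2 * sawtooth z : ℝ)) * (1 - z) ^ 2 =
      -conj z * (1 - z) ^ 2 := by
    calc _ = Complex.exp (Complex.I * (2 * sawtooth z : ℝ)) *
          ((‖1 - z‖ : ℂ) * Complex.exp (Complex.arg (1 - z) * Complex.I)) ^ 2 := by rw [hpol]
      _ = (‖1 - z‖ : ℂ) ^ 2 := by
          rw [mul_pow]; linear_combination (‖1 - z‖ : ℂ) ^ 2 * he
      _ = _ := by rw [hn2]; linear_combination (-(1 - z)) * hz2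
  exact mul_right_cancel₀ (pow_ne_zero 2 hw) h2

theorem sawtooth_exp {θ : ℝ} (h0 : 0 < θ) (h1 : θ < 2 * Real.pi) :
    sawtooth (Complex.exp (θ * Complex.I)) = (Real.pi - θ) / 2 := by
  have hs : 0 < Real.sin (θ / 2) := Real.sin_pos_of_pos_of_lt_pi (by linarith) (by linarith)
  have e : 1 - Complex.exp (θ * Complex.I) = ((2 * Real.sin (θ / 2) : ℝ) : ℂ) *
      (Complex.cos ((θ - Real.pi) / 2 : ℝ) + Complex.sin ((θ - Real.pi) / 2 : ℝ) * Complex.I) := by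
    have e1 : Real.cos ((θ - Real.pi) / 2) = Real.sin (θ / 2) := by
      rw [show (θ - Real.pi) / 2 = -(Real.pi / 2 - θ / 2) by ring, Real.cos_neg,
        Real.cos_pi_div_two_sub]
    have e2 : Real.sin ((θ - Real.pi) / 2) = -Real.cos (θ / 2) := by
      rw [show (θ - Real.pi) / 2 = -(Real.pi / 2 - θ / 2) by ring, Real.sin_neg,
        Real.sin_pi_div_two_sub]
    rw [← Complex.ofReal_cos, ← Complex.ofReal_sin, e1, e2, Complex.exp_mul_I,
      ← Complex.ofReal_cos, ← Complex.ofReal_sin]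
    have h3 : Real.cos θ = 1 - 2 * Real.sin (θ / 2) ^ 2 := by
      have := Real.cos_two_mul (θ / 2)
      rw [mul_div_cancel₀ _ two_ne_zero] at this
      nlinarith [Real.sin_sq_add_cos_sq (θ / 2)]
    have h4 : Real.sin θ = 2 * Real.sin (θ / 2) * Real.cos (θ / 2) := by
      have := Real.sin_two_mul (θ / 2)
      rwa [mul_div_cancel₀ _ two_ne_zero] at this
    rw [h3, h4]
    push_cast
    ring
  rw [sawtooth, e, Complex.arg_mul_cos_add_sin_mul_I (by positivity)
    ⟨by linarith, by linarith [Real.pi_pos]⟩]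
  ring

theorem sawtooth_conj (z : ℂ) (hz : ‖z‖ = 1) : sawtooth (conj z) = -sawtooth z := by
  by_cases h1 : z = 1
  · rw [h1, map_one, sawtooth_one, neg_zero]
  have hre := re_one_sub_pos hz h1
  have : (1 - conj z) = conj (1 - z) := by rw [map_sub, map_one]
  rw [sawtooth, sawtooth, this, Complex.arg_conj, if_neg]
  intro h
  have := Complex.arg_eq_pi_iff.1 h
  linarith [this.1]

theorem exists_angle {z : ℂ} (hz : ‖z‖ = 1) (h1 : z ≠ 1) :
    ∃ θ : ℝ, 0 < θ ∧ θ < 2 * Real.pi ∧ z = Complex.exp (θ * Complex.I) := by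
  have hp := Complex.norm_mul_exp_arg_mul_I z
  rw [hz, Complex.ofReal_one, one_mul] at hp
  have ha := Complex.arg_mem_Ioc z
  rcases lt_trichotomy (Complex.arg z) 0 with h | h | h
  · refine ⟨Complex.arg z + 2 * Real.pi, by linarith [ha.1, Real.pi_pos], by linarith, ?_⟩
    push_cast
    rw [add_mul, Complex.exp_add, Complex.exp_two_pi_mul_I, mul_one, hp]
  · rw [h] at hp; simp at hp; exact absurd hp.symm h1
  · exact ⟨Complex.arg z, h, by linarith [ha.2, Real.pi_pos], hp.symm⟩

theorem norm_exp_sub_one_le {θ β : ℝ} (h : 2 * Real.pi - β ≤ θ) (h' : θ ≤ 2 * Real.pi) :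
    ‖Complex.exp (θ * Complex.I) - 1‖ ≤ β := by
  have e : Complex.exp (θ * Complex.I) = Complex.exp (Complex.I * (θ - 2 * Real.pi : ℝ)) := by
    push_cast
    rw [mul_sub, Complex.exp_sub, mul_comm Complex.I (2 * Real.pi : ℂ), Complex.exp_two_pi_mul_I,
      div_one, mul_comm]
  rw [e]
  refine Real.norm_exp_I_mul_ofReal_sub_one_le.trans ?_
  rw [Real.norm_eq_abs, abs_le]
  constructor <;> linarith

/-- Rotation by a small positive angle shifts the sawtooth function by a constant, as long as the
angle does not pass `2 π`, that is, outside a lower one-sided neighbourhood of `1`. -/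
theorem sawtooth_rotate {z : ℂ} (hz : ‖z‖ = 1) {β ε : ℝ} (hβ : 0 < β) (hβπ : β < Real.pi)
    (hβε : β < ε) (h : ‖z - 1‖ < ε → 0 < z.im) :
    Complex.exp (β * Complex.I) * z ≠ 1 ∧
      sawtooth (Complex.exp (β * Complex.I) * z) = sawtooth z - β / 2 := by
  have h1 : z ≠ 1 := by
    rintro rfl
    have := h (by simpa using hβ.trans hβε)
    simp at this
  obtain ⟨θ, h0, h2, rfl⟩ := exists_angle hz h1
  have hlt : θ + β < 2 * Real.pi := by
    by_contra hle
    push Not at hle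
    have him := h ((norm_exp_sub_one_le (by linarith) h2.le).trans_lt hβε)
    rw [Complex.exp_ofReal_mul_I_im] at him
    have : Real.sin (θ - 2 * Real.pi) < 0 :=
      Real.sin_neg_of_neg_of_neg_pi_lt (by linarith) (by linarith)
    rw [Real.sin_sub_two_pi] at this
    linarith
  have e : Complex.exp (β * Complex.I) * Complex.exp (θ * Complex.I) =
      Complex.exp ((θ + β : ℝ) * Complex.I) := by
    rw [← Complex.exp_add]; push_cast; congr 1; ring
  rw [e, sawtooth_exp (by linarith) hlt, sawtooth_exp h0 h2]
  refine ⟨fun h3 => ?_, by ring⟩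
  have h4 := sawtooth_exp (θ := θ + β) (by linarith) hlt
  rw [Complex.exp_eq_one_iff] at h3
  obtain ⟨n, hn⟩ := h3
  have h5 : θ + β = n * (2 * Real.pi) := by
    have := congrArg Complex.im hn
    simpa using this
  have hp := Real.pi_pos
  have h6 : (0 : ℝ) < n := by
    by_contra hle
    push Not at hle
    nlinarith
  have h7 : (1 : ℝ) ≤ n := by
    have : (0 : ℤ) < n := by exact_mod_cast h6
    exact_mod_cast this
  nlinarith

end QuantumGraph

end

noncomputable section

namespace QuantumGraph

open Filter Topology ComplexConjugate

/-! ### Limits of sums over eigenvalues on the unit circle -/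

section
variable {n : Type*} [Fintype n] {l : Filter ℝ} {u : ℝ → n → ℂ} {u₀ : n → ℂ}

/-- Convergence of all power sums implies convergence of the sums of any continuous function on the
circle, since the trigonometric polynomials are dense. -/
theorem tendsto_sum_of_powerSum (hu : ∀ k j, ‖u k j‖ = 1) (hu₀ : ∀ j, ‖u₀ j‖ = 1)
    (hp : ∀ m : ℕ, Tendsto (fun k => ∑ j, u k j ^ m) l (𝓝 (∑ j, u₀ j ^ m)))
    {F : ℂ → ℂ} (hF : ContinuousOn F (Metric.sphere 0 1)) :
    Tendsto (fun k => ∑ j, F (u k j)) l (𝓝 (∑ j, F (u₀ j))) := by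
  let e := AddCircle.homeomorphCircle (T := (1 : ℝ)) one_ne_zero
  let v : ℝ → n → AddCircle (1 : ℝ) := fun k j =>
    e.symm ⟨u k j, mem_sphere_zero_iff_norm.2 (hu k j)⟩
  let v₀ : n → AddCircle (1 : ℝ) := fun j => e.symm ⟨u₀ j, mem_sphere_zero_iff_norm.2 (hu₀ j)⟩
  have hv : ∀ k j, ((e (v k j) : Circle) : ℂ) = u k j := fun k j =>
    congrArg Subtype.val (e.apply_symm_apply _)
  have hv₀ : ∀ j, ((e (v₀ j) : Circle) : ℂ) = u₀ j := fun j =>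
    congrArg Subtype.val (e.apply_symm_apply _)
  have hfour : ∀ (m : ℤ) (x : AddCircle (1 : ℝ)), fourier m x = ((e x : Circle) : ℂ) ^ m := by
    intro m x
    rw [fourier_apply, AddCircle.toCircle_zsmul, AddCircle.homeomorphCircle_apply]
    simp
  -- the statement for trigonometric polynomials
  have hspan : ∀ g ∈ Submodule.span ℂ (Set.range (@fourier (1 : ℝ))),
      Tendsto (fun k => ∑ j, g (v k j)) l (𝓝 (∑ j, g (v₀ j))) := by
    intro g hg
    induction hg using Submodule.span_induction with
    | mem g hg =>
      obtain ⟨m, rfl⟩ := hg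
      simp only [hfour, hv, hv₀]
      rcases Int.eq_nat_or_neg m with ⟨a, rfl | rfl⟩
      · simpa only [zpow_natCast] using hp a
      · have hinv : ∀ z : ℂ, ‖z‖ = 1 → z ^ (-(a : ℤ)) = conj (z ^ a) := fun z hz => by
          rw [zpow_neg, zpow_natCast, Complex.inv_def, Complex.normSq_eq_norm_sq, norm_pow, hz]
          simp
        have h1 : ∀ k, ∑ j, u k j ^ (-(a : ℤ)) = conj (∑ j, u k j ^ a) := fun k => by
          rw [map_sum]; exact Finset.sum_congr rfl fun j _ => hinv _ (hu k j)
        have h2 : ∑ j, u₀ j ^ (-(a : ℤ)) = conj (∑ j, u₀ j ^ a) := by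
          rw [map_sum]; exact Finset.sum_congr rfl fun j _ => hinv _ (hu₀ j)
        simp only [h1, h2]
        exact (Complex.continuous_conj.tendsto _).comp (hp a)
    | zero => simpa using tendsto_const_nhds
    | add f g _ _ hf hg =>
      simp only [ContinuousMap.add_apply, Finset.sum_add_distrib]
      exact hf.add hg
    | smul c f _ hf =>
      simp only [ContinuousMap.smul_apply, ← Finset.smul_sum]
      exact hf.const_smul c
  let f : C(AddCircle (1 : ℝ), ℂ) := ⟨fun x => F (e x), hF.comp_continuous
    (continuous_subtype_val.comp e.continuous) fun x =>
      mem_sphere_zero_iff_norm.2 (Circle.norm_coe _)⟩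
  have hf : ∀ k, ∑ j, F (u k j) = ∑ j, f (v k j) := fun k => by simp [f, hv]
  have hf₀ : ∑ j, F (u₀ j) = ∑ j, f (v₀ j) := by simp [f, hv₀]
  simp only [hf, hf₀]
  rw [Metric.tendsto_nhds]
  intro ε hε
  have hmem : f ∈ (Submodule.span ℂ (Set.range (@fourier (1 : ℝ)))).topologicalClosure := by
    rw [span_fourier_closure_eq_top]; trivial
  have hc : (0 : ℝ) < 3 * (Fintype.card n + 1) := by positivity
  obtain ⟨g, hg, hfg⟩ := Metric.mem_closure_iff.1 hmem (ε / (3 * (Fintype.card n + 1)))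
    (by positivity)
  have hclose : ∀ y : n → AddCircle (1 : ℝ), dist (∑ j, f (y j)) (∑ j, g (y j)) ≤ ε / 3 := by
    intro y
    calc dist (∑ j, f (y j)) (∑ j, g (y j)) ≤ ∑ j : n, dist (f (y j)) (g (y j)) :=
          dist_sum_sum_le _ _ _
      _ ≤ ∑ j : n, ε / (3 * (Fintype.card n + 1)) :=
          Finset.sum_le_sum fun j _ => (ContinuousMap.dist_apply_le_dist _).trans hfg.le
      _ = (Fintype.card n) * (ε / (3 * (Fintype.card n + 1))) := by
          rw [Finset.sum_const, Finset.card_univ, nsmul_eq_mul]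
      _ ≤ ε / 3 := by
          rw [← mul_div_assoc, div_le_div_iff₀ hc (by norm_num)]
          nlinarith
  filter_upwards [(Metric.tendsto_nhds.1 (hspan g hg)) (ε / 3) (by positivity)] with k hk
  calc dist (∑ j, f (v k j)) (∑ j, f (v₀ j))
      ≤ dist (∑ j, f (v k j)) (∑ j, g (v k j)) + dist (∑ j, g (v k j)) (∑ j, g (v₀ j)) +
        dist (∑ j, g (v₀ j)) (∑ j, f (v₀ j)) := dist_triangle4 _ _ _ _
    _ < ε := by
        have h1 := hclose (v k)
        have h2 := hclose v₀
        rw [dist_comm] at h2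
        linarith

/-- The sawtooth sum is continuous where `1` is not an eigenvalue. -/
theorem tendsto_sum_sawtooth (hu : ∀ k j, ‖u k j‖ = 1) (hu₀ : ∀ j, ‖u₀ j‖ = 1)
    (hp : ∀ m : ℕ, Tendsto (fun k => ∑ j, u k j ^ m) l (𝓝 (∑ j, u₀ j ^ m)))
    (h1 : ∀ j, u₀ j ≠ 1) :
    Tendsto (fun k => ∑ j, sawtooth (u k j)) l (𝓝 (∑ j, sawtooth (u₀ j))) := by
  obtain ⟨ε, hε, hεu⟩ : ∃ ε : ℝ, 0 < ε ∧ ∀ j, 2 * ε ≤ ‖u₀ j - 1‖ := by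
    have hpos : ∀ j, 0 < ‖u₀ j - 1‖ := fun j => norm_pos_iff.2 (sub_ne_zero.2 (h1 j))
    rcases isEmpty_or_nonempty n with h | h
    · exact ⟨1, one_pos, fun j => (h.false j).elim⟩
    · obtain ⟨j₀, hj₀⟩ := Finite.exists_min fun j => ‖u₀ j - 1‖
      exact ⟨‖u₀ j₀ - 1‖ / 2, by linarith [hpos j₀], fun j => by linarith [hj₀ j]⟩
  -- the eigenvalues stay away from `1`
  have hfar : ∀ᶠ k in l, ∀ j, ε ≤ ‖u k j - 1‖ := by
    let b : ℂ → ℝ := fun z => max 0 (1 - ‖z - 1‖ / (2 * ε))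
    have hb0 : ∀ z, 0 ≤ b z := fun z => le_max_left _ _
    have hbc : Continuous b := by fun_prop
    have hb : Tendsto (fun k => ∑ j, ((b (u k j) : ℝ) : ℂ)) l (𝓝 (∑ j, ((b (u₀ j) : ℝ) : ℂ))) :=
      tendsto_sum_of_powerSum (F := fun z => (b z : ℂ)) hu hu₀ hp
        (Complex.continuous_ofReal.comp hbc).continuousOn
    have hz : ∀ j, b (u₀ j) = 0 := fun j => by
      refine max_eq_left ?_
      rw [sub_nonpos, one_le_div (by positivity)]
      exact hεu j
    simp only [hz, Complex.ofReal_zero, Finset.sum_const_zero] at hb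
    have hb' : Tendsto (fun k => ∑ j, b (u k j)) l (𝓝 0) := by
      have := (Complex.continuous_re.tendsto _).comp hb
      simpa [Function.comp_def] using this
    filter_upwards [hb'.eventually (gt_mem_nhds (show (0 : ℝ) < 1 / 2 by norm_num))] with k hk j
    have h2 : b (u k j) < 1 / 2 :=
      (Finset.single_le_sum (f := fun j => b (u k j)) (fun i _ => hb0 _)
        (Finset.mem_univ j)).trans_lt hk
    have h3 : 1 - ‖u k j - 1‖ / (2 * ε) < 1 / 2 := (le_max_right _ _).trans_lt h2
    have h4 : 1 / 2 < ‖u k j - 1‖ / (2 * ε) := by linarith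
    rw [lt_div_iff₀ (by positivity)] at h4
    linarith
  -- the sawtooth function, cut off near its discontinuity
  let F : ℂ → ℝ := fun z => sawtooth z * min 1 (‖z - 1‖ / ε)
  have hF : ContinuousOn F (Metric.sphere 0 1) := by
    intro z hz
    have hz' : ‖z‖ = 1 := by simpa using hz
    by_cases h : z = 1
    · subst h
      have h0 : F 1 = 0 := by simp [F]
      have hlim : Tendsto (fun z : ℂ => min 1 (‖z - 1‖ / ε)) (𝓝 1) (𝓝 0) := by
        have : ContinuousAt (fun z : ℂ => min 1 (‖z - 1‖ / ε)) 1 := by fun_prop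
        simpa [ContinuousAt] using this
      have : Tendsto F (𝓝 1) (𝓝 0) := by
        refine Filter.Tendsto.zero_mul_isBoundedUnder_le (f := fun z : ℂ => min 1 (‖z - 1‖ / ε))
          (g := sawtooth) hlim ⟨Real.pi, ?_⟩ |>.congr fun z => mul_comm _ _
        rw [eventually_map]
        exact .of_forall fun z => abs_sawtooth_le z
      rw [ContinuousWithinAt, h0]
      exact this.mono_left nhdsWithin_le_nhds
    · refine ContinuousAt.continuousWithinAt (ContinuousAt.mul ?_ (by fun_prop))
      refine ContinuousAt.neg (ContinuousAt.comp (g := Complex.arg) (Complex.continuousAt_arg ?_)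
        (by fun_prop))
      left
      exact re_one_sub_pos hz' h
  have hFs : ∀ z, ε ≤ ‖z - 1‖ → F z = sawtooth z := fun z hz => by
    simp only [F]
    rw [min_eq_left ((one_le_div hε).2 hz), mul_one]
  have hlim := tendsto_sum_of_powerSum (F := fun z => (F z : ℂ)) hu hu₀ hp
    (Complex.continuous_ofReal.comp_continuousOn hF)
  have hlim' : Tendsto (fun k => ∑ j, F (u k j)) l (𝓝 (∑ j, F (u₀ j))) := by
    have := (Complex.continuous_re.tendsto _).comp hlim
    simpa [Function.comp_def] using this
  rw [Finset.sum_congr rfl fun j _ => hFs (u₀ j) (by linarith [hεu j])] at hlim'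
  refine hlim'.congr' ?_
  filter_upwards [hfar] with k hk
  exact Finset.sum_congr rfl fun j _ => hFs _ (hk j)

/-- The jump of the sawtooth sum when the eigenvalues that tend to `1` do so from the upper half
of the circle: rotate by a small angle and use continuity. -/
theorem tendsto_sum_sawtooth_right (hu : ∀ k j, ‖u k j‖ = 1) (hu₀ : ∀ j, ‖u₀ j‖ = 1)
    (hp : ∀ m : ℕ, Tendsto (fun k => ∑ j, u k j ^ m) l (𝓝 (∑ j, u₀ j ^ m)))
    {ε : ℝ} (hε : 0 < ε) (h : ∀ᶠ k in l, ∀ j, ‖u k j - 1‖ < ε → 0 < (u k j).im) :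
    Tendsto (fun k => ∑ j, sawtooth (u k j)) l
      (𝓝 (∑ j, sawtooth (u₀ j) + Real.pi / 2 * (Finset.univ.filter (u₀ · = 1)).card)) := by
  obtain ⟨δ, hδ, hδε, hδu⟩ : ∃ δ : ℝ, 0 < δ ∧ δ ≤ ε ∧ ∀ j, u₀ j ≠ 1 → δ ≤ ‖u₀ j - 1‖ := by
    rcases isEmpty_or_nonempty n with hn | hn
    · exact ⟨ε, hε, le_rfl, fun j => (hn.false j).elim⟩
    · obtain ⟨j₀, hj₀⟩ := Finite.exists_min fun j => if u₀ j = 1 then ε else min ε ‖u₀ j - 1‖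
      refine ⟨if u₀ j₀ = 1 then ε else min ε ‖u₀ j₀ - 1‖, ?_, ?_, fun j hj => ?_⟩
      · split_ifs with h1
        · exact hε
        · exact lt_min hε (norm_pos_iff.2 (sub_ne_zero.2 h1))
      · split_ifs
        · exact le_rfl
        · exact min_le_left _ _
      · refine (hj₀ j).trans ?_
        rw [if_neg hj]; exact min_le_right _ _
  set β : ℝ := min (δ / 2) 1 with hβd
  have hβ : 0 < β := lt_min (by positivity) one_pos
  have hβπ : β < Real.pi := (min_le_right _ _).trans_lt (by linarith [Real.pi_gt_three])
  have hβδ : β < δ := (min_le_left _ _).trans_lt (by linarith)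
  set ω : ℂ := Complex.exp (β * Complex.I) with hω
  have hωn : ‖ω‖ = 1 := Complex.norm_exp_ofReal_mul_I β
  have hrot := tendsto_sum_sawtooth (u := fun k j => ω * u k j) (u₀ := fun j => ω * u₀ j) (l := l)
    (fun k j => by rw [norm_mul, hωn, hu, one_mul]) (fun j => by rw [norm_mul, hωn, hu₀, one_mul])
    (fun m => by
      simp only [mul_pow, ← Finset.mul_sum]
      exact (hp m).const_mul _)
    (fun j => by
      by_cases hj : u₀ j = 1
      · rw [hj, mul_one, hω]
        intro h3
        have h4 := sawtooth_exp hβ (by linarith)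
        rw [h3, sawtooth_one] at h4
        linarith
      · exact (sawtooth_rotate (hu₀ j) hβ hβπ hβδ fun h' => absurd h' (not_lt.2 (hδu j hj))).1)
  have hval : ∀ j, sawtooth (ω * u₀ j) + β / 2 =
      sawtooth (u₀ j) + Real.pi / 2 * (if u₀ j = 1 then 1 else 0) := by
    intro j
    by_cases hj : u₀ j = 1
    · rw [if_pos hj, hj, mul_one, sawtooth_one, hω, sawtooth_exp hβ (by linarith)]; ring
    · rw [if_neg hj, (sawtooth_rotate (hu₀ j) hβ hβπ hβδ
        fun h' => absurd h' (not_lt.2 (hδu j hj))).2]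
      ring
  have hsum : ∑ j, sawtooth (u₀ j) + Real.pi / 2 * (Finset.univ.filter (u₀ · = 1)).card =
      ∑ j, sawtooth (ω * u₀ j) + Fintype.card n * (β / 2) := by
    have : ∑ j, (sawtooth (ω * u₀ j) + β / 2) = ∑ j, sawtooth (ω * u₀ j) +
        Fintype.card n * (β / 2) := by
      rw [Finset.sum_add_distrib, Finset.sum_const, Finset.card_univ, nsmul_eq_mul]
    rw [← this, Finset.sum_congr rfl fun j _ => hval j, Finset.sum_add_distrib, ← Finset.mul_sum,
      Finset.sum_boole]
  rw [hsum]
  refine (hrot.add_const _).congr' ?_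
  filter_upwards [h] with k hk
  have : ∑ j : n, (β / 2) = Fintype.card n * (β / 2) := by
    rw [Finset.sum_const, Finset.card_univ, nsmul_eq_mul]
  rw [← this, ← Finset.sum_add_distrib]
  refine Finset.sum_congr rfl fun j _ => ?_
  rw [(sawtooth_rotate (hu k j) hβ hβπ hβδ fun h' => hk j (h'.trans_le hδε)).2]
  ring

/-- The jump of the sawtooth sum when the eigenvalues that tend to `1` do so from the lower half
of the circle. -/
theorem tendsto_sum_sawtooth_left (hu : ∀ k j, ‖u k j‖ = 1) (hu₀ : ∀ j, ‖u₀ j‖ = 1)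
    (hp : ∀ m : ℕ, Tendsto (fun k => ∑ j, u k j ^ m) l (𝓝 (∑ j, u₀ j ^ m)))
    {ε : ℝ} (hε : 0 < ε) (h : ∀ᶠ k in l, ∀ j, ‖u k j - 1‖ < ε → (u k j).im < 0) :
    Tendsto (fun k => ∑ j, sawtooth (u k j)) l
      (𝓝 (∑ j, sawtooth (u₀ j) - Real.pi / 2 * (Finset.univ.filter (u₀ · = 1)).card)) := by
  have hr := tendsto_sum_sawtooth_right (u := fun k j => conj (u k j)) (u₀ := fun j => conj (u₀ j))
    (l := l) (fun k j => by rw [RCLike.norm_conj, hu]) (fun j => by rw [RCLike.norm_conj, hu₀])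
    (fun m => by
      simp only [← map_pow, ← map_sum]
      exact (Complex.continuous_conj.tendsto _).comp (hp m)) hε
    (by
      filter_upwards [h] with k hk j hj
      have : ‖u k j - 1‖ < ε := by
        rw [← RCLike.norm_conj, map_sub, map_one]; exact hj
      have := hk j this
      simpa using this)
  have h1 : ∀ k, ∑ j, sawtooth (u k j) = -∑ j, sawtooth (conj (u k j)) := fun k => by
    rw [← Finset.sum_neg_distrib]
    exact Finset.sum_congr rfl fun j _ => by rw [sawtooth_conj _ (hu k j), neg_neg]
  have h2 : ∑ j, sawtooth (conj (u₀ j)) = -∑ j, sawtooth (u₀ j) := by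
    rw [← Finset.sum_neg_distrib]
    exact Finset.sum_congr rfl fun j _ => sawtooth_conj _ (hu₀ j)
  have h3 : (Finset.univ.filter fun j => conj (u₀ j) = 1) = Finset.univ.filter (u₀ · = 1) := by
    ext j
    simp only [Finset.mem_filter, Finset.mem_univ, true_and]
    exact map_eq_one_iff _ (starRingEnd ℂ).injective
  rw [h3, h2] at hr
  simp only [h1]
  convert hr.neg using 2
  ring

end

end QuantumGraph

end

noncomputable section

namespace QuantumGraph

open Filter Topology ComplexConjugate Matrix

/-! ### Motion of the eigenvalues through one -/

section
variable {n : Type*} [Fintype n] [DecidableEq n]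

/-- If a differentiable family of matrices, unitary at `k₀`, moves the eigenvalue `1` upwards at
`k₀` to first order, then the eigenvalues near `1` lie in the upper half plane on the right of `k₀`
and in the lower half plane on the left. Otherwise a limit of normalised eigenvectors would be a
fixed vector that contradicts the first order condition. -/
theorem eventually_eigenvalue_side {U : ℝ → Matrix n n ℂ} {k₀ : ℝ}
    (hd : ∀ i j, DifferentiableAt ℝ (fun k => U k i j) k₀) (hU : (U k₀)ᴴ * U k₀ = 1)
    (hpos : ∀ x, U k₀ *ᵥ x = x → x ≠ 0 → ∃ c : ℂ, 0 < c.im ∧ Tendsto (fun l : ℝ =>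
      (star x ⬝ᵥ ((U l - U k₀) *ᵥ x)) / ((l : ℂ) - k₀)) (𝓝[≠] k₀) (𝓝 c)) :
    ∃ ε : ℝ, 0 < ε ∧ ∀ᶠ k in 𝓝[≠] k₀, ∀ (z : ℂ) (x : n → ℂ), x ≠ 0 → U k *ᵥ x = z • x →
      ‖z - 1‖ < ε → 0 < (k - k₀) * z.im := by
  by_contra hcon
  push Not at hcon
  have hseq : ∀ N : ℕ, ∃ (k : ℝ) (z : ℂ) (x : n → ℂ), (dist k k₀ < 1 / ((N : ℝ) + 1) ∧ k ≠ k₀) ∧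
      ‖x‖ = 1 ∧ U k *ᵥ x = z • x ∧ ‖z - 1‖ < 1 / ((N : ℝ) + 1) ∧ (k - k₀) * z.im ≤ 0 := by
    intro N
    have hN : (0 : ℝ) < 1 / ((N : ℝ) + 1) := Nat.one_div_pos_of_nat
    have hev : ∀ᶠ k in 𝓝[≠] k₀, dist k k₀ < 1 / ((N : ℝ) + 1) ∧ k ≠ k₀ :=
      Filter.Eventually.and (nhdsWithin_le_nhds (Metric.ball_mem_nhds k₀ hN)) self_mem_nhdsWithin
    obtain ⟨k, ⟨z, x, hx, hUx, hz, him⟩, hk⟩ := ((hcon _ hN).and_eventually hev).exists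
    refine ⟨k, z, ((‖x‖ : ℂ))⁻¹ • x, hk, ?_, ?_, hz, him⟩
    · rw [norm_smul, norm_inv, Complex.norm_real, norm_norm,
        inv_mul_cancel₀ (norm_ne_zero_iff.2 hx)]
    · rw [mulVec_smul, hUx, smul_comm]
  choose k z x hk hx hUx hz him using hseq
  have hsphere : IsCompact (Metric.sphere (0 : n → ℂ) 1) := isCompact_sphere _ _
  obtain ⟨y, hy, s, hs, hxs⟩ := hsphere.tendsto_subseq (x := x) fun N => by simp [hx N]
  have hy1 : ‖y‖ = 1 := by simpa using hy
  have hy0 : y ≠ 0 := norm_ne_zero_iff.1 (by rw [hy1]; exact one_ne_zero)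
  have h0 : Tendsto (fun N : ℕ => 1 / ((s N : ℝ) + 1)) atTop (𝓝 0) :=
    (tendsto_one_div_add_atTop_nhds_zero_nat (𝕜 := ℝ)).comp hs.tendsto_atTop
  have hks : Tendsto (fun N => k (s N)) atTop (𝓝[≠] k₀) := by
    refine tendsto_nhdsWithin_iff.2 ⟨?_, .of_forall fun N => (hk _).2⟩
    rw [tendsto_iff_dist_tendsto_zero]
    exact squeeze_zero (fun _ => dist_nonneg) (fun N => (hk (s N)).1.le) h0
  have hzs : Tendsto (fun N => z (s N)) atTop (𝓝 1) := by
    rw [tendsto_iff_norm_sub_tendsto_zero]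
    exact squeeze_zero (fun _ => norm_nonneg _) (fun N => (hz (s N)).le) h0
  have hxi : ∀ i, Tendsto (fun N => x (s N) i) atTop (𝓝 (y i)) := fun i =>
    (tendsto_pi_nhds.1 hxs) i
  -- the limit vector is fixed by `U k₀`
  have hUy : U k₀ *ᵥ y = y := by
    funext i
    have h1 : Tendsto (fun N => (U (k (s N)) *ᵥ x (s N)) i) atTop (𝓝 ((U k₀ *ᵥ y) i)) := by
      simp only [mulVec, dotProduct]
      exact tendsto_finsetSum _ fun j _ =>
        ((hd i j).continuousAt.tendsto.comp (hks.mono_right nhdsWithin_le_nhds)).mul (hxi j)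
    have h2 : Tendsto (fun N => (U (k (s N)) *ᵥ x (s N)) i) atTop (𝓝 (1 * y i)) := by
      simp only [hUx, Pi.smul_apply, smul_eq_mul]
      exact hzs.mul (hxi i)
    rw [one_mul] at h2
    exact tendsto_nhds_unique h1 h2
  obtain ⟨c, hc, hlim⟩ := hpos y hUy hy0
  have hslope : ∀ i j, Tendsto (fun N => (U (k (s N)) i j - U k₀ i j) / ((k (s N) : ℂ) - k₀)) atTop
      (𝓝 (deriv (fun k => U k i j) k₀)) := by
    intro i j
    have h1 := (hasDerivAt_iff_tendsto_slope.1 (hd i j).hasDerivAt).comp hks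
    refine h1.congr fun N => ?_
    simp only [Function.comp, slope, vsub_eq_sub, Complex.real_smul]
    push_cast
    rw [div_eq_inv_mul]
  have hquad : ∀ (v : ℕ → n → ℂ), (∀ i, Tendsto (fun N => v N i) atTop (𝓝 (y i))) →
      Tendsto (fun N => (star y ⬝ᵥ ((U (k (s N)) - U k₀) *ᵥ v N)) / ((k (s N) : ℂ) - k₀)) atTop
        (𝓝 (∑ i, star y i * ∑ j, deriv (fun k => U k i j) k₀ * y j)) := by
    intro v hv
    have : ∀ N, (star y ⬝ᵥ ((U (k (s N)) - U k₀) *ᵥ v N)) / ((k (s N) : ℂ) - k₀) =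
        ∑ i, star y i * ∑ j, (U (k (s N)) i j - U k₀ i j) / ((k (s N) : ℂ) - k₀) * v N j := by
      intro N
      simp only [mulVec, dotProduct, Matrix.sub_apply, Finset.sum_div, mul_div_assoc,
        Finset.mul_sum]
      refine Finset.sum_congr rfl fun i _ => Finset.sum_congr rfl fun j _ => by ring
    simp only [this]
    exact tendsto_finsetSum _ fun i _ => tendsto_const_nhds.mul
      (tendsto_finsetSum _ fun j _ => (hslope i j).mul (hv j))
  have hceq := tendsto_nhds_unique (hlim.comp hks) (hquad (fun _ => y) fun i => tendsto_const_nhds)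
  have hmain := hquad _ hxi
  rw [← hceq] at hmain
  have hfix : star y ᵥ* U k₀ = star y := by
    conv_lhs => rw [← hUy, star_mulVec, vecMul_vecMul, hU, vecMul_one]
  -- pairing the eigenvalue equation with the fixed vector `y` isolates the motion of the eigenvalue
  have hid : ∀ N, (star y ⬝ᵥ ((U (k (s N)) - U k₀) *ᵥ x (s N))) / ((k (s N) : ℂ) - k₀) =
      (z (s N) - 1) / ((k (s N) : ℂ) - k₀) * (star y ⬝ᵥ x (s N)) := by
    intro N
    rw [sub_mulVec, dotProduct_sub, dotProduct_mulVec _ (U k₀), hfix, hUx, dotProduct_smul,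
      smul_eq_mul]
    ring
  have hyy : Tendsto (fun N => star y ⬝ᵥ x (s N)) atTop (𝓝 (star y ⬝ᵥ y)) := by
    simp only [dotProduct]
    exact tendsto_finsetSum _ fun i _ => tendsto_const_nhds.mul (hxi i)
  obtain ⟨r, hr, hr0⟩ : ∃ r : ℝ, star y ⬝ᵥ y = (r : ℂ) ∧ 0 < r := by
    have h1 : star y ⬝ᵥ y = ((∑ i, Complex.normSq (y i) : ℝ) : ℂ) := by
      simp only [dotProduct, Pi.star_apply, Complex.star_def]
      push_cast
      exact Finset.sum_congr rfl fun i _ => (Complex.normSq_eq_conj_mul_self).symm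
    refine ⟨_, h1, lt_of_le_of_ne (Finset.sum_nonneg fun i _ => Complex.normSq_nonneg _)
      fun h => ?_⟩
    exact star_dotProduct_self_ne_zero hy0 (by rw [h1, ← h, Complex.ofReal_zero])
  simp only [hid] at hmain
  rw [hr] at hyy
  have hr0' : (r : ℂ) ≠ 0 := by exact_mod_cast hr0.ne'
  have hquot := hmain.div hyy hr0'
  have hquot' : Tendsto (fun N => (z (s N) - 1) / ((k (s N) : ℂ) - k₀)) atTop (𝓝 (c / r)) := by
    refine hquot.congr' ?_
    filter_upwards [hyy.eventually_ne hr0'] with N hN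
    rw [Pi.div_apply, mul_div_assoc, div_self hN, mul_one]
  have him' : Tendsto (fun N => ((z (s N) - 1) / ((k (s N) : ℂ) - k₀)).im) atTop
      (𝓝 (c / r).im) := (Complex.continuous_im.tendsto _).comp hquot'
  -- but the eigenvalues in the sequence move to the wrong side
  have hle : (c / r).im ≤ 0 := by
    refine le_of_tendsto him' (.of_forall fun N => ?_)
    have h1 : ((k (s N) : ℂ) - k₀) = ((k (s N) - k₀ : ℝ) : ℂ) := by push_cast; rfl
    rw [h1, Complex.div_ofReal_im, Complex.sub_im, Complex.one_im, sub_zero]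
    have h2 := him (s N)
    rcases lt_or_gt_of_ne (hk (s N)).2 with h | h
    · exact div_nonpos_of_nonneg_of_nonpos (by nlinarith) (by linarith)
    · exact div_nonpos_of_nonpos_of_nonneg (by nlinarith) (by linarith)
  rw [Complex.div_ofReal_im] at hle
  exact absurd hle (not_le.2 (div_pos hc hr0))

end

section
variable {V D : Type*} (G : MetricGraph V D) (W : Potential G) [Fintype D] [DecidableEq V]
  [DecidableEq D]

theorem isTame_evol (d d' : D) : IsTame fun k => evol G W k d d' := by
  simp only [evol, mul_apply]
  exact IsTame.sum fun e _ => (isTame_transitionMatrix G W e d').const_mul _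

theorem continuousAt_evol {k : ℝ} (hk : 0 < k) : ContinuousAt (evol G W) k :=
  continuousAt_pi.2 fun d => continuousAt_pi.2 fun d' =>
    ((isTame_evol G W d d').diff k hk).continuousAt

end

section
variable {V D : Type*} (G : MetricGraph V D) (W : Potential G) [Fintype V] [Fintype D]
  [DecidableEq V] [DecidableEq D]

/-- The eigenvalues of the evolution matrix, with multiplicity and in no particular order (all `1`
for nonpositive wave numbers, where the matrix need not be unitary). -/
def eig (k : ℝ) : D → ℂ :=
  if hk : 0 < k then (exists_eigenvalues (evol_unitary G W hk)).choose else 1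

theorem eig_spec {k : ℝ} (hk : 0 < k) :
    (∀ j, ∃ x, x ≠ 0 ∧ evol G W k *ᵥ x = eig G W k j • x) ∧
      (∀ m : ℕ, (evol G W k ^ m).trace = ∑ j, eig G W k j ^ m) ∧
      (evol G W k).det = ∏ j, eig G W k j ∧
      multiplicity G W k = (Finset.univ.filter (eig G W k · = 1)).card := by
  rw [eig, dif_pos hk, multiplicity_eq G W hk]
  exact (exists_eigenvalues (evol_unitary G W hk)).choose_spec.2

theorem norm_eig (k : ℝ) (j : D) : ‖eig G W k j‖ = 1 := by
  by_cases hk : 0 < k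
  · rw [eig, dif_pos hk]
    exact (exists_eigenvalues (evol_unitary G W hk)).choose_spec.1 j
  · simp [eig, hk]

/-- The sum of the sawtooth function over the eigenvalues of the evolution matrix. -/
def sawSum (k : ℝ) : ℝ := ∑ j, sawtooth (eig G W k j)

theorem tendsto_sum_eig_pow {k : ℝ} (hk : 0 < k) (m : ℕ) :
    Tendsto (fun l => ∑ j, eig G W l j ^ m) (𝓝 k) (𝓝 (∑ j, eig G W k j ^ m)) := by
  have h : ContinuousAt (fun l => (evol G W l ^ m).trace) k :=
    ContinuousAt.comp (f := fun l => evol G W l ^ m)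
      (continuous_id.matrix_trace.continuousAt (x := evol G W k ^ m))
      ((continuousAt_evol G W hk).pow m)
  rw [← (eig_spec G W hk).2.1 m]
  refine h.tendsto.congr' ?_
  filter_upwards [Ioi_mem_nhds hk] with l hl
  exact (eig_spec G W hl).2.1 m

theorem eventually_eig_side {k : ℝ} (hk : 0 < k) :
    ∃ ε : ℝ, 0 < ε ∧ ∀ᶠ l in 𝓝[≠] k, ∀ j, ‖eig G W l j - 1‖ < ε →
      0 < (l - k) * (eig G W l j).im := by
  obtain ⟨ε, hε, h⟩ := eventually_eigenvalue_side (U := evol G W)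
    (fun i j => (isTame_evol G W i j).diff k hk) (evol_unitary G W hk)
    fun x hx hx0 => evol_deriv_pos G W hk hx hx0
  refine ⟨ε, hε, ?_⟩
  filter_upwards [h, nhdsWithin_le_nhds (Ioi_mem_nhds hk)] with l hl hl0 j hj
  obtain ⟨x, hx, hUx⟩ := (eig_spec G W hl0).1 j
  exact hl _ x hx hUx hj

/-- The spectrum is discrete in the positive half line. -/
theorem eventually_multiplicity_eq_zero {k : ℝ} (hk : 0 < k) :
    ∀ᶠ l in 𝓝[≠] k, multiplicity G W l = 0 := by
  obtain ⟨ε, hε, h⟩ := eventually_eig_side G W hk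
  filter_upwards [h, nhdsWithin_le_nhds (Ioi_mem_nhds hk)] with l hl hl0
  rw [(eig_spec G W hl0).2.2.2, Finset.card_eq_zero, Finset.filter_eq_empty_iff]
  intro j _ hj
  have := hl j (by rw [hj]; simpa using hε)
  rw [hj] at this
  simp at this

variable {G W}

/-- Off the spectrum `exp (2 i Q)` is the product of the `-conj u_j`, that is, up to a constant the
inverse of `det T = exp (i Θ)`. -/
theorem exp_two_sawSum_add_phase {Θ : ℝ → ℝ} (hΘ : IsPhase G W Θ) {k : ℝ} (hk : 0 < k)
    (hm : multiplicity G W k = 0) :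
    Complex.exp (Complex.I * (2 * sawSum G W k + Θ k : ℝ)) =
      (-1) ^ Fintype.card D * conj (vertexMatrix G).det := by
  rw [(eig_spec G W hk).2.2.2, Finset.card_eq_zero, Finset.filter_eq_empty_iff] at hm
  have h1 : Complex.exp (Complex.I * (2 * sawSum G W k : ℝ)) =
      (-1) ^ Fintype.card D * conj (evol G W k).det := by
    rw [(eig_spec G W hk).2.2.1, sawSum, Finset.mul_sum, Complex.ofReal_sum, Finset.mul_sum,
      Complex.exp_sum, map_prod, Finset.prod_congr rfl fun j _ => exp_sawtooth (norm_eig G W k j)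
        (hm (Finset.mem_univ j)), Finset.prod_neg, Finset.card_univ]
  have h2 : Complex.exp (Complex.I * (Θ k : ℝ)) * conj (Complex.exp (Complex.I * (Θ k : ℝ))) =
      1 := by
    rw [Complex.mul_conj, Complex.normSq_eq_norm_sq, Complex.norm_exp_I_mul_ofReal]; norm_num
  rw [Complex.ofReal_add, mul_add, Complex.exp_add, h1, evol, det_mul, (hΘ k hk).2, map_mul]
  linear_combination (-1) ^ Fintype.card D * conj (vertexMatrix G).det * h2

/-- If `f` converges and `exp (i f)` is eventually constant, then `f` is eventually equal to its
limit. -/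
theorem eventually_eq_of_tendsto_of_exp {l : Filter ℝ} [l.NeBot] {f : ℝ → ℝ} {L : ℝ} {c : ℂ}
    (hf : Tendsto f l (𝓝 L)) (hc : ∀ᶠ k in l, Complex.exp (Complex.I * (f k : ℝ)) = c) :
    ∀ᶠ k in l, f k = L := by
  have hcL : Complex.exp (Complex.I * (L : ℝ)) = c := by
    have h1 : Tendsto (fun k => Complex.exp (Complex.I * (f k : ℝ))) l
        (𝓝 (Complex.exp (Complex.I * (L : ℝ)))) :=
      ((by fun_prop : Continuous fun x : ℝ => Complex.exp (Complex.I * (x : ℂ))).tendsto L).comp hf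
    exact tendsto_nhds_unique (h1.congr' hc) tendsto_const_nhds
  filter_upwards [hc, Metric.tendsto_nhds.1 hf 1 one_pos] with k hk hd
  have h1 : Complex.exp (((f k - L : ℝ) : ℂ) * Complex.I) = 1 := by
    push_cast
    rw [sub_mul, Complex.exp_sub, mul_comm, hk, mul_comm, hcL, div_self]
    rw [← hcL]; exact Complex.exp_ne_zero _
  obtain ⟨a, ha⟩ := Complex.exp_eq_one_iff.1 h1
  have h2 : f k - L = a * (2 * Real.pi) := by
    have h3 := congrArg Complex.im ha
    simpa using h3
  rw [Real.dist_eq, h2, abs_mul, abs_of_pos Real.two_pi_pos] at hd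
  have ha0 : a = 0 := by
    by_contra h
    have h3 : (1 : ℝ) ≤ |(a : ℝ)| := by exact_mod_cast Int.one_le_abs h
    nlinarith [Real.pi_gt_three]
  rw [ha0, Int.cast_zero, zero_mul] at h2
  linarith

/-- Twice the sawtooth sum plus the phase of `det T` is locally constant off the spectrum; it jumps
by `π` times the multiplicity on each side of an eigenvalue. -/
theorem eventually_right {Θ : ℝ → ℝ} (hΘ : IsPhase G W Θ) {k : ℝ} (hk : 0 < k) :
    ∀ᶠ l in 𝓝[>] k, multiplicity G W l = 0 ∧ 2 * sawSum G W l + Θ l =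
      2 * sawSum G W k + Θ k + Real.pi * multiplicity G W k := by
  have hm : ∀ᶠ l in 𝓝[>] k, multiplicity G W l = 0 :=
    nhdsWithin_mono k (fun x hx => (ne_of_gt hx)) (eventually_multiplicity_eq_zero G W hk)
  refine hm.and (eventually_eq_of_tendsto_of_exp
    (c := (-1) ^ Fintype.card D * conj (vertexMatrix G).det) ?_ ?_)
  · obtain ⟨ε, hε, h⟩ := eventually_eig_side G W hk
    have h' : ∀ᶠ l in 𝓝[>] k, ∀ j, ‖eig G W l j - 1‖ < ε → 0 < (eig G W l j).im := by
      filter_upwards [nhdsWithin_mono k (fun x hx => (ne_of_gt hx)) h, self_mem_nhdsWithin]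
        with l hl hkl j hj
      exact (pos_iff_pos_of_mul_pos (hl j hj)).1 (sub_pos.2 hkl)
    have hs := tendsto_sum_sawtooth_right (norm_eig G W) (norm_eig G W k)
      (fun m => (tendsto_sum_eig_pow G W hk m).mono_left nhdsWithin_le_nhds) hε h'
    have hc := ((hΘ k hk).1.continuousAt.tendsto.mono_left
      (nhdsWithin_le_nhds (s := Set.Ioi k)))
    rw [← (eig_spec G W hk).2.2.2] at hs
    convert (hs.const_mul 2).add hc using 2 <;> simp only [sawSum]
    ring
  · filter_upwards [hm, nhdsWithin_le_nhds (Ioi_mem_nhds hk)] with l hl hl0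
    exact exp_two_sawSum_add_phase hΘ hl0 hl

theorem eventually_left {Θ : ℝ → ℝ} (hΘ : IsPhase G W Θ) {k : ℝ} (hk : 0 < k) :
    ∀ᶠ l in 𝓝[<] k, multiplicity G W l = 0 ∧ 2 * sawSum G W l + Θ l =
      2 * sawSum G W k + Θ k - Real.pi * multiplicity G W k := by
  have hm : ∀ᶠ l in 𝓝[<] k, multiplicity G W l = 0 :=
    nhdsWithin_mono k (fun x hx => (ne_of_lt hx)) (eventually_multiplicity_eq_zero G W hk)
  refine hm.and (eventually_eq_of_tendsto_of_exp
    (c := (-1) ^ Fintype.card D * conj (vertexMatrix G).det) ?_ ?_)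
  · obtain ⟨ε, hε, h⟩ := eventually_eig_side G W hk
    have h' : ∀ᶠ l in 𝓝[<] k, ∀ j, ‖eig G W l j - 1‖ < ε → (eig G W l j).im < 0 := by
      filter_upwards [nhdsWithin_mono k (fun x hx => (ne_of_lt hx)) h, self_mem_nhdsWithin]
        with l hl hkl j hj
      exact (neg_iff_neg_of_mul_pos (hl j hj)).1 (sub_neg.2 hkl)
    have hs := tendsto_sum_sawtooth_left (norm_eig G W) (norm_eig G W k)
      (fun m => (tendsto_sum_eig_pow G W hk m).mono_left nhdsWithin_le_nhds) hε h'
    have hc := ((hΘ k hk).1.continuousAt.tendsto.mono_left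
      (nhdsWithin_le_nhds (s := Set.Iio k)))
    rw [← (eig_spec G W hk).2.2.2] at hs
    convert (hs.const_mul 2).add hc using 2 <;> simp only [sawSum]
    ring
  · filter_upwards [hm, nhdsWithin_le_nhds (Ioi_mem_nhds hk)] with l hl hl0
    exact exp_two_sawSum_add_phase hΘ hl0 hl

end

end QuantumGraph

end

noncomputable section

namespace QuantumGraph

open Filter Topology ComplexConjugate Matrix

/-! ### The phase of the determinant of the transition matrix -/

section
variable {V D : Type*} (G : MetricGraph V D) (W : Potential G) [Fintype D] [DecidableEq D]

theorem isTame_det : IsTame fun k : ℝ => (transitionMatrix G W (k : ℂ)).det := by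
  simp only [det_apply']
  exact IsTame.sum fun σ _ => (IsTame.prod fun d _ => isTame_transitionMatrix G W _ _).const_mul _

theorem norm_det_transitionMatrix {k : ℝ} (hk : 0 < k) :
    ‖(transitionMatrix G W (k : ℂ)).det‖ = 1 := by
  have h := congrArg det (transitionMatrix_unitary G W hk)
  rw [det_mul, det_conjTranspose, det_one] at h
  have h1 := congrArg norm h
  rw [norm_mul, norm_star, norm_one] at h1
  nlinarith [norm_nonneg (transitionMatrix G W (k : ℂ)).det]

/-- The phase is found by integrating the logarithmic derivative of the determinant. -/
theorem exists_isPhase : ∃ Θ : ℝ → ℝ, IsPhase G W Θ := by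
  set g : ℝ → ℂ := fun k => (transitionMatrix G W (k : ℂ)).det with hg
  have hgt : IsTame g := isTame_det G W
  have hn : ∀ k, 0 < k → ‖g k‖ = 1 := fun k hk => norm_det_transitionMatrix G W hk
  have h0 : ∀ k, 0 < k → g k ≠ 0 := fun k hk =>
    norm_ne_zero_iff.1 (by rw [hn k hk]; exact one_ne_zero)
  have hq : ContinuousOn (fun k => deriv g k / g k) (Set.Ioi 0) :=
    hgt.cont.div (fun k hk => (hgt.diff k hk).continuousAt.continuousWithinAt) h0
  set F : ℝ → ℂ := fun k => Complex.log (g 1) + ∫ t in (1 : ℝ)..k, deriv g t / g t with hF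
  have hFd : ∀ k, 0 < k → HasDerivAt F (deriv g k / g k) k := by
    intro k hk
    refine HasDerivAt.const_add _ (intervalIntegral.integral_hasDerivAt_right ?_
      (hq.stronglyMeasurableAtFilter isOpen_Ioi k hk) (hq.continuousAt (Ioi_mem_nhds hk)))
    refine (hq.mono fun x hx => ?_).intervalIntegrable
    rw [Set.mem_uIcc] at hx
    rcases hx with hx | hx
    · exact one_pos.trans_le hx.1
    · exact hk.trans_le hx.1
  have hconst : ∀ k, 0 < k → g k * Complex.exp (-F k) = 1 := by
    intro k hk
    have hd : ∀ x, 0 < x → HasDerivAt (fun k => g k * Complex.exp (-F k)) 0 x := by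
      intro x hx
      refine ((hgt.diff x hx).hasDerivAt.mul ((hFd x hx).neg.cexp)).congr_deriv ?_
      have := h0 x hx
      simp only [Pi.neg_apply]
      field_simp
      ring
    have h1 := isOpen_Ioi.is_const_of_deriv_eq_zero (isPreconnected_Ioi (a := (0 : ℝ)))
      (fun x hx => (hd x hx).differentiableAt.differentiableWithinAt)
      (fun x hx => (hd x hx).deriv) (Set.mem_Ioi.2 hk) (Set.mem_Ioi.2 one_pos)
    rw [h1]
    simp only [hF, intervalIntegral.integral_same, add_zero, Complex.exp_neg]
    rw [Complex.exp_log (h0 1 one_pos), mul_inv_cancel₀ (h0 1 one_pos)]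
  have hexp : ∀ k, 0 < k → g k = Complex.exp (F k) := fun k hk => by
    have h1 := hconst k hk
    rw [Complex.exp_neg] at h1
    exact (mul_inv_eq_one₀ (Complex.exp_ne_zero _)).1 h1
  refine ⟨fun k => (F k).im, fun k hk => ⟨?_, ?_⟩⟩
  · exact ((Complex.imCLM.hasFDerivAt).comp_hasDerivAt k (hFd k hk)).differentiableAt
  · have h1 := hn k hk
    rw [hexp k hk, Complex.norm_exp, Real.exp_eq_one_iff] at h1
    refine (hexp k hk).trans (congrArg Complex.exp ?_)
    apply Complex.ext <;> simp [h1]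

variable {G W}

theorem norm_deriv_phase {Θ : ℝ → ℝ} (hΘ : IsPhase G W Θ) {k : ℝ} (hk : 0 < k) :
    ‖deriv Θ k‖ = ‖deriv (fun k : ℝ => (transitionMatrix G W (k : ℂ)).det) k‖ := by
  have h : (fun k : ℝ => (transitionMatrix G W (k : ℂ)).det) =ᶠ[𝓝 k]
      fun k => Complex.exp (Complex.I * (Θ k : ℂ)) := by
    filter_upwards [Ioi_mem_nhds hk] with l hl
    exact (hΘ l hl).2
  rw [h.deriv_eq, (((hΘ k hk).1.hasDerivAt.ofReal_comp).const_mul Complex.I).cexp.deriv]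
  rw [norm_mul, Complex.norm_exp_I_mul_ofReal, one_mul, norm_mul, Complex.norm_I, one_mul,
    Complex.norm_real]

theorem exists_deriv_phase_bound {Θ : ℝ → ℝ} (hΘ : IsPhase G W Θ) {K : ℝ} (hK : 0 < K) :
    ∃ C, 0 ≤ C ∧ ∀ k, K ≤ k → |deriv Θ k| ≤ C := by
  obtain ⟨C, hC, h⟩ := (isTame_det G W).bdd K hK
  refine ⟨C, hC, fun k hk => ?_⟩
  rw [← Real.norm_eq_abs, norm_deriv_phase hΘ (hK.trans_le hk)]
  exact (h k hk).2

end

end QuantumGraph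

end

noncomputable section

namespace QuantumGraph

/-! ### Repetitions of words -/

section
variable {E : Type*}

/-- A word `B` that commutes with `A`, and whose length is a multiple of that of `A`, is a power
of `A`. -/
theorem eq_flatten_replicate_of_append_comm {A : List E} (s : ℕ) :
    ∀ B : List E, B.length = s * A.length → B ++ A = A ++ B → B = (List.replicate s A).flatten := by
  induction s with
  | zero =>
    intro B hB _
    rw [zero_mul, List.length_eq_zero_iff] at hB
    simp [hB]
  | succ s ih =>
    intro B hB hc
    have hle : A.length ≤ B.length := by rw [hB, Nat.succ_mul]; exact Nat.le_add_left _ _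
    obtain ⟨C, rfl⟩ : A <+: B :=
      List.prefix_of_prefix_length_le (hc ▸ List.prefix_append A B) (List.prefix_append B A) hle
    rw [List.append_assoc, List.append_cancel_left_eq] at hc
    rw [List.length_append, Nat.succ_mul, add_comm, Nat.add_right_cancel_iff] at hB
    rw [List.replicate_succ, List.flatten_cons, ← ih C hB hc]

theorem eq_flatten_replicate_of_rotate {l : List E} {d r : ℕ} (hl : l.length = r * d)
    (h : l.rotate d = l) : l = (List.replicate r (l.take d)).flatten := by
  cases r with
  | zero =>
    rw [zero_mul, List.length_eq_zero_iff] at hl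
    simp [hl]
  | succ r =>
    have hd : d ≤ l.length := by rw [hl, Nat.succ_mul]; exact Nat.le_add_left _ _
    have hA : (l.take d).length = d := by rw [List.length_take, min_eq_left hd]
    rw [List.rotate_eq_drop_append_take hd] at h
    have hB : l.drop d = (List.replicate r (l.take d)).flatten := by
      refine eq_flatten_replicate_of_append_comm r _ ?_ ?_
      · rw [List.length_drop, hl, hA, Nat.succ_mul, Nat.add_sub_cancel]
      · rw [h, List.take_append_drop]
    rw [List.replicate_succ, List.flatten_cons, ← hB, List.take_append_drop]

theorem rotate_flatten_replicate (l : List E) (r : ℕ) :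
    ((List.replicate r l).flatten).rotate l.length = (List.replicate r l).flatten := by
  cases r with
  | zero => simp
  | succ r =>
    rw [List.replicate_succ, List.flatten_cons, List.rotate_append_length_eq]
    have : List.replicate r l ++ [l] = l :: List.replicate r l := by
      rw [← List.replicate_succ', List.replicate_succ]
    rw [← List.flatten_cons, ← this, List.flatten_append]
    simp

theorem iterate_rotate_one (l : List E) (i : ℕ) :
    (fun l : List E => l.rotate 1)^[i] l = l.rotate i := by
  induction i with
  | zero => simp
  | succ i ih => rw [Function.iterate_succ_apply', ih, List.rotate_rotate]

/-- The primitive length of a nonempty cyclic word is the period of the rotation. -/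
theorem primLength_eq_minimalPeriod {l : List E} (hl : l ≠ []) :
    sInf {m | ∃ (l' : List E) (r : ℕ), l'.length = m ∧
      (l : Cycle E) = (((List.replicate r l').flatten : List E) : Cycle E)} =
    Function.minimalPeriod (fun l : List E => l.rotate 1) l := by
  set d := Function.minimalPeriod (fun l : List E => l.rotate 1) l with hd
  refine IsLeast.csInf_eq ⟨?_, ?_⟩
  · have hrot : l.rotate d = l := by
      rw [← iterate_rotate_one]
      exact Function.isPeriodicPt_minimalPeriod _ _
    obtain ⟨r, hr⟩ : d ∣ l.length := by
      refine Function.IsPeriodicPt.minimalPeriod_dvd ?_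
      rw [Function.IsPeriodicPt, Function.IsFixedPt, iterate_rotate_one, List.rotate_length]
    refine ⟨l.take d, r, ?_, ?_⟩
    · have hr0 : r ≠ 0 := by
        rintro rfl
        exact hl (List.length_eq_zero_iff.1 (by simpa using hr))
      rw [List.length_take, min_eq_left]
      rw [hr]; exact Nat.le_mul_of_pos_right _ (Nat.pos_of_ne_zero hr0)
    · rw [← eq_flatten_replicate_of_rotate (by rw [hr, mul_comm]) hrot]
  · rintro m ⟨l', r, rfl, h⟩
    obtain ⟨j, hj⟩ := (Cycle.coe_eq_coe.1 h).symm
    have hpos : 0 < l'.length := by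
      rw [List.length_pos_iff]
      rintro rfl
      refine hl ?_
      rw [← hj]
      simp
    refine Function.IsPeriodicPt.minimalPeriod_le hpos ?_
    rw [Function.IsPeriodicPt, Function.IsFixedPt, iterate_rotate_one, ← hj, List.rotate_rotate,
      add_comm, ← List.rotate_rotate, rotate_flatten_replicate]

end

/-! ### Traces of powers as sums over closed words -/

section
variable {E : Type*}

/-- The product of `τ` along the word `a, t, b`. -/
def pathProd (τ : E → E → ℂ) : E → List E → E → ℂ
  | a, [], b => τ b a
  | a, c :: t, b => τ c a * pathProd τ c t b

theorem listProd_cons (τ : E → E → ℂ) (a : E) (t : List E) :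
    listProd τ (a :: t) = pathProd τ a t a := by
  have h : ∀ (t : List E) (a b : E),
      (List.zipWith (fun a b => τ b a) (a :: t) (t ++ [b])).prod = pathProd τ a t b := by
    intro t
    induction t with
    | nil => intro a b; simp [pathProd]
    | cons c t ih => intro a b; simp [pathProd, ← ih c b]
  rw [listProd, List.rotate_cons_succ, List.rotate_zero, h]

theorem isChain_of_pathProd_ne_zero {τ : E → E → ℂ} {R : E → E → Prop}
    (h : ∀ a b, τ b a ≠ 0 → R a b) (t : List E) :
    ∀ a b, pathProd τ a t b ≠ 0 → (a :: (t ++ [b])).IsChain R := by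
  induction t with
  | nil =>
    intro a b hab
    simpa using h a b hab
  | cons c t ih =>
    intro a b hab
    rw [pathProd] at hab
    rw [List.cons_append, List.isChain_cons_cons]
    exact ⟨h _ _ (left_ne_zero_of_mul hab), ih c b (right_ne_zero_of_mul hab)⟩

/-- A cyclic word has as many linear representatives as its primitive length. -/
theorem card_filter_words {l : List E} (hl : l ≠ []) [DecidableEq E] {s : Finset (List E)}
    (hs : ∀ l' : List E, (l' : Cycle E) = l → l' ∈ s)
    [DecidablePred fun l' : List E => (l' : Cycle E) = l] :
    (s.filter fun l' : List E => (l' : Cycle E) = (l : Cycle E)).card =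
      Function.minimalPeriod (fun l : List E => l.rotate 1) l := by
  set d := Function.minimalPeriod (fun l : List E => l.rotate 1) l with hd
  have h : (s.filter fun l' : List E => (l' : Cycle E) = (l : Cycle E)) =
      (Finset.range d).image fun i => (fun l : List E => l.rotate 1)^[i] l := by
    ext l'
    simp only [Finset.mem_filter, Finset.mem_image, Finset.mem_range]
    constructor
    · rintro ⟨_, h⟩
      obtain ⟨j, rfl⟩ := (Cycle.coe_eq_coe.1 h).symm
      refine ⟨j % d, Nat.mod_lt _ ?_, ?_⟩
      · refine Function.IsPeriodicPt.minimalPeriod_pos (List.length_pos_iff.2 hl) ?_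
        rw [Function.IsPeriodicPt, Function.IsFixedPt, iterate_rotate_one, List.rotate_length]
      · rw [Function.iterate_mod_minimalPeriod_eq, iterate_rotate_one]
    · rintro ⟨i, _, rfl⟩
      have h1 : (((fun l : List E => l.rotate 1)^[i] l : List E) : Cycle E) = l := by
        rw [iterate_rotate_one, Cycle.coe_eq_coe]
        exact List.IsRotated.symm ⟨i, rfl⟩
      exact ⟨hs _ h1, h1⟩
  rw [h, Finset.card_image_of_injOn, Finset.card_range]
  intro i hi j hj hij
  exact Function.iterate_injOn_Iio_minimalPeriod (by simpa using hi) (by simpa using hj) hij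

end

section
variable {E : Type*} [Fintype E] [DecidableEq E]

/-- The words of length `n`. -/
def words (E : Type*) [Fintype E] [DecidableEq E] : ℕ → Finset (List E)
  | 0 => {[]}
  | n + 1 => (Finset.univ ×ˢ words E n).image fun x => x.1 :: x.2

theorem mem_words {n : ℕ} {l : List E} : l ∈ words E n ↔ l.length = n := by
  induction n generalizing l with
  | zero => simp [words]
  | succ n ih =>
    cases l with
    | nil => simp [words]
    | cons a t => simp [words, ih]

theorem sum_words_succ (n : ℕ) (f : List E → ℂ) :
    ∑ l ∈ words E (n + 1), f l = ∑ a, ∑ t ∈ words E n, f (a :: t) := by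
  rw [words, Finset.sum_image, Finset.sum_product]
  rintro ⟨a, t⟩ _ ⟨b, s⟩ _ h
  simpa using h

theorem pow_succ_apply (τ : E → E → ℂ) (n : ℕ) (a b : E) :
    (Matrix.of τ ^ (n + 1)) b a = ∑ t ∈ words E n, pathProd τ a t b := by
  induction n generalizing a with
  | zero => simp [words, pathProd]
  | succ n ih =>
    rw [pow_succ, Matrix.mul_apply, sum_words_succ]
    refine Finset.sum_congr rfl fun c _ => ?_
    rw [ih, Finset.sum_mul]
    exact Finset.sum_congr rfl fun t _ => mul_comm _ _

theorem trace_pow_succ (τ : E → E → ℂ) (n : ℕ) :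
    (Matrix.of τ ^ (n + 1)).trace = ∑ l ∈ words E (n + 1), listProd τ l := by
  rw [sum_words_succ, Matrix.trace]
  refine Finset.sum_congr rfl fun a _ => ?_
  simp only [Matrix.diag_apply, pow_succ_apply, listProd_cons]

variable {V : Type*} (H : DGraph V E)

open scoped Classical in
/-- The weighted sum over periodic orbits is a sum of traces of powers: each orbit `p` is
represented by as many closed words as its primitive length, and words that are not walks do not
contribute. -/
theorem sum_upTo (τ : E → E → ℂ) (hτ : ∀ a b, τ b a ≠ 0 → H.term a = H.init b) (N : ℕ) :
    ∑ p ∈ DGraph.PeriodicOrbit.upTo H N, (p.primLength : ℂ) / (p.length : ℂ) * cycleProd τ p.1 =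
      ∑ n ∈ Finset.range (N + 1), (Matrix.of τ ^ n).trace / n := by
  set S : Finset (List E) := (Finset.range N).biUnion fun n => words E (n + 1) with hS
  have hmem : ∀ l, l ∈ S ↔ l ≠ [] ∧ l.length ≤ N := by
    intro l
    simp only [hS, Finset.mem_biUnion, Finset.mem_range, mem_words]
    rw [← List.length_pos_iff]
    constructor
    · rintro ⟨n, hn, h⟩; omega
    · rintro ⟨h1, h2⟩; exact ⟨l.length - 1, by omega, by omega⟩
  let e : H.PeriodicOrbit ↪ Cycle E := ⟨fun p => p.1, Subtype.val_injective⟩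
  set T : Finset (Cycle E) := (DGraph.PeriodicOrbit.upTo H N).map e with hT
  have hup : ∀ p : H.PeriodicOrbit, p ∈ DGraph.PeriodicOrbit.upTo H N ↔ p.length ≤ N := fun p =>
    Set.Finite.mem_toFinset _
  have hTmem : ∀ l : List E, (l : Cycle E) ∈ T ↔
      l ∈ S ∧ (l : Cycle E).Chain fun a b => H.term a = H.init b := by
    intro l
    rw [hmem, hT, Finset.mem_map]
    constructor
    · rintro ⟨⟨c, hc, hc'⟩, hp, rfl⟩
      refine ⟨⟨fun h => hc ?_, (hup _).1 hp⟩, hc'⟩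
      rw [h]; rfl
    · rintro ⟨⟨h1, h2⟩, h3⟩
      refine ⟨⟨(l : Cycle E), fun h => h1 ?_, h3⟩, (hup _).2 h2, rfl⟩
      exact (Cycle.coe_eq_nil l).1 h
  -- a closed word that is not a walk contains a transition with `τ = 0`
  have hzero : ∀ l ∈ S, (l : Cycle E) ∉ T → listProd τ l = 0 := by
    intro l hl hlT
    by_contra hne
    refine hlT ((hTmem l).2 ⟨hl, ?_⟩)
    cases l with
    | nil => exact absurd rfl ((hmem _).1 hl).1
    | cons a t =>
      rw [listProd_cons] at hne
      rw [Cycle.chain_coe_cons]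
      exact isChain_of_pathProd_ne_zero hτ t a a hne
  have hdisj : (↑(Finset.range N) : Set ℕ).PairwiseDisjoint fun n => words E (n + 1) := by
    intro i _ j _ hij
    refine Finset.disjoint_left.2 fun l hi hj => hij ?_
    rw [mem_words] at hi hj
    omega
  have hright : ∑ n ∈ Finset.range (N + 1), (Matrix.of τ ^ n).trace / n =
      ∑ l ∈ S, listProd τ l / (l.length : ℂ) := by
    -- the term with exponent zero is a division by zero
    rw [Finset.sum_range_succ', Nat.cast_zero, div_zero, add_zero, hS, Finset.sum_biUnion hdisj]
    refine Finset.sum_congr rfl fun n _ => ?_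
    rw [trace_pow_succ, Finset.sum_div]
    exact Finset.sum_congr rfl fun l hl => by rw [mem_words.1 hl]
  have hleft : ∑ p ∈ DGraph.PeriodicOrbit.upTo H N,
      (p.primLength : ℂ) / (p.length : ℂ) * cycleProd τ p.1 =
      ∑ c ∈ T, ∑ l ∈ S.filter (fun l : List E => (l : Cycle E) = c),
        listProd τ l / (l.length : ℂ) := by
    rw [hT, Finset.sum_map]
    refine Finset.sum_congr rfl fun p hp => ?_
    change _ = ∑ l ∈ S.filter (fun l : List E => (l : Cycle E) = p.1), _
    obtain ⟨⟨c, hc, hc'⟩, rfl⟩ : ∃ q, q = p := ⟨p, rfl⟩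
    induction c using Quotient.inductionOn' with
    | h l =>
      have hl : l ≠ [] := fun h => hc (by rw [h]; rfl)
      have hlT : (l : Cycle E) ∈ T := by
        rw [hT]; exact Finset.mem_map.2 ⟨_, hp, rfl⟩
      have hrep : ∀ l' : List E, (l' : Cycle E) = l → l' ∈ S := fun l' h =>
        ((hTmem l').1 (h ▸ hlT)).1
      have hterm : ∀ l' ∈ S.filter fun l' : List E => (l' : Cycle E) = (l : Cycle E),
          listProd τ l' / (l'.length : ℂ) = listProd τ l / (l.length : ℂ) := by
        intro l' h
        have h1 : l' ~r l := Cycle.coe_eq_coe.1 (Finset.mem_filter.1 h).2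
        rw [listProd_isRotated τ h1, h1.perm.length_eq]
      have hp1 : DGraph.PeriodicOrbit.primLength (G := H) ⟨Quotient.mk'' l, hc, hc'⟩ =
          Function.minimalPeriod (fun l : List E => l.rotate 1) l := primLength_eq_minimalPeriod hl
      refine Eq.trans ?_ (Finset.sum_congr rfl hterm).symm
      rw [Finset.sum_const, card_filter_words hl hrep, nsmul_eq_mul, hp1, div_mul_eq_mul_div,
        mul_div_assoc]
      rfl
  have hsub : ∑ l ∈ S, listProd τ l / (l.length : ℂ) =
      ∑ l ∈ S.filter (fun l : List E => (l : Cycle E) ∈ T), listProd τ l / (l.length : ℂ) := by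
    symm
    refine Finset.sum_subset (Finset.filter_subset _ _) fun l hl hlT => ?_
    rw [hzero l hl fun h => hlT (Finset.mem_filter.2 ⟨hl, h⟩), zero_div]
  rw [hleft, hright, hsub, ← Finset.sum_fiberwise_of_maps_to
    (g := fun l : List E => (l : Cycle E)) (t := T) fun l hl => (Finset.mem_filter.1 hl).2]
  refine Finset.sum_congr rfl fun c hc => Finset.sum_congr ?_ fun _ _ => rfl
  ext l
  simp only [Finset.mem_filter]
  constructor
  · rintro ⟨h1, rfl⟩; exact ⟨⟨h1, hc⟩, rfl⟩
  · rintro ⟨⟨h1, _⟩, h2⟩; exact ⟨h1, h2⟩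

end

end QuantumGraph

end

noncomputable section

namespace QuantumGraph

open Matrix

/-! ### Traces of bipartite matrices -/

theorem trace_fromBlocks {n : Type*} [Fintype n] (A B C E : Matrix n n ℂ) :
    (fromBlocks A B C E).trace = A.trace + E.trace := by
  simp [trace, Fintype.sum_sum_type]

section
variable {n : Type*} [Fintype n] [DecidableEq n] (A B : Matrix n n ℂ)

theorem fromBlocks_pow_even (m : ℕ) :
    fromBlocks 0 A B 0 ^ (2 * m) = fromBlocks ((A * B) ^ m) 0 0 ((B * A) ^ m) := by
  rw [pow_mul, pow_two, fromBlocks_multiply]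
  simp [fromBlocks_diagonal_pow]

theorem trace_pow_mul_comm (m : ℕ) : ((B * A) ^ m).trace = ((A * B) ^ m).trace := by
  cases m with
  | zero => simp
  | succ m =>
    have h : (B * A) ^ m * B = B * (A * B) ^ m := by
      induction m with
      | zero => simp
      | succ m ih => rw [pow_succ', pow_succ', Matrix.mul_assoc, ih]; simp only [Matrix.mul_assoc]
    rw [pow_succ, ← Matrix.mul_assoc, h, trace_mul_comm, ← Matrix.mul_assoc, ← pow_succ']

theorem trace_fromBlocks_pow_even (m : ℕ) :
    (fromBlocks 0 A B 0 ^ (2 * m)).trace = 2 * ((A * B) ^ m).trace := by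
  rw [fromBlocks_pow_even, trace_fromBlocks, trace_pow_mul_comm]; ring

theorem trace_fromBlocks_pow_odd (m : ℕ) : (fromBlocks 0 A B 0 ^ (2 * m + 1)).trace = 0 := by
  rw [pow_succ, fromBlocks_pow_even, fromBlocks_multiply, trace_fromBlocks]
  simp

theorem sum_trace_fromBlocks_pow (N : ℕ) :
    ∑ m ∈ Finset.range (N + 1), (fromBlocks 0 A B 0 ^ m).trace / m =
      ∑ m ∈ Finset.range (N / 2 + 1), ((A * B) ^ m).trace / m := by
  induction N with
  | zero => simp
  | succ N ih =>
    rw [Finset.sum_range_succ, ih]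
    rcases Nat.even_or_odd' N with ⟨q, rfl | rfl⟩
    · rw [trace_fromBlocks_pow_odd, show (2 * q + 1) / 2 = 2 * q / 2 by omega]
      simp
    · rw [show 2 * q + 1 + 1 = 2 * (q + 1) by ring, trace_fromBlocks_pow_even,
        show (2 * q + 1) / 2 = q by omega, show 2 * (q + 1) / 2 = q + 1 by omega,
        Finset.sum_range_succ _ (q + 1)]
      congr 1
      have : ((q + 1 : ℕ) : ℂ) ≠ 0 := by exact_mod_cast q.succ_ne_zero
      rw [Nat.cast_mul, Nat.cast_ofNat, mul_div_mul_left _ _ two_ne_zero]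

end

/-! ### The sum over periodic orbits -/

theorem toEdge_rev {V D : Type*} (G : MetricGraph V D) (d : D) : G.toEdge (G.rev d) = G.toEdge d :=
  (Quot.sound (r := fun d d' => d' = G.rev d) rfl).symm

section
variable {V D : Type*} (G : MetricGraph V D) (W : Potential G) [Fintype D] [DecidableEq V]
  [DecidableEq D]

theorem term_eq_init_of_tau_ne_zero (k : ℂ) (a b : D ⊕ D) (h : tau G W k b a ≠ 0) :
    G.toDGraph.subdivision.term a = G.toDGraph.subdivision.init b := by
  rcases a with a | a <;> rcases b with b | b
  · exact absurd rfl h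
  · have hab : G.toEdge a = G.toEdge b := by
      simp only [tau, transitionMatrix, of_apply] at h
      split_ifs at h with h1 h2
      · rw [h1]
      · rw [h2]; exact toEdge_rev G b
      · exact absurd rfl h
    exact congrArg Sum.inr ((toEdge_rev G a).trans hab)
  · have hab : G.term a = G.init b := by
      simp only [tau, vertexMatrix, of_apply] at h
      by_contra h1
      exact h (if_neg h1)
    exact congrArg Sum.inl hab
  · exact absurd rfl h

theorem of_tau (k : ℂ) :
    Matrix.of (tau G W k) = fromBlocks 0 (vertexMatrix G) (transitionMatrix G W k) 0 := by
  ext a b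
  rcases a with a | a <;> rcases b with b | b <;> rfl

/-- The periodic orbits of length at most `N` reproduce the traces of the powers of the evolution
matrix up to `N / 2`: each step of the evolution passes one inserted and one original vertex. -/
theorem sum_orbitProd (N : ℕ) (k : ℝ) :
    ∑ p ∈ DGraph.PeriodicOrbit.upTo G.toDGraph.subdivision N,
      (p.primLength : ℂ) / (p.length : ℂ) * orbitProd G W p k =
    ∑ n ∈ Finset.range (N / 2 + 1), (evol G W k ^ n).trace / n := by
  have h := sum_upTo G.toDGraph.subdivision (tau G W (k : ℂ))
    (term_eq_init_of_tau_ne_zero G W k) N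
  rw [of_tau, sum_trace_fromBlocks_pow] at h
  exact h

theorem isTame_tau (a b : D ⊕ D) : IsTame fun k : ℝ => tau G W (k : ℂ) b a := by
  rcases a with a | a <;> rcases b with b | b
  · exact IsTame.const 0
  · exact isTame_transitionMatrix G W b a
  · exact IsTame.const _
  · exact IsTame.const 0

theorem isTame_pathProd (t : List (D ⊕ D)) :
    ∀ a b, IsTame fun k : ℝ => pathProd (tau G W (k : ℂ)) a t b := by
  induction t with
  | nil => exact fun a b => isTame_tau G W a b
  | cons c t ih => exact fun a b => (isTame_tau G W a c).mul (ih c b)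

theorem isTame_orbitProd (p : POStar G) : IsTame (orbitProd G W p) := by
  obtain ⟨c, hc, hc'⟩ := p
  induction c using Quotient.inductionOn' with
  | h l =>
    change IsTame fun k : ℝ => listProd (tau G W (k : ℂ)) l
    cases l with
    | nil => exact absurd rfl hc
    | cons a t =>
      simp only [listProd_cons]
      exact isTame_pathProd G W t a a

/-- The sum of the amplitudes is the derivative of the sum of traces. -/
theorem sum_amplitude (N : ℕ) {k : ℝ} (hk : 0 < k) :
    HasDerivAt (fun l => ∑ n ∈ Finset.range (N / 2 + 1), (evol G W l ^ n).trace / (n : ℂ))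
      (∑ p ∈ DGraph.PeriodicOrbit.upTo G.toDGraph.subdivision N, amplitude G W p k) k := by
  simp only [← sum_orbitProd, amplitude]
  exact HasDerivAt.fun_sum fun p _ =>
    (((isTame_orbitProd G W p).diff k hk).hasDerivAt).const_mul _

theorem exists_amplitude_bound (p : POStar G) {K : ℝ} (hK : 0 < K) :
    ∃ C, ∀ k, K ≤ k → ‖amplitude G W p k‖ ≤ C := by
  obtain ⟨C, _, h⟩ := (isTame_orbitProd G W p).bdd K hK
  refine ⟨‖(p.primLength : ℂ) / (p.length : ℂ)‖ * C, fun k hk => ?_⟩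
  rw [amplitude, norm_mul]
  exact mul_le_mul_of_nonneg_left (h k hk).2 (norm_nonneg _)

theorem measurable_amplitude (p : POStar G) : Measurable (amplitude G W p) :=
  (measurable_deriv _).const_mul _

end

end QuantumGraph

end

noncomputable section

namespace QuantumGraph

open Filter Topology MeasureTheory

/-! ### Integration against Schwartz functions -/

section
variable (φ : 𝓢(ℝ, ℂ)) {K : ℝ}

theorem integrableOn_schwartz_mul_of_bounded {f : ℝ → ℂ} {C : ℝ}
    (hf : AEStronglyMeasurable f (volume.restrict (Set.Ioi K))) (hC : ∀ k, K < k → ‖f k‖ ≤ C) :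
    IntegrableOn (fun k => φ k * f k) (Set.Ioi K) :=
  Integrable.mul_bdd (c := C) φ.integrable.integrableOn hf
    ((ae_restrict_iff' measurableSet_Ioi).2 (.of_forall hC))

theorem integrableOn_schwartz_linear (A B : ℝ) :
    IntegrableOn (fun k => ‖φ k‖ * (A + B * |k|)) (Set.Ioi K) := by
  have h0 := (φ.integrable_pow_mul volume 0).integrableOn (s := Set.Ioi K)
  have h1 := (φ.integrable_pow_mul volume 1).integrableOn (s := Set.Ioi K)
  refine ((h0.const_mul A).add (h1.const_mul B)).congr (.of_forall fun k => ?_)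
  simp only [Pi.add_apply, pow_zero, one_mul, pow_one, Real.norm_eq_abs]
  ring

theorem integrableOn_schwartz_mul_of_linear {f : ℝ → ℂ} {A B : ℝ}
    (hf : AEStronglyMeasurable f (volume.restrict (Set.Ioi K)))
    (hAB : ∀ k, K < k → ‖f k‖ ≤ A + B * |k|) :
    IntegrableOn (fun k => φ k * f k) (Set.Ioi K) := by
  refine (integrableOn_schwartz_linear φ (K := K) A B).mono'
    (φ.continuous.aestronglyMeasurable.mul hf) ?_
  refine (ae_restrict_iff' measurableSet_Ioi).2 (.of_forall fun k hk => ?_)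
  rw [norm_mul]
  exact mul_le_mul_of_nonneg_left (hAB k hk) (norm_nonneg _)

theorem integrableOn_deriv_mul_of_linear {f : ℝ → ℂ} {A B : ℝ}
    (hf : AEStronglyMeasurable f (volume.restrict (Set.Ioi K)))
    (hAB : ∀ k, K < k → ‖f k‖ ≤ A + B * |k|) :
    IntegrableOn (fun k => deriv φ k * f k) (Set.Ioi K) :=
  integrableOn_schwartz_mul_of_linear (SchwartzMap.derivCLM ℂ ℂ φ) hf hAB

theorem integral_deriv_Ioi (a : ℝ) : ∫ k in Set.Ioi a, deriv φ k = -φ a := by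
  have hd : ∀ k ∈ Set.Ici a, HasDerivAt φ (deriv φ k) k := fun k _ => φ.hasDerivAt k
  have hi : IntegrableOn (deriv φ) (Set.Ioi a) :=
    (SchwartzMap.derivCLM ℂ ℂ φ).integrable.integrableOn
  rw [integral_Ioi_of_hasDerivAt_of_tendsto' hd hi (tendsto_zero_of_hasDerivAt_of_integrableOn_Ioi
    (fun k hk => hd k (Set.mem_Ici.2 (le_of_lt hk))) hi φ.integrable.integrableOn), zero_sub]

theorem norm_le_linear {f f' : ℝ → ℂ} (hf : ∀ k, K ≤ k → HasDerivAt f (f' k) k) {C : ℝ}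
    (hC : ∀ k, K ≤ k → ‖f' k‖ ≤ C) {k : ℝ} (hk : K ≤ k) :
    ‖f k‖ ≤ (‖f K‖ + C * |K|) + C * |k| := by
  have h := (convex_Ici K).norm_image_sub_le_of_norm_hasDerivWithin_le
    (fun x hx => (hf x hx).hasDerivWithinAt) hC (Set.mem_Ici.2 le_rfl) (Set.mem_Ici.2 hk)
  have hC0 : 0 ≤ C := (norm_nonneg _).trans (hC K le_rfl)
  have h1 : ‖k - K‖ ≤ |k| + |K| := by
    rw [Real.norm_eq_abs]; exact abs_sub _ _
  have h2 := norm_le_norm_add_norm_sub' (f k) (f K)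
  nlinarith [mul_le_mul_of_nonneg_left h1 hC0]

/-- Integration by parts on `[K, ∞)` of a Schwartz function against a function with bounded
derivative. -/
theorem integral_schwartz_mul_deriv {f f' : ℝ → ℂ} (hf : ∀ k, K ≤ k → HasDerivAt f (f' k) k)
    {C : ℝ} (hC : ∀ k, K ≤ k → ‖f' k‖ ≤ C)
    (hm : AEStronglyMeasurable f' (volume.restrict (Set.Ioi K))) :
    IntegrableOn (fun k => deriv φ k * f k) (Set.Ioi K) ∧
    IntegrableOn (fun k => φ k * f' k) (Set.Ioi K) ∧
    ∫ k in Set.Ioi K, φ k * f' k = -(φ K * f K) - ∫ k in Set.Ioi K, deriv φ k * f k := by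
  have hfm : AEStronglyMeasurable f (volume.restrict (Set.Ioi K)) :=
    ContinuousOn.aestronglyMeasurable (fun k hk =>
      (hf k (le_of_lt hk)).continuousAt.continuousWithinAt) measurableSet_Ioi
  have hlin : ∀ k, K < k → ‖f k‖ ≤ (‖f K‖ + C * |K|) + C * |k| := fun k hk =>
    norm_le_linear hf hC hk.le
  have h1 := integrableOn_deriv_mul_of_linear φ hfm hlin
  have h2 := integrableOn_schwartz_mul_of_bounded φ hm fun k hk => hC k hk.le
  have h3 := integrableOn_schwartz_mul_of_linear φ hfm hlin
  have hd : ∀ k ∈ Set.Ici K, HasDerivAt (fun k => φ k * f k) (deriv φ k * f k + φ k * f' k) k :=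
    fun k hk => (φ.hasDerivAt k).mul (hf k hk)
  have h := integral_Ioi_of_hasDerivAt_of_tendsto' hd (h1.add h2)
    (tendsto_zero_of_hasDerivAt_of_integrableOn_Ioi (fun k hk => hd k (Set.mem_Ici.2 (le_of_lt hk)))
      (h1.add h2) h3)
  rw [integral_add h1 h2] at h
  exact ⟨h1, h2, by linear_combination h⟩

/-- Integration against a counting function: if the weighted number `N k` of points below `k` is
finite and at most linear in `k`, the weighted sum of a Schwartz function is minus the integral of
its derivative against `N`, by Fubini's theorem and `φ s = -∫ φ'` over `(s, ∞)`. -/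
theorem hasSum_counting {S : Set ℝ} (hSc : S.Countable) (hSK : S ⊆ Set.Ioi K) (m : ℝ → ℕ)
    {N : ℝ → ℝ} {A B : ℝ} (hAB : ∀ k, K < k → |N k| ≤ A + B * |k|)
    (hN : ∀ k, K < k → HasSum (fun s : S => if (s : ℝ) < k then (m s : ℝ) else 0) (N k)) :
    HasSum (fun s : S => (m s : ℂ) * φ s) (-∫ k in Set.Ioi K, deriv φ k * (N k : ℂ)) := by
  have : Countable S := hSc
  let F : S → ℝ → ℂ := fun s => (Set.Ioi (s : ℝ)).indicator fun k => -((m s : ℂ) * deriv φ k)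
  have hφ' : Integrable (deriv φ) := (SchwartzMap.derivCLM ℂ ℂ φ).integrable
  have hFi : ∀ s, IntegrableOn (F s) (Set.Ioi K) := fun s =>
    ((hφ'.const_mul _).neg.indicator measurableSet_Ioi).integrableOn
  have hnorm : ∀ (s : S) (k : ℝ), ‖F s k‖ = ‖deriv φ k‖ * if (s : ℝ) < k then (m s : ℝ) else 0 := by
    intro s k
    simp only [F, Set.indicator, Set.mem_Ioi]
    split_ifs
    · rw [norm_neg, norm_mul, Complex.norm_natCast, mul_comm]
    · simp
  have hFsum : Summable fun s => ∫ k in Set.Ioi K, ‖F s k‖ := by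
    refine summable_of_sum_le (c := ∫ k in Set.Ioi K, ‖deriv φ k‖ * (A + B * |k|))
      (fun s => integral_nonneg fun k => norm_nonneg _) fun u => ?_
    rw [← integral_finsetSum _ fun s _ => (hFi s).norm]
    refine setIntegral_mono_on (integrable_finsetSum _ fun s _ => (hFi s).norm)
      (integrableOn_schwartz_linear (SchwartzMap.derivCLM ℂ ℂ φ) A B) measurableSet_Ioi
      fun k hk => ?_
    simp only [hnorm, ← Finset.mul_sum]
    refine mul_le_mul_of_nonneg_left ?_ (norm_nonneg _)
    refine (sum_le_hasSum u (fun s _ => ?_) (hN k hk)).trans ((le_abs_self _).trans (hAB k hk))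
    split_ifs <;> positivity
  have h := hasSum_integral_of_summable_integral_norm hFi hFsum
  have hterm : ∀ s : S, ∫ k in Set.Ioi K, F s k = (m s : ℂ) * φ s := by
    intro s
    have hs : K < s := hSK s.2
    rw [setIntegral_indicator measurableSet_Ioi, Set.Ioi_inter_Ioi, sup_eq_right.2 hs.le,
      integral_neg, integral_const_mul, integral_deriv_Ioi]
    ring
  simp only [hterm] at h
  suffices heq : -∫ k in Set.Ioi K, deriv φ k * (N k : ℂ) = ∫ k in Set.Ioi K, ∑' s, F s k by
    rw [heq]; exact h
  rw [← integral_neg]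
  refine setIntegral_congr_fun measurableSet_Ioi fun k hk => ?_
  have h1 : HasSum (fun s : S => F s k) (-(deriv φ k * (N k : ℂ))) := by
    have h2 := ((Complex.hasSum_ofReal.2 (hN k hk)).mul_left (deriv φ k)).neg
    refine h2.congr_fun ?_
    intro s
    simp only [F, Set.indicator, Set.mem_Ioi]
    split_ifs
    · push_cast; ring
    · simp
  exact h1.tsum_eq.symm

end

end QuantumGraph

end

noncomputable section

namespace QuantumGraph

open Filter Topology MeasureTheory

/-! ### Counting functions -/

section
variable {m : ℝ → ℕ} {J : ℝ → ℝ} {K : ℝ}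

/-- A set of weighted points without accumulation in a compact interval is finite there. -/
theorem finite_support_inter (hK : 0 < K) (hm : ∀ k, 0 < k → ∀ᶠ l in 𝓝[≠] k, m l = 0) (b : ℝ) :
    {l | (K < l ∧ l < b) ∧ m l ≠ 0}.Finite := by
  by_contra h
  obtain ⟨x, hx, hacc⟩ := Set.Infinite.exists_accPt_of_subset_isCompact h (isCompact_Icc (a := K)
    (b := b)) fun l hl => ⟨hl.1.1.le, hl.1.2.le⟩
  rw [accPt_iff_frequently_nhdsNE] at hacc
  obtain ⟨l, h1, h2⟩ := (hacc.and_eventually (hm x (hK.trans_le hx.1))).exists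
  exact h1.2 h2

/-- The number of points in `(K, k)`, counted with multiplicity. -/
def countBelow (m : ℝ → ℕ) (K k : ℝ) : ℝ := ∑ᶠ l ∈ {l | (K < l ∧ l < k) ∧ m l ≠ 0}, (m l : ℝ)

theorem countBelow_nonneg (k : ℝ) : 0 ≤ countBelow m K k :=
  finsum_nonneg fun _ => finsum_nonneg fun _ => Nat.cast_nonneg _

/-- A function that jumps at each point by half the weight on either side, and is locally constant
elsewhere, is a counting function up to an additive constant; at the points themselves it takes the
mean of its one-sided limits. -/
theorem eq_countBelow (hK : 0 < K) (hmK : m K = 0)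
    (hr : ∀ k, 0 < k → ∀ᶠ l in 𝓝[>] k, m l = 0 ∧ J l = J k + m k / 2)
    (hl : ∀ k, 0 < k → ∀ᶠ l in 𝓝[<] k, m l = 0 ∧ J l = J k - m k / 2) {k : ℝ} (hk : K ≤ k) :
    J k = J K + countBelow m K k + m k / 2 := by
  have hne : ∀ k, 0 < k → ∀ᶠ l in 𝓝[≠] k, m l = 0 := fun k hk => by
    rw [← Set.Iio_union_Ioi, nhdsWithin_union]
    exact eventually_sup.2 ⟨(hl k hk).mono fun _ h => h.1, (hr k hk).mono fun _ h => h.1⟩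
  have hfin := finite_support_inter hK hne
  -- it suffices that the difference is locally constant
  set H : ℝ → ℝ := fun k => J k - countBelow m K k - m k / 2 with hH
  have hright : ∀ x, K ≤ x → ∀ᶠ l in 𝓝[>] x, H l = H x := by
    intro x hx
    obtain ⟨u, hu, hux⟩ := mem_nhdsGT_iff_exists_Ioo_subset.1 (hr x (hK.trans_le hx))
    filter_upwards [Ioo_mem_nhdsGT hu] with l hl
    have h1 := hux hl
    have hset : {y | (K < y ∧ y < l) ∧ m y ≠ 0} =
        {y | (K < y ∧ y < x) ∧ m y ≠ 0} ∪ {y | y = x ∧ m y ≠ 0} := by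
      ext y
      constructor
      · rintro ⟨⟨h2, h3⟩, h4⟩
        rcases lt_trichotomy y x with h | h | h
        · exact Or.inl ⟨⟨h2, h⟩, h4⟩
        · exact Or.inr ⟨h, h4⟩
        · exact absurd (hux ⟨h, h3.trans hl.2⟩).1 h4
      · rintro (⟨⟨h2, h3⟩, h4⟩ | ⟨rfl, h4⟩)
        · exact ⟨⟨h2, h3.trans hl.1⟩, h4⟩
        · refine ⟨⟨lt_of_le_of_ne hx fun h => h4 (h ▸ hmK), hl.1⟩, h4⟩
    have hcount : countBelow m K l = countBelow m K x + m x := by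
      rw [countBelow, hset, finsum_mem_union _ (hfin x)
        ((Set.finite_singleton x).subset fun y hy => hy.1)]
      · congr 1
        by_cases h0 : m x = 0
        · have : {y | y = x ∧ m y ≠ 0} = ∅ := by
            ext y
            simp only [Set.mem_empty_iff_false, iff_false]
            rintro ⟨rfl, h⟩
            exact h h0
          rw [this, finsum_mem_empty, h0, Nat.cast_zero]
        · have : {y | y = x ∧ m y ≠ 0} = {x} := by
            ext y
            constructor
            · rintro ⟨rfl, _⟩; rfl
            · rintro rfl; exact ⟨rfl, h0⟩
          rw [this, finsum_mem_singleton]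
      · rw [Set.disjoint_left]
        rintro y ⟨⟨_, h2⟩, _⟩ ⟨rfl, _⟩
        exact lt_irrefl _ h2
    simp only [hH, hcount, h1.1, h1.2, Nat.cast_zero]
    ring
  have hleft : ∀ x, K < x → ∀ᶠ l in 𝓝[<] x, H l = H x := by
    intro x hx
    obtain ⟨u, hu, hux⟩ := mem_nhdsLT_iff_exists_Ioo_subset.1 (hl x (hK.trans hx))
    filter_upwards [Ioo_mem_nhdsLT hu, Ioo_mem_nhdsLT hx] with l hl hlK
    have h1 := hux hl
    have hset : {y | (K < y ∧ y < x) ∧ m y ≠ 0} = {y | (K < y ∧ y < l) ∧ m y ≠ 0} := by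
      ext y
      constructor
      · rintro ⟨⟨h2, h3⟩, h4⟩
        refine ⟨⟨h2, ?_⟩, h4⟩
        by_contra h
        exact h4 (hux ⟨hl.1.trans_le (not_lt.1 h), h3⟩).1
      · rintro ⟨⟨h2, h3⟩, h4⟩
        exact ⟨⟨h2, h3.trans hlK.2⟩, h4⟩
    have hcount : countBelow m K x = countBelow m K l := by rw [countBelow, hset, countBelow]
    simp only [hH, hcount, h1.1, h1.2, Nat.cast_zero]
    ring
  have hconst := constant_of_has_deriv_right_zero (f := H) (a := K) (b := k) ?_ ?_ k ⟨hk, le_rfl⟩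
  · have h0 : countBelow m K K = 0 := by
      have : {l | (K < l ∧ l < K) ∧ m l ≠ 0} = ∅ := by
        ext y
        simp only [Set.mem_empty_iff_false, iff_false]
        rintro ⟨⟨h1, h2⟩, _⟩
        exact lt_asymm h1 h2
      rw [countBelow, this, finsum_mem_empty]
    simp only [hH, h0, hmK, Nat.cast_zero] at hconst
    linarith
  · intro x hx
    have h1 : ∀ᶠ l in 𝓝[Set.Icc K k] x, H l = H x := by
      rcases hx.1.eq_or_lt with rfl | h
      · have h2 : ∀ᶠ l in 𝓝[Set.Ici K] K, H l = H K := by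
          rw [← Set.Ioi_insert, nhdsWithin_insert]
          exact eventually_sup.2 ⟨rfl, hright K le_rfl⟩
        exact nhdsWithin_mono _ Set.Icc_subset_Ici_self h2
      · refine nhdsWithin_le_nhds ?_
        rw [← nhdsLT_sup_nhdsGE, ← Set.Ioi_insert, nhdsWithin_insert]
        exact eventually_sup.2 ⟨hleft x h, eventually_sup.2 ⟨rfl, hright x hx.1⟩⟩
    exact tendsto_const_nhds.congr' (h1.mono fun _ h => h.symm)
  · intro x hx
    have h2 : ∀ᶠ l in 𝓝[Set.Ici x] x, H l = H x := by
      rw [← Set.Ioi_insert, nhdsWithin_insert]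
      exact eventually_sup.2 ⟨rfl, hright x hx.1⟩
    exact (hasDerivWithinAt_const x _ (H x)).congr_of_eventuallyEq h2 rfl

theorem countable_support (hK : 0 < K) (hm : ∀ k, 0 < k → ∀ᶠ l in 𝓝[≠] k, m l = 0) :
    {l | K < l ∧ m l ≠ 0}.Countable := by
  have : {l | K < l ∧ m l ≠ 0} ⊆ ⋃ n : ℕ, {l | (K < l ∧ l < n) ∧ m l ≠ 0} := fun l hl => by
    obtain ⟨n, hn⟩ := exists_nat_gt l
    exact Set.mem_iUnion.2 ⟨n, ⟨hl.1, hn⟩, hl.2⟩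
  exact (Set.countable_iUnion fun n : ℕ => (finite_support_inter hK hm n).countable).mono this

theorem hasSum_countBelow (hK : 0 < K) (hm : ∀ k, 0 < k → ∀ᶠ l in 𝓝[≠] k, m l = 0) (k : ℝ) :
    HasSum (fun s : {l | K < l ∧ m l ≠ 0} => if (s : ℝ) < k then (m s : ℝ) else 0)
      (countBelow m K k) := by
  have hfin := finite_support_inter hK hm k
  have hc : countBelow m K k = ∑ l ∈ hfin.toFinset, (m l : ℝ) :=
    finsum_mem_eq_finite_toFinset_sum _ hfin
  rw [hc]
  refine (hasSum_subtype_iff_indicator (s := {l | K < l ∧ m l ≠ 0})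
    (f := fun l : ℝ => if l < k then (m l : ℝ) else 0)).2 ?_
  have hval : ∀ l ∈ hfin.toFinset, (m l : ℝ) = ({l | K < l ∧ m l ≠ 0} : Set ℝ).indicator
      (fun l : ℝ => if l < k then (m l : ℝ) else 0) l := fun l hl => by
    have hl' := (Set.Finite.mem_toFinset _).1 hl
    rw [Set.indicator_of_mem (show l ∈ {l | K < l ∧ m l ≠ 0} from ⟨hl'.1.1, hl'.2⟩), if_pos hl'.1.2]
  rw [Finset.sum_congr rfl hval]
  refine hasSum_sum_of_ne_finset_zero fun l hl => ?_
  by_cases h1 : l ∈ {l | K < l ∧ m l ≠ 0}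
  · rw [Set.indicator_of_mem h1]
    exact if_neg fun h2 => hl ((Set.Finite.mem_toFinset _).2 ⟨⟨h1.1, h2⟩, h1.2⟩)
  · exact Set.indicator_of_notMem h1 _

/-- The summation formula for a locally constant function with jumps: by `eq_countBelow`, `J - J K`
agrees off a countable set with the counting function of its jumps. -/
theorem hasSum_of_jumps (φ : 𝓢(ℝ, ℂ)) (hK : 0 < K) (hmK : m K = 0)
    (hr : ∀ k, 0 < k → ∀ᶠ l in 𝓝[>] k, m l = 0 ∧ J l = J k + m k / 2)
    (hl : ∀ k, 0 < k → ∀ᶠ l in 𝓝[<] k, m l = 0 ∧ J l = J k - m k / 2)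
    {A B : ℝ} (hJ : ∀ k, K ≤ k → |J k| ≤ A + B * |k|)
    (hJi : IntegrableOn (fun k => deriv φ k * (J k : ℂ)) (Set.Ioi K)) :
    HasSum (fun k : Set.Ioi K => (m k : ℂ) * φ k)
      (-(φ K * J K) - ∫ k in Set.Ioi K, deriv φ k * (J k : ℂ)) := by
  have hne : ∀ k, 0 < k → ∀ᶠ l in 𝓝[≠] k, m l = 0 := fun k hk => by
    rw [← Set.Iio_union_Ioi, nhdsWithin_union]
    exact eventually_sup.2 ⟨(hl k hk).mono fun _ h => h.1, (hr k hk).mono fun _ h => h.1⟩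
  have hN : ∀ k, K ≤ k → J k = J K + countBelow m K k + m k / 2 := fun k hk =>
    eq_countBelow hK hmK hr hl hk
  have hcs := countable_support hK hne
  have h := hasSum_counting φ hcs (fun l hl => hl.1) m (N := countBelow m K)
    (A := A + |J K|) (B := B) (fun k hk => ?_) fun k _ => hasSum_countBelow hK hne k
  · have hint : -∫ k in Set.Ioi K, deriv φ k * (countBelow m K k : ℂ) =
        -(φ K * J K) - ∫ k in Set.Ioi K, deriv φ k * (J k : ℂ) := by
      have h1 : ∫ k in Set.Ioi K, deriv φ k * (countBelow m K k : ℂ) =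
          ∫ k in Set.Ioi K, (deriv φ k * (J k : ℂ) - deriv φ k * (J K : ℂ)) := by
        refine integral_congr_ae ?_
        have hae : ∀ᵐ k ∂volume, k ∉ {l | K < l ∧ m l ≠ 0} :=
          measure_eq_zero_iff_ae_notMem.1 (hcs.measure_zero volume)
        filter_upwards [ae_restrict_of_ae hae, ae_restrict_mem measurableSet_Ioi] with k hk hkK
        have hmk : m k = 0 := by
          by_contra h0
          exact hk ⟨hkK, h0⟩
        rw [hN k (le_of_lt hkK), hmk]
        push_cast
        ring
      have hφ' : IntegrableOn (deriv φ) (Set.Ioi K) :=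
        (SchwartzMap.derivCLM ℂ ℂ φ).integrable.integrableOn
      rw [h1, integral_sub hJi (hφ'.mul_const _), integral_mul_const, integral_deriv_Ioi]
      ring
    rw [hint] at h
    refine (hasSum_subtype_iff_indicator (s := Set.Ioi K)
      (f := fun k : ℝ => (m k : ℂ) * φ k)).2 ?_
    have h' := (hasSum_subtype_iff_indicator (s := {l | K < l ∧ m l ≠ 0})
      (f := fun k : ℝ => (m k : ℂ) * φ k)).1 h
    refine h'.congr_fun fun k => ?_
    by_cases h1 : K < k
    · rw [Set.indicator_of_mem (Set.mem_Ioi.2 h1)]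
      by_cases h2 : k ∈ {l | K < l ∧ m l ≠ 0}
      · rw [Set.indicator_of_mem h2]
      · have h3 : m k = 0 := by
          by_contra h0
          exact h2 ⟨h1, h0⟩
        rw [Set.indicator_of_notMem h2, h3, Nat.cast_zero, zero_mul]
    · rw [Set.indicator_of_notMem (s := Set.Ioi K) (fun h2 => h1 h2),
        Set.indicator_of_notMem (s := {l | K < l ∧ m l ≠ 0}) (fun h2 => h1 h2.1)]
  · rw [abs_of_nonneg (countBelow_nonneg k)]
    have h1 := hN k hk.le
    have h2 := hJ k hk.le
    have h3 := le_abs_self (J k)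
    have h4 := neg_abs_le (J K)
    have h5 : (0 : ℝ) ≤ m k := Nat.cast_nonneg _
    linarith

end

end QuantumGraph

end

noncomputable section

namespace QuantumGraph

open Filter Topology MeasureTheory

/-! ### The trace formula -/

section
variable {V D : Type*} {G : MetricGraph V D} {W : Potential G} [Fintype D] [DecidableEq D]

/-- Integration by parts for the phase of `det T`. -/
theorem integral_phase {Θ : ℝ → ℝ} (hΘ : IsPhase G W Θ) (φ : 𝓢(ℝ, ℂ)) {K : ℝ} (hK : 0 < K) :
    IntegrableOn (fun k => deriv φ k * (Θ k : ℂ)) (Set.Ioi K) ∧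
    IntegrableOn (fun k => φ k * ((deriv Θ k : ℝ) : ℂ)) (Set.Ioi K) ∧
    ∫ k in Set.Ioi K, φ k * ((deriv Θ k : ℝ) : ℂ) =
      -(φ K * Θ K) - ∫ k in Set.Ioi K, deriv φ k * (Θ k : ℂ) := by
  obtain ⟨C, _, hC⟩ := exists_deriv_phase_bound hΘ hK
  exact integral_schwartz_mul_deriv φ (K := K)
    (fun k hk => (hΘ k (hK.trans_le hk)).1.hasDerivAt.ofReal_comp)
    (fun k hk => by rw [Complex.norm_real]; exact hC k hk)
    (Complex.measurable_ofReal.comp (measurable_deriv Θ)).aestronglyMeasurable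

variable (G W) [DecidableEq V]

/-- The oscillating part of the counting function, truncated: the imaginary part of the partial
sums of `-log det (1 - U)`. -/
def imTraceSum (M : ℕ) (k : ℝ) : ℝ :=
  (∑ n ∈ Finset.range (M + 1), (evol G W k ^ n).trace / (n : ℂ)).im

theorem hasDerivAt_imTraceSum (N : ℕ) {k : ℝ} (hk : 0 < k) :
    HasDerivAt (imTraceSum G W (N / 2))
      (∑ p ∈ DGraph.PeriodicOrbit.upTo G.toDGraph.subdivision N, amplitude G W p k).im k :=
  Complex.imCLM.hasFDerivAt.comp_hasDerivAt k (sum_amplitude G W N hk)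

theorem exists_sum_amplitude_bound (N : ℕ) {K : ℝ} (hK : 0 < K) :
    ∃ C, ∀ k, K ≤ k → ‖(((∑ p ∈ DGraph.PeriodicOrbit.upTo G.toDGraph.subdivision N,
      amplitude G W p k).im : ℝ) : ℂ)‖ ≤ C := by
  choose C hC using fun p => exists_amplitude_bound G W p hK
  refine ⟨∑ p ∈ DGraph.PeriodicOrbit.upTo G.toDGraph.subdivision N, C p, fun k hk => ?_⟩
  rw [Complex.norm_real, Real.norm_eq_abs]
  exact (Complex.abs_im_le_norm _).trans
    ((norm_sum_le _ _).trans (Finset.sum_le_sum fun p _ => hC p k hk))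

end

section
variable {V D : Type*} (G : MetricGraph V D) (W : Potential G) [Fintype V] [Fintype D]
  [DecidableEq V] [DecidableEq D]

theorem imTraceSum_eq (M : ℕ) {k : ℝ} (hk : 0 < k) :
    imTraceSum G W M k = ∑ j, (∑ n ∈ Finset.range (M + 1), eig G W k j ^ n / (n : ℂ)).im := by
  simp only [imTraceSum, (eig_spec G W hk).2.1, Finset.sum_div]
  rw [Finset.sum_comm, Complex.im_sum]

theorem abs_imTraceSum_le (M : ℕ) {k : ℝ} (hk : 0 < k) :
    |imTraceSum G W M k| ≤ Fintype.card D * (Real.pi + 2) := by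
  rw [imTraceSum_eq G W M hk]
  refine (Finset.abs_sum_le_sum_abs _ _).trans ?_
  refine (Finset.sum_le_sum fun j _ => abs_im_sum_le (norm_eig G W k j) (M + 1)).trans ?_
  rw [Finset.sum_const, Finset.card_univ, nsmul_eq_mul]

theorem tendsto_imTraceSum {k : ℝ} (hk : 0 < k) :
    Tendsto (fun N : ℕ => imTraceSum G W (N / 2) k) atTop (𝓝 (sawSum G W k)) := by
  simp only [imTraceSum_eq G W _ hk]
  have h : Tendsto (fun N : ℕ => N / 2 + 1) atTop atTop :=
    (tendsto_add_atTop_nat 1).comp (Nat.tendsto_div_const_atTop two_ne_zero)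
  exact tendsto_finsetSum _ fun j _ => (tendsto_im_sum (norm_eig G W k j)).comp h

theorem abs_sawSum_le (k : ℝ) : |sawSum G W k| ≤ Fintype.card D * Real.pi := by
  refine (Finset.abs_sum_le_sum_abs _ _).trans ?_
  refine (Finset.sum_le_sum fun j _ => abs_sawtooth_le (eig G W k j)).trans ?_
  rw [Finset.sum_const, Finset.card_univ, nsmul_eq_mul]

variable {G W}

/-- Integration by parts and dominated convergence for the sum over periodic orbits. -/
theorem tendsto_integral_amplitude (φ : 𝓢(ℝ, ℂ)) {K : ℝ} (hK : 0 < K) :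
    IntegrableOn (fun k => deriv φ k * (sawSum G W k : ℂ)) (Set.Ioi K) ∧
    Tendsto (fun N : ℕ => ∫ k in Set.Ioi K, φ k *
        (((∑ p ∈ DGraph.PeriodicOrbit.upTo G.toDGraph.subdivision N,
          amplitude G W p k).im : ℝ) : ℂ)) atTop
      (𝓝 (-(φ K * sawSum G W K) - ∫ k in Set.Ioi K, deriv φ k * (sawSum G W k : ℂ))) := by
  have hpos : ∀ k, K < k → 0 < k := fun k hk => hK.trans hk
  choose C hC using fun N => exists_sum_amplitude_bound G W N hK
  have hparts := fun N : ℕ => integral_schwartz_mul_deriv φ (K := K)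
      (fun k hk => (hasDerivAt_imTraceSum G W N (hK.trans_le hk)).ofReal_comp) (hC N)
      (Complex.measurable_ofReal.comp (Complex.measurable_im.comp
        (Finset.measurable_fun_sum _ fun p _ => measurable_amplitude G W p))).aestronglyMeasurable
  have hlim : ∀ᵐ k ∂volume.restrict (Set.Ioi K), Tendsto (fun N : ℕ =>
      deriv φ k * (imTraceSum G W (N / 2) k : ℂ)) atTop (𝓝 (deriv φ k * (sawSum G W k : ℂ))) :=
    (ae_restrict_iff' measurableSet_Ioi).2 (.of_forall fun k hk =>
      ((Complex.continuous_ofReal.tendsto _).comp (tendsto_imTraceSum G W (hpos k hk))).const_mul _)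
  have hφ' : IntegrableOn (deriv φ) (Set.Ioi K) :=
    (SchwartzMap.derivCLM ℂ ℂ φ).integrable.integrableOn
  refine ⟨?_, ?_⟩
  · refine (hφ'.norm.mul_const (Fintype.card D * Real.pi)).mono'
      (aestronglyMeasurable_of_tendsto_ae atTop (fun N => (hparts N).1.1) hlim)
      (.of_forall fun k => ?_)
    rw [norm_mul, Complex.norm_real]
    exact mul_le_mul_of_nonneg_left (abs_sawSum_le G W k) (norm_nonneg _)
  · simp only [fun N => (hparts N).2.2]
    refine Tendsto.sub (Tendsto.neg (Tendsto.const_mul _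
      ((Complex.continuous_ofReal.tendsto _).comp (tendsto_imTraceSum G W hK)))) ?_
    refine tendsto_integral_of_dominated_convergence
      (fun k => ‖deriv φ k‖ * (Fintype.card D * (Real.pi + 2))) (fun N => (hparts N).1.1)
      (hφ'.norm.mul_const _) (fun N => ?_) hlim
    refine (ae_restrict_iff' measurableSet_Ioi).2 (.of_forall fun k hk => ?_)
    rw [norm_mul, Complex.norm_real]
    exact mul_le_mul_of_nonneg_left (abs_imTraceSum_le G W _ (hpos k hk)) (norm_nonneg _)

/-- The trace formula with both sides brought into the form of an integral against the derivative
of the test function. -/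
theorem hasSum_spectrum {Θ : ℝ → ℝ} (hΘ : IsPhase G W Θ) (φ : 𝓢(ℝ, ℂ)) {K : ℝ} (hK : 0 < K)
    (hmK : multiplicity G W K = 0) :
    HasSum (fun k : Set.Ioi K => (multiplicity G W k : ℂ) * φ k)
      (1 / (2 * (Real.pi : ℂ)) *
          (-(φ K * Θ K) - ∫ k in Set.Ioi K, deriv φ k * (Θ k : ℂ)) +
        1 / (Real.pi : ℂ) *
          (-(φ K * sawSum G W K) - ∫ k in Set.Ioi K, deriv φ k * (sawSum G W k : ℂ))) := by
  have hπ : (Real.pi : ℂ) ≠ 0 := Complex.ofReal_ne_zero.2 Real.pi_ne_zero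
  set J : ℝ → ℝ := fun k => (2 * sawSum G W k + Θ k) / (2 * Real.pi) with hJ
  have hJc : ∀ k, deriv φ k * (J k : ℂ) = 1 / (2 * (Real.pi : ℂ)) * (deriv φ k * (Θ k : ℂ)) +
      1 / (Real.pi : ℂ) * (deriv φ k * (sawSum G W k : ℂ)) := fun k => by
    simp only [hJ]
    push_cast
    field_simp
    ring
  have hiΘ := (integral_phase hΘ φ hK).1
  have hiQ := (tendsto_integral_amplitude (G := G) (W := W) φ hK).1
  obtain ⟨C, _, hC⟩ := exists_deriv_phase_bound hΘ hK
  have h := hasSum_of_jumps (m := multiplicity G W) (J := J) φ hK hmK ?_ ?_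
    (A := (Fintype.card D * Real.pi * 2 + (|Θ K| + C * |K|)) / (2 * Real.pi))
    (B := C / (2 * Real.pi)) ?_ ?_
  · convert h using 1
    simp only [hJc]
    rw [integral_add (hiΘ.const_mul _) (hiQ.const_mul _), integral_const_mul, integral_const_mul]
    simp only [hJ]
    push_cast
    field_simp
    ring
  · intro k hk
    filter_upwards [eventually_right hΘ hk] with l hl
    refine ⟨hl.1, ?_⟩
    simp only [hJ, hl.2]
    field_simp
  · intro k hk
    filter_upwards [eventually_left hΘ hk] with l hl
    refine ⟨hl.1, ?_⟩
    simp only [hJ, hl.2]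
    field_simp
  · intro k hk
    have h1 := norm_le_linear (f := fun k => (Θ k : ℂ)) (K := K)
      (fun k hk => (hΘ k (hK.trans_le hk)).1.hasDerivAt.ofReal_comp)
      (fun k hk => by rw [Complex.norm_real]; exact hC k hk) hk
    simp only [Complex.norm_real, Real.norm_eq_abs] at h1
    have h2 := abs_sawSum_le G W k
    have h3 : |2 * sawSum G W k + Θ k| ≤ 2 * |sawSum G W k| + |Θ k| := by
      refine (abs_add_le _ _).trans (le_of_eq ?_)
      rw [abs_mul, abs_two]
    have hpi := Real.two_pi_pos
    simp only [hJ]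
    rw [abs_div, abs_of_pos hpi, div_mul_eq_mul_div, ← add_div]
    exact div_le_div_of_nonneg_right (by linarith) hpi.le
  · exact ((hiΘ.const_mul _).add (hiQ.const_mul _)).congr (.of_forall fun k => (hJc k).symm)

end

end QuantumGraph

end

theorem theorem2 {V D : Type*} [Fintype V] [Fintype D] [DecidableEq V] [DecidableEq D]
    (G : QuantumGraph.MetricGraph V D) (W : QuantumGraph.Potential G) :
    (∃ Θ : ℝ → ℝ, QuantumGraph.IsPhase G W Θ) ∧
    ∃ K : ℝ, 0 ≤ K ∧
      (∀ k : ℝ, K < k → Module.Finite ℂ (QuantumGraph.eigenspace G W ((k : ℂ) ^ 2))) ∧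
      ∀ Θ : ℝ → ℝ, QuantumGraph.IsPhase G W Θ →
      ∀ φ : 𝓢(ℝ, ℂ), QuantumGraph.HasHolomorphicExtension φ →
        Summable (fun k : Set.Ioi K => (QuantumGraph.multiplicity G W k : ℂ) * φ k) ∧
        MeasureTheory.IntegrableOn (fun k : ℝ => φ k * ((deriv Θ k : ℝ) : ℂ)) (Set.Ioi K) ∧
        (∀ p : QuantumGraph.POStar G,
          (∀ k : ℝ, K < k → DifferentiableAt ℝ (QuantumGraph.orbitProd G W p) k) ∧
          MeasureTheory.IntegrableOn
            (fun k : ℝ => φ k * QuantumGraph.amplitude G W p k) (Set.Ioi K)) ∧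
        Filter.Tendsto
          (fun N : ℕ =>
            1 / (2 * (Real.pi : ℂ)) * (∫ k in Set.Ioi K, φ k * ((deriv Θ k : ℝ) : ℂ)) +
            1 / (Real.pi : ℂ) * (∫ k in Set.Ioi K,
              φ k * (((∑ p ∈ QuantumGraph.DGraph.PeriodicOrbit.upTo _ N,
                QuantumGraph.amplitude G W p k).im : ℝ) : ℂ)))
          Filter.atTop
          (nhds (∑' k : Set.Ioi K, (QuantumGraph.multiplicity G W k : ℂ) * φ k)) := by
  refine ⟨QuantumGraph.exists_isPhase G W, ?_⟩
  -- any point `K > 0` outside the spectrum will do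
  have hev : ∀ᶠ k in nhdsWithin (1 : ℝ) (Set.Ioi 1), QuantumGraph.multiplicity G W k = 0 ∧ 1 < k :=
    Filter.Eventually.and (nhdsWithin_mono 1 (fun x hx => ne_of_gt hx)
      (QuantumGraph.eventually_multiplicity_eq_zero G W one_pos)) self_mem_nhdsWithin
  obtain ⟨K, hmK, hK1⟩ := hev.exists
  have hK : 0 < K := one_pos.trans hK1
  refine ⟨K, hK.le, fun k hk => QuantumGraph.finite_eigenspace G W (hK.trans hk),
    fun Θ hΘ φ _ => ?_⟩
  have hsum := QuantumGraph.hasSum_spectrum hΘ φ hK hmK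
  obtain ⟨-, hint, hphase⟩ := QuantumGraph.integral_phase hΘ φ hK
  refine ⟨hsum.summable, hint, fun p => ⟨fun k hk =>
    (QuantumGraph.isTame_orbitProd G W p).diff k (hK.trans hk), ?_⟩, ?_⟩
  · obtain ⟨C, hC⟩ := QuantumGraph.exists_amplitude_bound G W p hK
    exact QuantumGraph.integrableOn_schwartz_mul_of_bounded φ
      (QuantumGraph.measurable_amplitude G W p).aestronglyMeasurable fun k hk => hC k hk.le
  · rw [hsum.tsum_eq, hphase]
    exact ((QuantumGraph.tendsto_integral_amplitude φ hK).2.const_mul _).const_add _
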